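/- **Conventions.** Let $d\ge 1$. Let $\varphi\in C^\infty(\mathbb R^d;\mathbb R)$ be supported in $\{1/2\le|\xi|\le 2\}$ with $\sum_{j\in\mathbb Z}\varphi(2^{-j}\xi)=1$ for $\xi\ne0$, let $\Delta_j=\varphi(2^{-j}D)$ be the Littlewood–Paley blocks (Fourier multipliers), and let $\|u\|_{\dot B^s_q}=\big(\sum_{j\in\mathbb Z}2^{2js}\|\Delta_ju\|_{L^q}^2\big)^{1/2}$ be the homogeneous Besov norm (third index $2$). Let $\chi\in C_0^\infty(\mathbb R^d;\mathbb R)$ with $\chi=1$ on $|\xi|\le1$ and $\chi=0$ on $|\xi|\ge2$, let $P$ be the Fourier multiplier with symbol $\chi$ and $Q=\mathrm{Id}-P$. For $a,b\in\mathbb R$, $q\in[1,\infty]$ put $$\|u\|_{B^{a,b}_q}=\|Pu\|_{\dot B^a_q}+\|Qu\|_{\dot B^b_q},\qquad H^{a,b}=B^{a,b}_2 ;$$ $B^{a,b}_q$ is the set of tempered distributions $u$ with $\|u\|_{B^{a,b}_q}<\infty$ and $u=\sum_{j\in\mathbb Z}\Delta_ju$ in $\mathcal S'$. For tempered distributions $f,g,h$,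 put $S_N=\sum_{|j|\le N}\Delta_j$; $\int fgh\,dx$ denotes $\lim_{N\to\infty}\int_{\mathbb R^d} S_Nf\,S_Ng\,S_Nh\,dx$ whenever $S_Nf,S_Ng,S_Nh$ are functions with integrable product for every $N$ and the limit exists. **Lemma 4.1 (multiplicative property of the spaces $B^{a,b}_q$).** Let $p_1,p_2,p_3\in[2,\infty]$, $s_1,s_2,s_3,t_1,t_2,t_3\in\mathbb R$ and $b_a=1/p_a$ (with $1/\infty=0$). Assume that for $a=1,2,3$ $$\max(0,\,s_a,\,s_1+s_2+s_3)\le d(b_1+b_2+b_3-1)\le t_1+t_2+t_3,\qquad t_a\le t_1+t_2+t_3,\qquad s_a<d\,b_a .$$ Exclude the endpoint in which, for some permutation $(a,a',a'')$ of $(1,2,3)$, one has simultaneously $p_{a'}=p_{a''}=2$, $t_{a'}+t_{a''}=0$ and $t_a=d\,b_a$. Then there is a constant $C$, independent of $f,g,h$, such that for all $f\in B^{s_1,t_1}_{p_1}$, $g\in B^{s_2,t_2}_{p_2}$, $h\in B^{s_3,t_3}_{p_3}$ the integral $\int fgh\,dx$ exists in the above sense and $$\Big|\int_{\mathbb R^d}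 fgh\,dx\Big|\le C\,\|f\|_{B^{s_1,t_1}_{p_1}}\|g\|_{B^{s_2,t_2}_{p_2}}\|h\|_{B^{s_3,t_3}_{p_3}} .$$ It is the Lebesgue integral of $fgh$ whenever $f\in L^{r_1}$, $g\in L^{r_2}$, $h\in L^{r_3}$ with $1<r_1,r_2,r_3<\infty$ and $1/r_1+1/r_2+1/r_3=1$. **Bilinear estimates.** Let moreover $d\ge4$, $s=d/2-1$, $b=1/p=1-1/p'=1/2-1/d$, $1/q=1/2-1/(2d)$, and let $\sigma\in\mathbb R$ satisfy $|\sigma|-b\le d/2-2$. Then, for all real $j,k\ge0$ with $j+k\le1$, 1. $H^{\sigma-b,s-j}\times B^{\sigma-b,s-k}_p\subset B^{\sigma+b,s-j-k}_{p'}$, 2. $H^{\sigma,s}\times B^{\sigma-b,s-1}_p\subset H^{\sigma-b,s-1}$, 3. $B^{\sigma-b/2,s}_q\times B^{\sigma-b/2,s}_q\subset H^{\sigma,s}$, 4. $H^{\sigma,s}\times H^{\sigma,s}\subset B^{\sigma,s}_{p'}$, 5. $H^{\sigma,s}\times B^{\sigma-b/2,s}_q\subset H^{\sigma-1,s-1/2}$.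 Here $X\times Y\subset Z$ means: there is a constant $C$ such that all $f\in X$ and $g\in Y$ are locally integrable functions whose pointwise product $fg$ belongs to $Z$, with $\|fg\|_Z\le C\|f\|_X\|g\|_Y$. -/

import Mathlib

open MeasureTheory Filter Topology
open scoped SchwartzMap ENNReal NNReal ContDiff

namespace HybridBesov

variable {d : ℕ}

/-- The tempered distribution `u` is (integration against) the locally integrable function `F`.
Such an `F` is unique up to a null set. -/
def Represents (u : 𝓢'(EuclideanSpace ℝ (Fin d), ℂ)) (F : EuclideanSpace ℝ (Fin d) → ℂ) : Prop :=
  LocallyIntegrable F volume ∧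
    ∀ ψ : 𝓢(EuclideanSpace ℝ (Fin d), ℂ),
      Integrable (fun x => ψ x * F x) volume ∧ u ψ = ∫ x, ψ x * F x

/-- The `L^p` norm of a tempered distribution; it is `∞` unless the distribution is an `L^p`
function. -/
noncomputable def lpNorm (p : ℝ≥0∞) (u : 𝓢'(EuclideanSpace ℝ (Fin d), ℂ)) : ℝ≥0∞ :=
  ⨅ (F : EuclideanSpace ℝ (Fin d) → ℂ) (_ : Represents u F), eLpNorm F p volume

/-- The Fourier multiplier with symbol `m`, where `m` is a function of the frequency `ξ` of the
plane wave `exp (i x · ξ)`. Mathlib's Fourier transform uses `exp (2 π i x · ξ)`, which explains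
the rescaling by `2 π`. -/
noncomputable def multiplier (m : EuclideanSpace ℝ (Fin d) → ℝ) :
    𝓢'(EuclideanSpace ℝ (Fin d), ℂ) →L[ℂ] 𝓢'(EuclideanSpace ℝ (Fin d), ℂ) :=
  TemperedDistribution.fourierMultiplierCLM ℂ (fun ξ => ((m ((2 * Real.pi) • ξ) : ℝ) : ℂ))

/-- `χ ∈ C_0^∞` with `χ = 1` for `|ξ| ≤ 1` and `χ = 0` for `|ξ| ≥ 2`. -/
structure IsLowFreqCutoff (χ : EuclideanSpace ℝ (Fin d) → ℝ) : Prop where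
  smooth : ContDiff ℝ ∞ χ
  eq_one : ∀ ξ, ‖ξ‖ ≤ 1 → χ ξ = 1
  eq_zero : ∀ ξ, 2 ≤ ‖ξ‖ → χ ξ = 0

/-- `φ` generates a smooth homogeneous dyadic partition of unity `∑_j φ(2^{-j} ξ) = 1`, `ξ ≠ 0`,
with `φ` supported in `1/2 ≤ |ξ| ≤ 2`. -/
structure IsDyadicPartition (φ : EuclideanSpace ℝ (Fin d) → ℝ) : Prop where
  smooth : ContDiff ℝ ∞ φ
  support : ∀ ξ, φ ξ ≠ 0 → 1 / 2 ≤ ‖ξ‖ ∧ ‖ξ‖ ≤ 2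
  sum_eq_one : ∀ ξ, ξ ≠ 0 → HasSum (fun j : ℤ => φ ((2 : ℝ) ^ (-j) • ξ)) 1

/-- The Littlewood-Paley block `φ(2^{-j} D) u`. -/
noncomputable def block (φ : EuclideanSpace ℝ (Fin d) → ℝ) (j : ℤ)
    (u : 𝓢'(EuclideanSpace ℝ (Fin d), ℂ)) : 𝓢'(EuclideanSpace ℝ (Fin d), ℂ) :=
  multiplier (fun ξ => φ ((2 : ℝ) ^ (-j) • ξ)) u

/-- The homogeneous Besov norm of `Ḃ^s_{p,2}`. -/
noncomputable def homNorm (φ : EuclideanSpace ℝ (Fin d) → ℝ) (s : ℝ) (p : ℝ≥0∞)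
    (u : 𝓢'(EuclideanSpace ℝ (Fin d), ℂ)) : ℝ≥0∞ :=
  (∑' j : ℤ, (ENNReal.ofReal ((2 : ℝ) ^ ((j : ℝ) * s)) * lpNorm p (block φ j u)) ^ 2) ^
    (1 / 2 : ℝ)

/-- The indices of the space `B^{a,b}_q`: regularity `a` at low frequency, regularity `b` at high
frequency, Lebesgue exponent `q`. -/
structure Index where
  low : ℝ
  high : ℝ
  exponent : ℝ≥0∞

/-- The norm of `B^{a,b}_q`, namely `‖P u‖ + ‖Q u‖` with the norms of `Ḃ^a_{q,2}` and `Ḃ^b_{q,2}`,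
where `P` is the Fourier multiplier with symbol `χ` and `Q = Id - P`. -/
noncomputable def norm (χ φ : EuclideanSpace ℝ (Fin d) → ℝ) (i : Index)
    (u : 𝓢'(EuclideanSpace ℝ (Fin d), ℂ)) : ℝ≥0∞ :=
  homNorm φ i.low i.exponent (multiplier χ u) +
    homNorm φ i.high i.exponent (u - multiplier χ u)

/-- The space `B^{a,b}_q` as a space of tempered distributions. The norm does not see polynomials;
as usual for `a < d / q` the space is embedded into the tempered distributions by requiring that
`u` be the sum of its Littlewood-Paley blocks, with convergence in the tempered distributions. -/
def Mem (χ φ : EuclideanSpace ℝ (Fin d) → ℝ) (i : Index)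
    (u : 𝓢'(EuclideanSpace ℝ (Fin d), ℂ)) : Prop :=
  norm χ φ i u < ⊤ ∧ HasSum (fun j : ℤ => block φ j u) u

/-- The band-limited truncation `∑_{|j| ≤ N} φ(2^{-j} D) u`. -/
noncomputable def truncation (φ : EuclideanSpace ℝ (Fin d) → ℝ) (N : ℕ)
    (u : 𝓢'(EuclideanSpace ℝ (Fin d), ℂ)) : 𝓢'(EuclideanSpace ℝ (Fin d), ℂ) :=
  ∑ j ∈ Finset.Icc (-(N : ℤ)) (N : ℤ), block φ j u

/-- `∫ f₀ f₁ f₂ dx = I` for tempered distributions, through the Littlewood-Paley decomposition: the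
truncations are functions with integrable product, and the integrals converge to `I`. -/
def HasTripleIntegral (φ : EuclideanSpace ℝ (Fin d) → ℝ)
    (f : Fin 3 → 𝓢'(EuclideanSpace ℝ (Fin d), ℂ)) (I : ℂ) : Prop :=
  ∃ F : ℕ → Fin 3 → EuclideanSpace ℝ (Fin d) → ℂ,
    (∀ N a, Represents (truncation φ N (f a)) (F N a)) ∧
    (∀ N, Integrable (fun x => ∏ a, F N a x) volume) ∧
    Tendsto (fun N => ∫ x, ∏ a, F N a x) atTop (𝓝 I)

/-- The product estimate `B(i₁) × B(i₂) ⊂ B(i₃)`: members of the first two spaces are functions,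
their pointwise product belongs to the third space, and the norm inequality holds. -/
def ProductEstimate (χ φ : EuclideanSpace ℝ (Fin d) → ℝ) (i₁ i₂ i₃ : Index) : Prop :=
  ∃ C : ℝ≥0, ∀ f g : 𝓢'(EuclideanSpace ℝ (Fin d), ℂ), Mem χ φ i₁ f → Mem χ φ i₂ g →
    ∃ (u : 𝓢'(EuclideanSpace ℝ (Fin d), ℂ)) (F G : EuclideanSpace ℝ (Fin d) → ℂ),
      Represents f F ∧ Represents g G ∧ Represents u (fun x => F x * G x) ∧
      Mem χ φ i₃ u ∧ norm χ φ i₃ u ≤ C * norm χ φ i₁ f * norm χ φ i₂ g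

end HybridBesov

open FourierTransform

set_option linter.unusedSectionVars false

/-! Up to constants, the norm of B^{a,b}_q is a weighted ℓ²L^q norm of the blocks, with weight
2^{ja} for j ≤ 0 and 2^{jb} for j > 0 (`blockNorm`): P acts as the identity on the blocks j ≤ -1 and
as zero on the blocks j ≥ 2, so only j = 0, 1 are shared.

Trilinear estimate. Put A = d(b₁+b₂+b₃-1) and expand each factor into blocks. The integral of a
product of three blocks vanishes when one frequency dominates
(`integral_mul_mul_eq_zero_of_localized`), so the two largest frequencies are comparable and the sum
splits into three paraproducts, one for each choice of the lowest factor. If f is the lowest, Hölder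
places it in L^r with 1/r = 1 - 1/p₂ - 1/p₃; then A = d(1/p₁ - 1/r) is exactly the Sobolev loss from
L^{p₁} to L^r. The low-pass sums of f up to 2^k are bounded in L^r by ‖f‖ times the weight of
regularity (s₂+s₃, t₂+t₃) at k (`exists_lpNorm_lowpass_le`): this is where s₁ ≤ A and s₁+s₂+s₃ ≤ A
(low frequency), A ≤ t₁+t₂+t₃ and t₁ ≤ t₁+t₂+t₃ (high frequency) enter. Cauchy–Schwarz in k
concludes (`exists_sum_norm_integral_lowpass_le`).

The low-pass bound at equality cases rests on ℓ²L^r ⊂ L^r for 2 ≤ r < ∞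
(`exists_lpNorm_sum_le_sqrt`). It is proved without square functions: adding the block f_a to S
changes ‖S‖_r^r by at most r|∫|S|^{r-2} conj(S) f_a|, and the mean-zero kernel reproducing f_a
yields a gain 2^{j-a} against each lower block f_j. The resulting double sum is bounded in ℓ² by
Schur's test. The value r = ∞ occurs only for p₂ = p₃ = 2. There Cauchy–Schwarz in j replaces the
embedding, and s₁ < d/p₁ together with the excluded endpoint makes the geometric series converge.

Applied to tails, the same bound makes the truncated integrals Cauchy. The limit is the Lebesgue
integral on Hölder triples because the truncations are differences of two approximate identities and
converge in L^r for 1 < r < ∞ (`tendsto_eLpNorm_truncation_sub`).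

Bilinear estimates. By duality, the weighted norm of the blocks of a product is a trilinear form
whose third factor is built from norming functionals (`exists_besovSum_conv_mul_le`). Sobolev
embedding makes both factors honest functions, and Fatou passes from truncations to the full product
(`productEstimate_of_admissible`). Estimates 1–5 are then linear inequalities between indices. -/

namespace LittlewoodPaley

/-! ### Convolution, Young's inequality and adjoints -/

section

variable {E : Type*} [NormedAddCommGroup E] [InnerProductSpace ℝ E] [FiniteDimensional ℝ E]
  [MeasurableSpace E] [BorelSpace E]

/-- The convolution of `K` and `F`. -/
noncomputable def conv (K F : E → ℂ) (x : E) : ℂ := ∫ y, K (x - y) * F y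

theorem lintegral_sub_left (k : E → ℝ≥0∞) (x : E) : ∫⁻ y, k (x - y) = ∫⁻ y, k y :=
  lintegral_sub_left_eq_self k x

/-- Write k f = k^{1-1/p} (k f^p)^{1/p}, apply Hölder in y, and integrate in x by Tonelli. -/
theorem lintegral_conv_rpow_le {k f : E → ℝ≥0∞} (hk : Measurable k) (hf : AEMeasurable f)
    {p : ℝ} (hp : 1 ≤ p) :
    ∫⁻ x, (∫⁻ y, k (x - y) * f y) ^ p ≤ (∫⁻ y, k y) ^ p * ∫⁻ y, f y ^ p := by
  have hp0 : 0 < p := by linarith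
  have hpinv : p⁻¹ ≤ 1 := inv_le_one_of_one_le₀ hp
  have hinner : ∀ x, (∫⁻ y, k (x - y) * f y) ^ p ≤
      (∫⁻ y, k y) ^ (p - 1) * ∫⁻ y, k (x - y) * f y ^ p := by
    intro x
    have hkx : AEMeasurable (fun y => k (x - y)) := (hk.comp (measurable_const.sub measurable_id)).aemeasurable
    have h1 : ∫⁻ y, k (x - y) * f y ≤
        (∫⁻ y, k (x - y)) ^ (1 - p⁻¹) * (∫⁻ y, k (x - y) * f y ^ p) ^ p⁻¹ := by
      refine le_trans (le_of_eq ?_) (ENNReal.lintegral_mul_norm_pow_le hkx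
        (hkx.mul (hf.pow_const p)) (by linarith) (by positivity) (by ring))
      refine lintegral_congr fun y => ?_
      rw [Pi.mul_apply, ENNReal.mul_rpow_of_nonneg _ _ (by positivity), ← mul_assoc,
        ← ENNReal.rpow_add_of_nonneg _ _ (by linarith) (by positivity), ← ENNReal.rpow_mul,
        mul_inv_cancel₀ hp0.ne']
      simp
    rw [lintegral_sub_left] at h1
    calc _ ≤ ((∫⁻ y, k y) ^ (1 - p⁻¹) * (∫⁻ y, k (x - y) * f y ^ p) ^ p⁻¹) ^ p :=
          ENNReal.rpow_le_rpow h1 hp0.le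
      _ = _ := by
        rw [ENNReal.mul_rpow_of_nonneg _ _ hp0.le, ← ENNReal.rpow_mul, ← ENNReal.rpow_mul,
          inv_mul_cancel₀ hp0.ne', ENNReal.rpow_one, sub_mul, inv_mul_cancel₀ hp0.ne', one_mul]
  have hm : AEMeasurable (fun z : E × E => k (z.1 - z.2) * f z.2 ^ p) (volume.prod volume) :=
    (hk.comp (measurable_fst.sub measurable_snd)).aemeasurable.mul
      ((hf.pow_const p).comp_snd)
  calc _ ≤ ∫⁻ x, (∫⁻ y, k y) ^ (p - 1) * ∫⁻ y, k (x - y) * f y ^ p := lintegral_mono hinner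
    _ = (∫⁻ y, k y) ^ (p - 1) * ∫⁻ x, ∫⁻ y, k (x - y) * f y ^ p :=
        lintegral_const_mul'' _ hm.lintegral_prod_right'
    _ = (∫⁻ y, k y) ^ (p - 1) * ∫⁻ y, ∫⁻ x, k (x - y) * f y ^ p := by
        rw [lintegral_lintegral_swap hm]
    _ = (∫⁻ y, k y) ^ (p - 1) * ∫⁻ y, (∫⁻ x, k x) * f y ^ p := by
        congr 1
        refine lintegral_congr fun y => ?_
        rw [lintegral_mul_const'' _ (by fun_prop),
          lintegral_sub_right_eq_self k y]
    _ = _ := by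
        rw [lintegral_const_mul'' _ (hf.pow_const p), ← mul_assoc]
        congr 1
        nth_rewrite 2 [← ENNReal.rpow_one (∫⁻ y, k y)]
        rw [← ENNReal.rpow_add_of_nonneg _ _ (by linarith) (by norm_num)]
        congr 1; ring

theorem enorm_conv_le (K F : E → ℂ) (x : E) : ‖conv K F x‖ₑ ≤ ∫⁻ y, ‖K (x - y)‖ₑ * ‖F y‖ₑ := by
  refine (enorm_integral_le_lintegral_enorm _).trans (le_of_eq ?_)
  simp

theorem aestronglyMeasurable_conv {K : E → ℂ} (hK : Continuous K) {F : E → ℂ}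
    (hF : AEStronglyMeasurable F volume) : AEStronglyMeasurable (conv K F) volume := by
  have : AEStronglyMeasurable (fun z : E × E => K (z.1 - z.2) * F z.2) (volume.prod volume) :=
    (hK.comp (continuous_fst.sub continuous_snd)).aestronglyMeasurable.mul hF.comp_snd
  exact this.integral_prod_right'

/-- Young's inequality for convolution with an integrable kernel. -/
theorem eLpNorm_conv_le {K : E → ℂ} (hK : Continuous K) {F : E → ℂ} (hF : AEStronglyMeasurable F volume)
    {p : ℝ≥0∞} (hp : 1 ≤ p) :
    eLpNorm (conv K F) p volume ≤ eLpNorm K 1 volume * eLpNorm F p volume := by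
  have hk : Measurable fun x => ‖K x‖ₑ := hK.measurable.enorm
  rcases eq_or_ne p ⊤ with rfl | hpt
  · rw [eLpNorm_exponent_top, eLpNorm_exponent_top]
    refine eLpNormEssSup_le_of_ae_enorm_bound (ae_of_all _ fun x => ?_)
    refine (enorm_conv_le _ _ x).trans ?_
    calc _ ≤ ∫⁻ y, ‖K (x - y)‖ₑ * eLpNormEssSup F volume := by
          refine lintegral_mono_ae ?_
          filter_upwards [enorm_ae_le_eLpNormEssSup F volume] with y hy
          gcongr
      _ = _ := by
          rw [lintegral_mul_const'' _ (by fun_prop),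
            lintegral_sub_left_eq_self (fun y => ‖K y‖ₑ) x, eLpNorm_one_eq_lintegral_enorm]
  · have hp0 : p ≠ 0 := (zero_lt_one.trans_le hp).ne'
    have hpr : 1 ≤ p.toReal := by
      rw [← ENNReal.toReal_one]; exact ENNReal.toReal_mono hpt hp
    rw [eLpNorm_eq_lintegral_rpow_enorm_toReal hp0 hpt, eLpNorm_eq_lintegral_rpow_enorm_toReal hp0 hpt,
      eLpNorm_one_eq_lintegral_enorm]
    calc _ ≤ ((∫⁻ y, ‖K y‖ₑ) ^ p.toReal * ∫⁻ y, ‖F y‖ₑ ^ p.toReal) ^ (1 / p.toReal) := by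
          refine ENNReal.rpow_le_rpow ?_ (by positivity)
          refine le_trans (lintegral_mono fun x => ?_)
            (lintegral_conv_rpow_le hk hF.enorm hpr)
          exact ENNReal.rpow_le_rpow (enorm_conv_le _ _ x) (by positivity)
      _ = _ := by
          rw [ENNReal.mul_rpow_of_nonneg _ _ (by positivity), ← ENNReal.rpow_mul,
            mul_one_div_cancel (by linarith), ENNReal.rpow_one]

theorem memLp_conv {K F : E → ℂ} (hK : Continuous K) (hK1 : Integrable K volume) {p : ℝ≥0∞}
    (hp : 1 ≤ p) (hF : MemLp F p volume) : MemLp (conv K F) p volume := by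
  refine ⟨aestronglyMeasurable_conv hK hF.1, (eLpNorm_conv_le hK hF.1 hp).trans_lt ?_⟩
  exact ENNReal.mul_lt_top (memLp_one_iff_integrable.2 hK1).2 hF.2

theorem eLpNorm_mul_le {f g : E → ℂ} {p q r : ℝ≥0∞} [hpqr : p.HolderTriple q r]
    (hf : AEStronglyMeasurable f volume) (hg : AEStronglyMeasurable g volume) :
    eLpNorm (fun x => f x * g x) r volume ≤ eLpNorm f p volume * eLpNorm g q volume :=
  eLpNorm_smul_le_mul_eLpNorm (φ := f) (f := g) hg hf

/-- Reflection `x ↦ K (-x)`. -/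
noncomputable def reflect (K : 𝓢(E, ℂ)) : 𝓢(E, ℂ) :=
  SchwartzMap.compCLMOfContinuousLinearEquiv ℂ (ContinuousLinearEquiv.neg ℝ) K

@[simp] theorem reflect_apply (K : 𝓢(E, ℂ)) (x : E) : reflect K x = K (-x) := rfl

/-- Translation `x ↦ K (x - y)`. -/
noncomputable def translate (y : E) (K : 𝓢(E, ℂ)) : 𝓢(E, ℂ) :=
  SchwartzMap.compSubConstCLM ℂ y K

@[simp] theorem translate_apply (y : E) (K : 𝓢(E, ℂ)) (x : E) : translate y K x = K (x - y) := by
  simp [translate]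

theorem conv_eq_integral_translate (K : 𝓢(E, ℂ)) (F : E → ℂ) (x : E) :
    conv K F x = ∫ y, translate x (reflect K) y * F y := by
  simp [conv]

theorem eLpNorm_translate (y : E) (K : 𝓢(E, ℂ)) (p : ℝ≥0∞) :
    eLpNorm (translate y K) p volume = eLpNorm K p volume := by
  have := eLpNorm_comp_measurePreserving (p := p) K.continuous.aestronglyMeasurable
    (measurePreserving_sub_right (volume : Measure E) y)
  rw [← this]; congr 1

theorem eLpNorm_reflect (K : 𝓢(E, ℂ)) (p : ℝ≥0∞) :
    eLpNorm (reflect K) p volume = eLpNorm K p volume := by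
  have := eLpNorm_comp_measurePreserving (p := p) K.continuous.aestronglyMeasurable
    (Measure.measurePreserving_neg (volume : Measure E))
  rw [← this]; congr 1

theorem integrable_kernel_mul (K : 𝓢(E, ℂ)) {F : E → ℂ} {p : ℝ≥0∞} (hp : 1 ≤ p)
    (hF : MemLp F p volume) (x : E) : Integrable (fun y => K (x - y) * F y) volume := by
  have := ENNReal.HolderConjugate.inv_one_sub_inv' hp
  have h := hF.mul' ((translate x (reflect K)).memLp (1 - p⁻¹)⁻¹ volume) (r := 1)
  rw [memLp_one_iff_integrable] at h
  simpa using h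

theorem enorm_conv_le_eLpNorm_mul (K : 𝓢(E, ℂ)) {F : E → ℂ} {p q : ℝ≥0∞}
    [p.HolderConjugate q] (hF : AEStronglyMeasurable F volume) (x : E) :
    ‖conv K F x‖ₑ ≤ eLpNorm K q volume * eLpNorm F p volume := by
  have : ENNReal.HolderTriple q p 1 := ENNReal.HolderTriple.symm
  rw [conv_eq_integral_translate]
  refine (enorm_integral_le_lintegral_enorm _).trans ?_
  rw [← eLpNorm_one_eq_lintegral_enorm, ← eLpNorm_reflect K, ← eLpNorm_translate x (reflect K)]
  exact eLpNorm_mul_le (translate x (reflect K)).continuous.aestronglyMeasurable hF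

/-- Log-convexity of the Lebesgue norms, with one endpoint equal to `∞`. -/
theorem eLpNorm_le_interpolate {F : E → ℂ} (hF : AEStronglyMeasurable F volume) {p r : ℝ≥0∞}
    (hp : 1 ≤ p) (hpr : p ≤ r) :
    eLpNorm F r volume ≤ eLpNorm F p volume ^ (p.toReal * r⁻¹.toReal) *
      eLpNorm F ⊤ volume ^ (1 - p.toReal * r⁻¹.toReal) := by
  rcases eq_or_ne r ⊤ with rfl | hr
  · simp
  have hpt : p ≠ ⊤ := ne_top_of_le_ne_top hr hpr
  have hp0 : p ≠ 0 := (zero_lt_one.trans_le hp).ne'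
  have hr0 : r ≠ 0 := (zero_lt_one.trans_le (hp.trans hpr)).ne'
  have hpp : 0 < p.toReal := ENNReal.toReal_pos hp0 hpt
  have hrr : 0 < r.toReal := ENNReal.toReal_pos hr0 hr
  have hprr : p.toReal ≤ r.toReal := ENNReal.toReal_mono hr hpr
  rw [eLpNorm_eq_lintegral_rpow_enorm_toReal hr0 hr, eLpNorm_eq_lintegral_rpow_enorm_toReal hp0 hpt,
    ENNReal.toReal_inv]
  have h1 : ∫⁻ x, ‖F x‖ₑ ^ r.toReal ≤
      eLpNorm F ⊤ volume ^ (r.toReal - p.toReal) * ∫⁻ x, ‖F x‖ₑ ^ p.toReal := by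
    rw [← lintegral_const_mul'' _ (hF.enorm.pow_const _)]
    refine lintegral_mono_ae ?_
    rw [eLpNorm_exponent_top]
    filter_upwards [enorm_ae_le_eLpNormEssSup F volume] with x hx
    calc ‖F x‖ₑ ^ r.toReal = ‖F x‖ₑ ^ (r.toReal - p.toReal) * ‖F x‖ₑ ^ p.toReal := by
          rw [← ENNReal.rpow_add_of_nonneg _ _ (by linarith) (by linarith)]; ring_nf
      _ ≤ _ := by gcongr
  refine (ENNReal.rpow_le_rpow h1 (by positivity)).trans (le_of_eq ?_)
  rw [ENNReal.mul_rpow_of_nonneg _ _ (by positivity), ← ENNReal.rpow_mul, ← ENNReal.rpow_mul, mul_comm]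
  congr 2
  · rw [← mul_assoc, one_div_mul_cancel hpp.ne', one_mul, one_div]
  · rw [sub_mul, mul_one_div_cancel hrr.ne', one_div]

/-- Convolution with `K` and with its reflection are adjoint to each other. -/
theorem integral_conv_mul (K : 𝓢(E, ℂ)) {F G : E → ℂ} {p q : ℝ≥0∞} [hpq : p.HolderConjugate q]
    (hF : MemLp F p volume) (hG : MemLp G q volume) :
    ∫ x, conv K F x * G x = ∫ y, F y * conv (reflect K) G y := by
  have hp : 1 ≤ p := ENNReal.HolderConjugate.one_le p q
  have hint : Integrable (fun z : E × E => K (z.1 - z.2) * F z.2 * G z.1)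
      (volume.prod volume) := by
    have hm : AEStronglyMeasurable (fun z : E × E => K (z.1 - z.2) * F z.2 * G z.1)
        (volume.prod volume) :=
      ((K.continuous.comp (continuous_fst.sub continuous_snd)).aestronglyMeasurable.mul
        hF.1.comp_snd).mul hG.1.comp_fst
    rw [integrable_prod_iff hm]
    refine ⟨ae_of_all _ fun x => (integrable_kernel_mul K hp hF x).mul_const (G x), ?_⟩
    have hK : Continuous fun x => ((‖K x‖ : ℝ) : ℂ) := by
      have := K.continuous; fun_prop
    -- Convolving the absolute values gives an L^p function, so its product with G is integrable;
    -- this is the absolute convergence needed for Fubini.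
    have h1 : MemLp (conv (fun x => ((‖K x‖ : ℝ) : ℂ)) (fun x => ((‖F x‖ : ℝ) : ℂ))) p volume :=
      memLp_conv hK K.integrable.norm.ofReal hp hF.norm.ofReal
    have h2 := (h1.mul' hG (r := 1))
    rw [memLp_one_iff_integrable] at h2
    refine h2.norm.congr (ae_of_all _ fun x => ?_)
    have h3 : conv (fun x => ((‖K x‖ : ℝ) : ℂ)) (fun x => ((‖F x‖ : ℝ) : ℂ)) x =
        ((∫ y, ‖K (x - y)‖ * ‖F y‖ : ℝ) : ℂ) := by
      rw [conv, ← integral_complex_ofReal]; simp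
    have h4 : (0 : ℝ) ≤ ∫ y, ‖K (x - y)‖ * ‖F y‖ := integral_nonneg fun y => by positivity
    beta_reduce
    rw [h3, norm_mul, Complex.norm_real, Real.norm_of_nonneg h4, mul_comm, ← integral_mul_const]
    simp
  calc ∫ x, conv K F x * G x = ∫ x, ∫ y, K (x - y) * F y * G x := by
        simp_rw [conv, ← integral_mul_const]
    _ = ∫ y, ∫ x, K (x - y) * F y * G x := integral_integral_swap hint
    _ = _ := by
        refine integral_congr_ae (ae_of_all _ fun y => ?_)
        simp only [conv, reflect_apply, neg_sub, ← integral_const_mul]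
        congr 1; ext x; ring

end

/-! ### Dyadic dilations, Bernstein's inequality and translations -/

section

variable {E : Type*} [NormedAddCommGroup E] [InnerProductSpace ℝ E] [FiniteDimensional ℝ E]
  [MeasurableSpace E] [BorelSpace E]

/-- The `L¹`-normalized dyadic dilation `x ↦ 2^{jd} K (2^j x)`. -/
noncomputable def dil (j : ℤ) (K : 𝓢(E, ℂ)) : 𝓢(E, ℂ) :=
  ((((2 : ℝ) ^ j) ^ Module.finrank ℝ E : ℝ) : ℂ) •
    SchwartzMap.compCLMOfContinuousLinearEquiv ℂ
      (ContinuousLinearEquiv.smulLeft (R₁ := ℝ) (M₁ := E)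
        (Units.mk0 ((2 : ℝ) ^ j) (by positivity))) K

theorem dil_apply (j : ℤ) (K : 𝓢(E, ℂ)) (x : E) :
    dil j K x = ((((2 : ℝ) ^ j) ^ Module.finrank ℝ E : ℝ) : ℂ) * K ((2 : ℝ) ^ j • x) := rfl

theorem integral_dilate {F : Type*} [NormedAddCommGroup F] [NormedSpace ℝ F] (j : ℤ) (f : E → F) :
    ∫ x, ((2 : ℝ) ^ j) ^ Module.finrank ℝ E • f ((2 : ℝ) ^ j • x) = ∫ x, f x := by
  rw [integral_smul, Measure.integral_comp_smul_of_nonneg volume f ((2 : ℝ) ^ j)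
    (hR := by positivity), smul_smul, mul_inv_cancel₀ (by positivity), one_smul]

theorem norm_dil_apply (j : ℤ) (K : 𝓢(E, ℂ)) (x : E) :
    ‖dil j K x‖ = ((2 : ℝ) ^ j) ^ Module.finrank ℝ E * ‖K ((2 : ℝ) ^ j • x)‖ := by
  rw [dil_apply, norm_mul, Complex.norm_real, Real.norm_of_nonneg (by positivity)]

theorem integral_norm_dil (j : ℤ) (K : 𝓢(E, ℂ)) : ∫ x, ‖dil j K x‖ = ∫ x, ‖K x‖ := by
  simp_rw [norm_dil_apply]
  exact integral_dilate j fun x => ‖K x‖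

theorem integral_norm_dil_mul_norm (j : ℤ) (K : 𝓢(E, ℂ)) :
    ∫ x, ‖dil j K x‖ * ‖x‖ = ((2 : ℝ) ^ j)⁻¹ * ∫ x, ‖K x‖ * ‖x‖ := by
  rw [← integral_dilate j fun x => ‖K x‖ * ‖x‖, ← integral_const_mul]
  congr 1; ext x
  have : (0 : ℝ) < 2 ^ j := by positivity
  rw [norm_dil_apply, norm_smul, Real.norm_of_nonneg this.le, smul_eq_mul]
  field_simp

theorem integral_dil (j : ℤ) (K : 𝓢(E, ℂ)) : ∫ x, dil j K x = ∫ x, K x := by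
  rw [← integral_dilate j fun x => K x]
  simp_rw [dil_apply, Complex.real_smul]

theorem eLpNorm_one_eq_ofReal (K : 𝓢(E, ℂ)) :
    eLpNorm K 1 volume = ENNReal.ofReal (∫ x, ‖K x‖) := by
  rw [eLpNorm_one_eq_lintegral_enorm, ofReal_integral_norm_eq_lintegral_enorm K.integrable]

theorem eLpNorm_one_dil (j : ℤ) (K : 𝓢(E, ℂ)) :
    eLpNorm (dil j K) 1 volume = eLpNorm K 1 volume := by
  rw [eLpNorm_one_eq_ofReal, integral_norm_dil, ← eLpNorm_one_eq_ofReal]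

/-- A bound for the supremum of a Schwartz function. -/
noncomputable def supBound (K : 𝓢(E, ℂ)) : ℝ := SchwartzMap.seminorm ℝ 0 0 K

theorem norm_le_supBound (K : 𝓢(E, ℂ)) (x : E) : ‖K x‖ ≤ supBound K :=
  SchwartzMap.norm_le_seminorm ℝ K x

theorem supBound_nonneg (K : 𝓢(E, ℂ)) : 0 ≤ supBound K := (norm_nonneg _).trans (norm_le_supBound K 0)

theorem eLpNorm_top_dil_le (j : ℤ) (K : 𝓢(E, ℂ)) :
    eLpNorm (dil j K) ⊤ volume ≤ ENNReal.ofReal (((2 : ℝ) ^ j) ^ Module.finrank ℝ E * supBound K) := by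
  rw [eLpNorm_exponent_top]
  refine eLpNormEssSup_le_of_ae_bound (ae_of_all _ fun x => ?_)
  rw [norm_dil_apply]
  gcongr
  exact norm_le_supBound K _

/-- The `L^q` norm of a dilated kernel. -/
theorem exists_eLpNorm_dil_le (K : 𝓢(E, ℂ)) (q : ℝ≥0∞) (hq : 1 ≤ q) :
    ∃ C : ℝ≥0, ∀ j : ℤ, eLpNorm (dil j K) q volume ≤
      C * ENNReal.ofReal ((2 : ℝ) ^ ((j : ℝ) * (Module.finrank ℝ E * (1 - q⁻¹.toReal)))) := by
  set θ : ℝ := q⁻¹.toReal with hθ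
  have hθ0 : 0 ≤ θ := ENNReal.toReal_nonneg
  have hθ1 : θ ≤ 1 := by
    rw [hθ, ← ENNReal.toReal_one]
    exact ENNReal.toReal_mono ENNReal.one_ne_top (ENNReal.inv_le_one.2 hq)
  have hI : 0 ≤ ∫ x, ‖K x‖ := integral_nonneg fun x => norm_nonneg _
  refine ⟨Real.toNNReal ((∫ x, ‖K x‖) ^ θ * supBound K ^ (1 - θ)), fun j => ?_⟩
  refine (eLpNorm_le_interpolate (dil j K).continuous.aestronglyMeasurable le_rfl hq).trans ?_
  rw [eLpNorm_one_dil, ENNReal.toReal_one, one_mul, ← hθ, eLpNorm_one_eq_ofReal]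
  calc _ ≤ ENNReal.ofReal (∫ x, ‖K x‖) ^ θ *
        ENNReal.ofReal (((2 : ℝ) ^ j) ^ Module.finrank ℝ E * supBound K) ^ (1 - θ) := by
        gcongr
        exact eLpNorm_top_dil_le j K
    _ = _ := by
      have h2 : 0 ≤ ((2 : ℝ) ^ j) ^ Module.finrank ℝ E * supBound K :=
        mul_nonneg (by positivity) (supBound_nonneg K)
      rw [ENNReal.ofReal_rpow_of_nonneg hI hθ0, ENNReal.ofReal_rpow_of_nonneg h2 (by linarith),
        ← ENNReal.ofReal_mul (by positivity), ENNReal.ofNNReal_toNNReal,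
        ← ENNReal.ofReal_mul (mul_nonneg (by positivity) (Real.rpow_nonneg (supBound_nonneg K) _))]
      congr 1
      rw [Real.mul_rpow (by positivity) (supBound_nonneg K), ← Real.rpow_natCast, ← Real.rpow_intCast,
        ← Real.rpow_mul (by positivity), ← Real.rpow_mul (by norm_num)]
      ring_nf

/-- Bernstein's inequality for convolution with a dilated kernel. -/
theorem exists_eLpNorm_conv_dil_le (K : 𝓢(E, ℂ)) (p r : ℝ≥0∞) (hp : 1 ≤ p) (hpr : p ≤ r) :
    ∃ C : ℝ≥0, ∀ (j : ℤ) (F : E → ℂ), AEStronglyMeasurable F volume →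
      eLpNorm (conv (dil j K) F) r volume ≤
      C * ENNReal.ofReal ((2 : ℝ) ^ ((j : ℝ) * (Module.finrank ℝ E * (p⁻¹.toReal - r⁻¹.toReal)))) *
        eLpNorm F p volume := by
  have hpq := ENNReal.HolderConjugate.inv_one_sub_inv' hp
  set q : ℝ≥0∞ := (1 - p⁻¹)⁻¹ with hq
  have hq1 : 1 ≤ q := by simp [hq]
  have hpi : p⁻¹ ≤ 1 := ENNReal.inv_le_one.2 hp
  have hqr : 1 - q⁻¹.toReal = p⁻¹.toReal := by
    rw [hq, inv_inv, ENNReal.toReal_sub_of_le hpi ENNReal.one_ne_top, ENNReal.toReal_one]; ring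
  obtain ⟨C, hC⟩ := exists_eLpNorm_dil_le K q hq1
  -- The interpolation parameter p/r between L^p → L^p (Young) and L^p → L^∞ (Hölder against the
  -- conjugate norm of the kernel). For p = ∞ the convention `⊤.toReal = 0` gives τ = 0, which is
  -- the right value because then r = ∞.
  set τ : ℝ := p.toReal * r⁻¹.toReal with hτ
  have hτ0 : 0 ≤ τ := by positivity
  have hτ1 : τ ≤ 1 := by
    rcases eq_or_ne p ⊤ with rfl | hpt
    · simp [hτ]
    have hp0 : p ≠ 0 := (zero_lt_one.trans_le hp).ne'
    calc τ ≤ p.toReal * p⁻¹.toReal := by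
          rw [hτ]; gcongr
          exact ENNReal.inv_ne_top.2 hp0
      _ = 1 := by
          rw [ENNReal.toReal_inv, mul_inv_cancel₀ (ENNReal.toReal_pos hp0 hpt).ne']
  have hexp : p⁻¹.toReal * (1 - τ) = p⁻¹.toReal - r⁻¹.toReal := by
    rcases eq_or_ne p ⊤ with rfl | hpt
    · have : r = ⊤ := top_le_iff.1 hpr
      simp [this]
    have hp0 : p ≠ 0 := (zero_lt_one.trans_le hp).ne'
    have := (ENNReal.toReal_pos hp0 hpt).ne'
    rw [hτ, ENNReal.toReal_inv p]; field_simp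
  refine ⟨Real.toNNReal ((∫ x, ‖K x‖) ^ τ * (C : ℝ) ^ (1 - τ)), fun j F hF => ?_⟩
  have hI : 0 ≤ ∫ x, ‖K x‖ := integral_nonneg fun x => norm_nonneg _
  refine (eLpNorm_le_interpolate (aestronglyMeasurable_conv (dil j K).continuous hF) hp hpr).trans ?_
  rw [← hτ]
  have h1 : eLpNorm (conv (dil j K) F) p volume ≤
      ENNReal.ofReal (∫ x, ‖K x‖) * eLpNorm F p volume := by
    rw [← eLpNorm_one_eq_ofReal, ← eLpNorm_one_dil j K]
    exact eLpNorm_conv_le (dil j K).continuous hF hp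
  have h2 : eLpNorm (conv (dil j K) F) ⊤ volume ≤
      ENNReal.ofReal (C * (2 : ℝ) ^ ((j : ℝ) * (Module.finrank ℝ E * p⁻¹.toReal))) * eLpNorm F p volume := by
    rw [eLpNorm_exponent_top]
    refine eLpNormEssSup_le_of_ae_enorm_bound (ae_of_all _ fun x => ?_)
    refine (enorm_conv_le_eLpNorm_mul (p := p) (q := q) (dil j K) hF x).trans ?_
    gcongr
    rw [ENNReal.ofReal_mul C.coe_nonneg, ENNReal.ofReal_coe_nnreal, ← hqr]
    exact hC j
  calc _ ≤ (ENNReal.ofReal (∫ x, ‖K x‖) * eLpNorm F p volume) ^ τ *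
        (ENNReal.ofReal (C * (2 : ℝ) ^ ((j : ℝ) * (Module.finrank ℝ E * p⁻¹.toReal))) * eLpNorm F p volume) ^ (1 - τ) := by
        gcongr
    _ = _ := by
      rw [ENNReal.mul_rpow_of_nonneg _ _ hτ0, ENNReal.mul_rpow_of_nonneg _ _ (by linarith),
        mul_mul_mul_comm, ← ENNReal.rpow_add_of_nonneg _ _ hτ0 (by linarith), add_sub_cancel,
        ENNReal.rpow_one]
      congr 1
      rw [ENNReal.ofReal_rpow_of_nonneg hI hτ0, ENNReal.ofReal_rpow_of_nonneg (by positivity) (by linarith),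
        ← ENNReal.ofReal_mul (by positivity), ENNReal.ofNNReal_toNNReal,
        ← ENNReal.ofReal_mul (by positivity)]
      congr 1
      rw [Real.mul_rpow (by positivity) (by positivity), ← Real.rpow_mul (by norm_num), ← hexp]
      ring_nf

/-- The increment is the integral of the derivative along the segment; by Fubini and translation
invariance the constant is the L¹ norm of the derivative. -/
theorem exists_integral_norm_sub_translate_le (K : 𝓢(E, ℂ)) :
    ∃ C : ℝ, 0 ≤ C ∧ ∀ y : E, ∫ x, ‖K x - K (x - y)‖ ≤ C * ‖y‖ := by
  set D := SchwartzMap.fderivCLM ℝ E ℂ K with hD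
  refine ⟨∫ x, ‖D x‖, integral_nonneg fun x => norm_nonneg _, fun y => ?_⟩
  have hftc : ∀ x, K x - K (x - y) = ∫ t in (0:ℝ)..1, D (x - y + t • y) y := by
    intro x
    have hder : ∀ t ∈ Set.uIcc (0:ℝ) 1, HasDerivAt (fun t : ℝ => K (x - y + t • y))
        (D (x - y + t • y) y) t := by
      intro t _
      have h1 : HasFDerivAt K (D (x - y + t • y)) (x - y + t • y) :=
        (K.differentiable _).hasFDerivAt
      have h2 : HasDerivAt (fun t : ℝ => x - y + t • y) y t := by
        simpa using ((hasDerivAt_id t).smul_const y).const_add (x - y)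
      exact h1.comp_hasDerivAt t h2
    have hc : Continuous fun t : ℝ => D (x - y + t • y) y := by
      have := D.continuous
      fun_prop
    rw [intervalIntegral.integral_eq_sub_of_hasDerivAt hder (hc.intervalIntegrable _ _)]
    simp
  have hDint : Integrable D volume := D.integrable
  have hmeas : AEStronglyMeasurable (fun z : E × ℝ => ‖D (z.1 - y + z.2 • y)‖ * ‖y‖)
      (volume.prod (volume.restrict (Set.Ioc (0:ℝ) 1))) := by
    have := D.continuous
    exact Continuous.aestronglyMeasurable (by fun_prop)
  have hint : Integrable (fun z : E × ℝ => ‖D (z.1 - y + z.2 • y)‖ * ‖y‖)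
      (volume.prod (volume.restrict (Set.Ioc (0:ℝ) 1))) := by
    rw [integrable_prod_iff' hmeas]
    have hsh : ∀ t : ℝ, Integrable (fun x => ‖D (x - y + t • y)‖ * ‖y‖) volume := fun t => by
      have := (hDint.comp_add_right (t • y - y)).norm.mul_const ‖y‖
      refine this.congr (ae_of_all _ fun x => ?_)
      simp only; congr 3; abel
    refine ⟨ae_of_all _ hsh, ?_⟩
    have : ∀ t : ℝ, ∫ x, ‖‖D (x - y + t • y)‖ * ‖y‖‖ = (∫ x, ‖D x‖) * ‖y‖ := fun t => by
      simp_rw [norm_mul, norm_norm, integral_mul_const]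
      rw [← integral_add_right_eq_self (fun x => ‖D x‖) (t • y - y)]
      congr 3; ext x; congr 2; abel
    simp_rw [this]
    exact integrable_const _
  calc ∫ x, ‖K x - K (x - y)‖ ≤ ∫ x, ∫ t in Set.Ioc (0:ℝ) 1, ‖D (x - y + t • y)‖ * ‖y‖ := by
        refine integral_mono_of_nonneg (ae_of_all _ fun x => norm_nonneg _) hint.integral_prod_left
          (ae_of_all _ fun x => ?_)
        simp only [hftc x]
        rw [intervalIntegral.integral_of_le zero_le_one]
        refine norm_integral_le_of_norm_le ?_ (ae_of_all _ fun t => (D (x - y + t • y)).le_opNorm y)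
        have : Continuous fun t : ℝ => ‖D (x - y + t • y)‖ * ‖y‖ := by
          have := D.continuous
          fun_prop
        exact (this.integrableOn_Icc (a := 0) (b := 1)).mono_set Set.Ioc_subset_Icc_self
    _ = ∫ t in Set.Ioc (0:ℝ) 1, ∫ x, ‖D (x - y + t • y)‖ * ‖y‖ := integral_integral_swap hint
    _ = ∫ t in Set.Ioc (0:ℝ) 1, (∫ x, ‖D x‖) * ‖y‖ := by
        congr 1; ext t
        rw [integral_mul_const, ← integral_add_right_eq_self (fun x => ‖D x‖) (t • y - y)]
        congr 3; ext x; congr 2; abel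
    _ = _ := by simp

/-- The difference is a convolution with the kernel minus its translate. Rescaling turns the shift y
into 2^j y, so functions of frequency 2^j oscillate slowly below the scale 2^{-j}. -/
theorem exists_eLpNorm_conv_sub_translate_le (K : 𝓢(E, ℂ)) :
    ∃ C : ℝ≥0, ∀ (j : ℤ) (p : ℝ≥0∞) (F : E → ℂ) (y : E), 1 ≤ p → MemLp F p volume →
      eLpNorm (fun x => conv (dil j K) F x - conv (dil j K) F (x - y)) p volume ≤
        C * ENNReal.ofReal ((2 : ℝ) ^ j * ‖y‖) * eLpNorm F p volume := by
  obtain ⟨C, hC0, hC⟩ := exists_integral_norm_sub_translate_le K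
  refine ⟨C.toNNReal, fun j p F y hp hF => ?_⟩
  have h1 : (fun x => conv (dil j K) F x - conv (dil j K) F (x - y)) =
      conv (dil j K - translate y (dil j K)) F := by
    ext x
    rw [conv, conv, conv, ← integral_sub (integrable_kernel_mul _ hp hF x)
      (integrable_kernel_mul _ hp hF _)]
    congr 1; ext z
    rw [← sub_mul]; congr 1
    simp only [sub_apply, translate_apply]
    congr 2; abel
  rw [h1]
  refine (eLpNorm_conv_le (SchwartzMap.continuous _) hF.1 hp).trans ?_
  gcongr
  rw [eLpNorm_one_eq_ofReal, ENNReal.ofNNReal_toNNReal, ← ENNReal.ofReal_mul hC0]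
  apply ENNReal.ofReal_le_ofReal
  have h2 := hC ((2 : ℝ) ^ j • y)
  rw [norm_smul, Real.norm_of_nonneg (by positivity), ← integral_dilate j] at h2
  refine le_trans (le_of_eq ?_) h2
  congr 1; ext x
  rw [sub_apply, translate_apply, dil_apply, dil_apply, ← mul_sub, norm_mul,
    Complex.norm_real, Real.norm_of_nonneg (by positivity), smul_sub, smul_eq_mul]

end

/-! ### Fourier side: triple products with incompatible frequencies -/

section

variable {E : Type*} [NormedAddCommGroup E] [InnerProductSpace ℝ E] [FiniteDimensional ℝ E]
  [MeasurableSpace E] [BorelSpace E]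

theorem fourier_dil (j : ℤ) (K : 𝓢(E, ℂ)) (ξ : E) :
    𝓕 (dil j K) ξ = 𝓕 K ((2 : ℝ) ^ (-j) • ξ) := by
  rw [SchwartzMap.fourier_coe, SchwartzMap.fourier_coe, Real.fourier_eq, Real.fourier_eq,
    ← integral_dilate j fun v => Real.fourierChar (-inner ℝ v ((2 : ℝ) ^ (-j) • ξ)) • K v]
  congr 1; ext v
  have h2 : (2 : ℝ) ^ j ≠ 0 := by positivity
  rw [inner_smul_left, inner_smul_right, dil_apply, smul_comm, Complex.real_smul, Circle.smul_def,
    Circle.smul_def]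
  simp [zpow_neg, h2]

theorem fourier_translate_eq_zero {K : 𝓢(E, ℂ)} {ξ : E} (h : 𝓕 K ξ = 0) (y : E) :
    𝓕 (LittlewoodPaley.translate y K) ξ = 0 := by
  rw [SchwartzMap.fourier_coe] at h ⊢
  have := congrFun (VectorFourier.fourierIntegral_comp_add_right Real.fourierChar volume (innerₗ E) K (-y)) ξ
  have h3 : (⇑(LittlewoodPaley.translate y K)) = K ∘ fun v => v + -y := by
    ext x; rw [translate_apply, sub_eq_add_neg]; rfl
  rw [h3]
  refine this.trans ?_
  have : VectorFourier.fourierIntegral Real.fourierChar volume (innerₗ E) K ξ = 0 := h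
  simp [this]

theorem fourier_reflect (K : 𝓢(E, ℂ)) : 𝓕 (reflect K) = 𝓕⁻ K := by
  ext ξ
  rw [SchwartzMap.fourierInv_coe, Real.fourierInv_eq_fourier_comp_neg, SchwartzMap.fourier_coe]
  rfl

theorem fourierInv_apply (K : 𝓢(E, ℂ)) (ξ : E) : 𝓕⁻ K ξ = 𝓕 K (-ξ) := by
  rw [SchwartzMap.fourierInv_coe, Real.fourierInv_eq_fourier_neg, SchwartzMap.fourier_coe]

theorem reflect_reflect (K : 𝓢(E, ℂ)) : reflect (reflect K) = K := by
  ext x; simp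

/-- The action of the Fourier multiplier with symbol `𝓕 K` on test functions. -/
theorem fourier_mul_fourierInv_apply (K ψ T : 𝓢(E, ℂ)) (hT : ∀ ξ, T ξ = 𝓕 K ξ * 𝓕⁻ ψ ξ) (y : E) :
    𝓕 T y = conv (reflect K) ψ y := by
  -- The Fourier transform of the reflection of ψ is its inverse transform, so T is itself the
  -- Fourier transform of a convolution; the second transform then only reflects.
  have h1 : T = 𝓕 (SchwartzMap.convolution (ContinuousLinearMap.mul ℂ ℂ) K (reflect ψ)) := by
    ext ξ
    rw [SchwartzMap.fourier_convolution]
    simp [hT, fourier_reflect]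
  have h2 : 𝓕 T y = 𝓕⁻ T (-y) := by rw [fourierInv_apply, neg_neg]
  rw [h2, h1, FourierTransform.fourierInv_fourier_eq, SchwartzMap.convolution_apply,
    MeasureTheory.convolution, conv, ← integral_add_right_eq_self (fun x => reflect K (y - x) * ψ x) y]
  congr 1; ext t
  simp [add_comm]

/-- Moving the Fourier transform from the first two factors to the third writes the integral as an
integral of 𝓕 k₀(ξ) 𝓕 k₁(η) 𝓕 k₂(ζ) over ξ + η + ζ = 0. -/
theorem integral_mul_mul_eq_zero (k₀ k₁ k₂ : 𝓢(E, ℂ))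
    (h : ∀ ξ η ζ : E, ξ + η + ζ = 0 → 𝓕 k₀ ξ * 𝓕 k₁ η * 𝓕 k₂ ζ = 0) :
    ∫ x, k₀ x * k₁ x * k₂ x = 0 := by
  set c := SchwartzMap.convolution (ContinuousLinearMap.mul ℂ ℂ) (𝓕⁻ k₀) (𝓕⁻ k₁) with hc
  have h1 : ∀ x, 𝓕 c x = k₀ x * k₁ x := fun x => by
    rw [hc, SchwartzMap.fourier_convolution]; simp
  have h2 : k₂ = 𝓕⁻ (𝓕 k₂) := by simp
  simp_rw [← h1]
  have := SchwartzMap.integral_fourier_mul_eq c k₂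
  rw [this]
  have h3 : ∀ ζ, c ζ * 𝓕 k₂ ζ = 0 := by
    intro ζ
    rw [hc, SchwartzMap.convolution_apply, MeasureTheory.convolution, ← integral_mul_const]
    refine integral_eq_zero_of_ae (ae_of_all _ fun t => ?_)
    have := h (-t) (-(ζ-t)) ζ (by abel)
    simpa [fourierInv_apply] using this
  simp [h3]

theorem integral_mul_of_ae_eq_conv {K : 𝓢(E, ℂ)} {F G : E → ℂ} {p q : ℝ≥0∞}
    [hpq : p.HolderConjugate q] (hF : MemLp F p volume) (hG : MemLp G q volume)
    (hK : F =ᵐ[volume] conv K F) :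
    ∫ x, F x * G x = ∫ y, F y * conv (reflect K) G y := by
  rw [← integral_conv_mul K hF hG]
  refine integral_congr_ae ?_
  filter_upwards [hK] with x hx
  rw [← hx]

/-- The integral of a product of three functions vanishes when their frequencies cannot add up to
zero. -/
theorem integral_mul_mul_eq_zero_of_ae_eq_conv {r₀ r₁ r₂ : ℝ≥0∞} (hr : r₀⁻¹ + r₁⁻¹ + r₂⁻¹ = 1)
    {f₀ f₁ f₂ : E → ℂ} {K₀ K₁ K₂ : 𝓢(E, ℂ)} (hf₀ : MemLp f₀ r₀ volume) (hf₁ : MemLp f₁ r₁ volume)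
    (hf₂ : MemLp f₂ r₂ volume) (h₀ : f₀ =ᵐ[volume] conv K₀ f₀) (h₁ : f₁ =ᵐ[volume] conv K₁ f₁)
    (h₂ : f₂ =ᵐ[volume] conv K₂ f₂)
    (h : ∀ ξ η ζ : E, ξ + η + ζ = 0 → 𝓕 K₀ ξ * 𝓕 K₁ η * 𝓕 K₂ ζ = 0) :
    ∫ x, f₀ x * f₁ x * f₂ x = 0 := by
  have t₀ : ENNReal.HolderTriple r₁ r₂ (r₁⁻¹ + r₂⁻¹)⁻¹ := ⟨by simp⟩
  have t₁ : ENNReal.HolderTriple r₀ r₂ (r₀⁻¹ + r₂⁻¹)⁻¹ := ⟨by simp⟩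
  have t₂ : ENNReal.HolderTriple r₀ r₁ (r₀⁻¹ + r₁⁻¹)⁻¹ := ⟨by simp⟩
  have c₀ : ENNReal.HolderConjugate r₀ (r₁⁻¹ + r₂⁻¹)⁻¹ := ⟨by
    rw [inv_inv, inv_one, ← hr]; ring⟩
  have c₁ : ENNReal.HolderConjugate r₁ (r₀⁻¹ + r₂⁻¹)⁻¹ := ⟨by
    rw [inv_inv, inv_one, ← hr]; ring⟩
  have c₂ : ENNReal.HolderConjugate r₂ (r₀⁻¹ + r₁⁻¹)⁻¹ := ⟨by
    rw [inv_inv, inv_one, ← hr]; ring⟩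
  simp_rw [mul_assoc]
  rw [integral_mul_of_ae_eq_conv hf₀ (hf₂.mul' hf₁ (r := (r₁⁻¹ + r₂⁻¹)⁻¹)) h₀]
  refine integral_eq_zero_of_ae (ae_of_all _ fun y => mul_eq_zero_of_right _ ?_)
  have e₀ : conv (reflect K₀) (fun x => f₁ x * f₂ x) y =
      ∫ x, f₁ x * (LittlewoodPaley.translate y K₀ x * f₂ x) := by
    simp only [conv, reflect_apply, neg_sub, translate_apply]
    congr 1; ext x; ring
  rw [e₀, integral_mul_of_ae_eq_conv hf₁
    (hf₂.mul' ((LittlewoodPaley.translate y K₀).memLp r₀) (r := (r₀⁻¹ + r₂⁻¹)⁻¹)) h₁]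
  refine integral_eq_zero_of_ae (ae_of_all _ fun z => mul_eq_zero_of_right _ ?_)
  have e₁ : conv (reflect K₁) (fun x => LittlewoodPaley.translate y K₀ x * f₂ x) z =
      ∫ x, f₂ x * (LittlewoodPaley.translate y K₀ x * LittlewoodPaley.translate z K₁ x) := by
    simp only [conv, reflect_apply, neg_sub, translate_apply]
    congr 1; ext x; ring
  rw [e₁, integral_mul_of_ae_eq_conv hf₂ (((LittlewoodPaley.translate z K₁).memLp r₁).mul'
    ((LittlewoodPaley.translate y K₀).memLp r₀) (r := (r₀⁻¹ + r₁⁻¹)⁻¹)) h₂]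
  refine integral_eq_zero_of_ae (ae_of_all _ fun w => mul_eq_zero_of_right _ ?_)
  rw [← integral_mul_mul_eq_zero (LittlewoodPaley.translate y K₀) (LittlewoodPaley.translate z K₁)
    (LittlewoodPaley.translate w K₂)]
  · simp only [conv, reflect_apply, neg_sub, translate_apply]
    congr 1; ext x; ring
  · intro ξ η ζ hs
    rcases mul_eq_zero.1 (h ξ η ζ hs) with h' | h'
    · rcases mul_eq_zero.1 h' with h'' | h''
      · simp [fourier_translate_eq_zero h'']
      · simp [fourier_translate_eq_zero h'']
    · simp [fourier_translate_eq_zero h']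

end

/-! ### Multiplier kernels and frequency localization -/

section

variable {E : Type*} [NormedAddCommGroup E] [InnerProductSpace ℝ E] [FiniteDimensional ℝ E]
  [MeasurableSpace E] [BorelSpace E]

/-- `K` is the convolution kernel of the Fourier multiplier with symbol `m`, a function of the
angular frequency. -/
def IsKernel (K : 𝓢(E, ℂ)) (m : E → ℝ) : Prop :=
  ∀ ξ, 𝓕 K ξ = ((m ((2 * Real.pi) • ξ) : ℝ) : ℂ)

theorem exists_isKernel {m : E → ℝ} (hm : ContDiff ℝ ∞ m) (hc : HasCompactSupport m) :
    ∃ K : 𝓢(E, ℂ), IsKernel K m := by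
  have h2π : (2 * Real.pi : ℝ) ≠ 0 := by positivity
  have h1 : HasCompactSupport fun ξ : E => ((m ((2 * Real.pi) • ξ) : ℝ) : ℂ) :=
    (hc.comp_smul h2π).comp_left Complex.ofReal_zero
  have h2 : ContDiff ℝ ∞ fun ξ : E => ((m ((2 * Real.pi) • ξ) : ℝ) : ℂ) :=
    Complex.ofRealCLM.contDiff.comp (hm.comp (contDiff_const_smul _))
  refine ⟨𝓕⁻ (h1.toSchwartzMap h2), fun ξ => ?_⟩
  rw [FourierTransform.fourier_fourierInv_eq]
  rfl

theorem IsKernel.dil {K : 𝓢(E, ℂ)} {m : E → ℝ} (h : IsKernel K m) (j : ℤ) :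
    IsKernel (dil j K) fun ξ => m ((2 : ℝ) ^ (-j) • ξ) := by
  intro ξ
  rw [fourier_dil, h, smul_comm]

theorem IsKernel.reflect {K : 𝓢(E, ℂ)} {m : E → ℝ} (h : IsKernel K m) :
    IsKernel (reflect K) fun ξ => m (-ξ) := by
  intro ξ
  rw [fourier_reflect, fourierInv_apply, h, smul_neg]

theorem IsKernel.sub {K L : 𝓢(E, ℂ)} {m n : E → ℝ} (h : IsKernel K m) (h' : IsKernel L n) :
    IsKernel (K - L) fun ξ => m ξ - n ξ := by
  intro ξ
  have : 𝓕 (K - L) = 𝓕 K - 𝓕 L := map_sub (FourierTransform.fourierCLM ℂ 𝓢(E, ℂ)) K L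
  rw [this, sub_apply, h, h']
  push_cast; rfl

theorem IsKernel.integral_eq {K : 𝓢(E, ℂ)} {m : E → ℝ} (h : IsKernel K m) :
    ∫ x, K x = (m 0 : ℂ) := by
  have := h 0
  rw [SchwartzMap.fourier_coe, Real.fourier_eq, smul_zero] at this
  simpa using this

variable (E) in
/-- A radial cutoff to the annulus `1/4 < |ξ| < 4`, equal to `1` for `1/2 ≤ |ξ| ≤ 2`. -/
noncomputable def annulus (ξ : E) : ℝ :=
  (⟨2, 4, by norm_num, by norm_num⟩ : ContDiffBump (0 : E)) ξ -
    (⟨1 / 4, 1 / 2, by norm_num, by norm_num⟩ : ContDiffBump (0 : E)) ξ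

theorem contDiff_annulus : ContDiff ℝ ∞ (annulus E) := by
  unfold annulus
  exact (ContDiffBump.contDiff _).sub (ContDiffBump.contDiff _)

theorem hasCompactSupport_annulus : HasCompactSupport (annulus E) :=
  (ContDiffBump.hasCompactSupport _).sub (ContDiffBump.hasCompactSupport _)

theorem annulus_eq_one {ξ : E} (h₁ : 1 / 2 ≤ ‖ξ‖) (h₂ : ‖ξ‖ ≤ 2) : annulus E ξ = 1 := by
  rw [annulus, ContDiffBump.one_of_mem_closedBall, ContDiffBump.zero_of_le_dist, sub_zero]
  · simpa using h₁
  · simpa using h₂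

theorem annulus_ne_zero {ξ : E} (h : annulus E ξ ≠ 0) : 1 / 4 < ‖ξ‖ ∧ ‖ξ‖ < 4 := by
  constructor
  · by_contra! h'
    apply h
    rw [annulus, ContDiffBump.one_of_mem_closedBall, ContDiffBump.one_of_mem_closedBall, sub_self]
    · simpa using h'
    · simp only [mem_closedBall_zero_iff]; linarith
  · by_contra! h'
    apply h
    rw [annulus, ContDiffBump.zero_of_le_dist, ContDiffBump.zero_of_le_dist, sub_self]
    · simp only [dist_zero_right]; linarith
    · simpa using h'

variable (E) in
/-- The kernel of the Fourier multiplier with symbol `annulus`. -/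
noncomputable def annulusKernel : 𝓢(E, ℂ) :=
  (exists_isKernel (contDiff_annulus (E := E)) hasCompactSupport_annulus).choose

theorem isKernel_annulusKernel : IsKernel (annulusKernel E) (annulus E) :=
  (exists_isKernel (contDiff_annulus (E := E)) hasCompactSupport_annulus).choose_spec

theorem integral_annulusKernel : ∫ x, annulusKernel E x = 0 := by
  rw [isKernel_annulusKernel.integral_eq, Complex.ofReal_eq_zero]
  by_contra h
  have := (annulus_ne_zero h).1
  norm_num at this

/-- The frequencies of `F` are localized near `|ξ| ~ 2^j`. -/
def Localized (j : ℤ) (F : E → ℂ) : Prop := F =ᵐ[volume] conv (dil j (annulusKernel E)) F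

theorem localized_zero (j : ℤ) : Localized j (0 : E → ℂ) := by
  refine ae_of_all _ fun x => ?_
  simp [conv]

theorem fourier_dil_annulusKernel_ne_zero {j : ℤ} {ξ : E}
    (h : 𝓕 (dil j (annulusKernel E)) ξ ≠ 0) :
    (2 : ℝ) ^ j * (1 / 4) < ‖(2 * Real.pi) • ξ‖ ∧ ‖(2 * Real.pi) • ξ‖ < (2 : ℝ) ^ j * 4 := by
  rw [(isKernel_annulusKernel.dil j) ξ, Complex.ofReal_ne_zero] at h
  have h1 := annulus_ne_zero h
  have h2 : (0 : ℝ) < 2 ^ j := by positivity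
  rw [norm_smul, Real.norm_of_nonneg (by positivity), zpow_neg, inv_mul_eq_div, lt_div_iff₀ h2,
    div_lt_iff₀ h2] at h1
  exact ⟨by linarith [h1.1], by linarith [h1.2]⟩

/-- The product of three localized functions has zero integral when one frequency dominates. -/
theorem integral_mul_mul_eq_zero_of_localized {r₀ r₁ r₂ : ℝ≥0∞} (hr : r₀⁻¹ + r₁⁻¹ + r₂⁻¹ = 1)
    {f₀ f₁ f₂ : E → ℂ} (hf₀ : MemLp f₀ r₀ volume) (hf₁ : MemLp f₁ r₁ volume)
    (hf₂ : MemLp f₂ r₂ volume) {j k l : ℤ} (h₀ : Localized j f₀) (h₁ : Localized k f₁)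
    (h₂ : Localized l f₂) (hjk : (j + 6 ≤ k ∧ l + 6 ≤ k) ∨ (j + 6 ≤ l ∧ k + 6 ≤ l) ∨
      (k + 6 ≤ j ∧ l + 6 ≤ j)) :
    ∫ x, f₀ x * f₁ x * f₂ x = 0 := by
  refine integral_mul_mul_eq_zero_of_ae_eq_conv hr hf₀ hf₁ hf₂ h₀ h₁ h₂ fun ξ η ζ hs => ?_
  by_contra hne
  obtain ⟨⟨n₀, n₁⟩, n₂⟩ : (𝓕 (dil j (annulusKernel E)) ξ ≠ 0 ∧ 𝓕 (dil k (annulusKernel E)) η ≠ 0) ∧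
      𝓕 (dil l (annulusKernel E)) ζ ≠ 0 := by
    simpa only [mul_ne_zero_iff] using hne
  have b₀ := fourier_dil_annulusKernel_ne_zero n₀
  have b₁ := fourier_dil_annulusKernel_ne_zero n₁
  have b₂ := fourier_dil_annulusKernel_ne_zero n₂
  have hs' : (2 * Real.pi) • ξ + (2 * Real.pi) • η + (2 * Real.pi) • ζ = 0 := by
    rw [← smul_add, ← smul_add, hs, smul_zero]
  -- A gap of 6 is enough: the dominant frequency exceeds 2^k/4, while the other two add up to less
  -- than 2·4·2^k/64 = 2^k/8.
  have hpow : ∀ {a b : ℤ}, a + 6 ≤ b → (2 : ℝ) ^ a * 64 ≤ 2 ^ b := fun {a b} hab => by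
    calc (2 : ℝ) ^ a * 64 = 2 ^ (a + 6) := by rw [zpow_add₀ (by norm_num)]; norm_num
      _ ≤ 2 ^ b := zpow_le_zpow_right₀ (by norm_num) hab
  have key : ∀ a b c : E, a + b + c = 0 → ‖a‖ ≤ ‖b‖ + ‖c‖ := fun a b c h => by
    have : a = -(b + c) := by rw [eq_neg_iff_add_eq_zero, ← add_assoc, h]
    rw [this, norm_neg]; exact norm_add_le _ _
  have pj : (0 : ℝ) < 2 ^ j := by positivity
  have pk : (0 : ℝ) < 2 ^ k := by positivity
  have pl : (0 : ℝ) < 2 ^ l := by positivity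
  rcases hjk with ⟨h1, h2⟩ | ⟨h1, h2⟩ | ⟨h1, h2⟩
  · have := key _ _ _ (show (2 * Real.pi) • η + (2 * Real.pi) • ξ + (2 * Real.pi) • ζ = 0 by
      rw [← hs']; abel)
    linarith [hpow h1, hpow h2, b₀.2, b₁.1, b₂.2]
  · have := key _ _ _ (show (2 * Real.pi) • ζ + (2 * Real.pi) • ξ + (2 * Real.pi) • η = 0 by
      rw [← hs']; abel)
    linarith [hpow h1, hpow h2, b₀.2, b₁.2, b₂.1]
  · have := key _ _ _ hs'
    linarith [hpow h1, hpow h2, b₀.1, b₁.2, b₂.2]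

/-- Bernstein's inequality for localized functions. -/
theorem exists_lpNorm_le_of_localized (p r : ℝ≥0∞) (hp : 1 ≤ p) (hpr : p ≤ r) :
    ∃ C : ℝ, 0 ≤ C ∧ ∀ (j : ℤ) (F : E → ℂ), MemLp F p volume → Localized j F →
      MemLp F r volume ∧ lpNorm F r volume ≤
      C * (2 : ℝ) ^ ((j : ℝ) * (Module.finrank ℝ E * (p⁻¹.toReal - r⁻¹.toReal))) *
        lpNorm F p volume := by
  obtain ⟨C, hC⟩ := exists_eLpNorm_conv_dil_le (annulusKernel E) p r hp hpr
  refine ⟨C, C.coe_nonneg, fun j F hF hloc => ?_⟩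
  have h1 := hC j F hF.1
  rw [← eLpNorm_congr_ae hloc, ← ofReal_lpNorm hF, ← ENNReal.ofReal_coe_nnreal,
    ← ENNReal.ofReal_mul C.coe_nonneg, ← ENNReal.ofReal_mul (by positivity)] at h1
  have h2 : MemLp F r volume := ⟨hF.1, h1.trans_lt ENNReal.ofReal_lt_top⟩
  refine ⟨h2, ?_⟩
  rw [← ofReal_lpNorm h2] at h1
  exact (ENNReal.ofReal_le_ofReal_iff (mul_nonneg (by positivity) lpNorm_nonneg)).1 h1

end

/-! ### The duality map and its pairing with mean-zero convolutions -/

section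

/-- The convex function t ↦ t^p lies above its tangent at x; for x > 0 this is Bernoulli's
inequality at y/x - 1. -/
theorem rpow_sub_rpow_le {x y p : ℝ} (hx : 0 ≤ x) (hy : 0 ≤ y) (hp : 1 ≤ p) :
    x ^ p - y ^ p ≤ p * x ^ (p - 1) * (x - y) := by
  rcases hx.eq_or_lt with rfl | hx
  · rcases hp.eq_or_lt with rfl | hp
    · simp
    · rw [Real.zero_rpow (by linarith), Real.zero_rpow (by linarith)]
      simpa using Real.rpow_nonneg hy p
  · have h := one_add_mul_self_le_rpow_one_add (s := y / x - 1) (by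
      have : 0 ≤ y / x := by positivity
      linarith) hp
    rw [add_sub_cancel, Real.div_rpow hy hx.le, le_div_iff₀ (Real.rpow_pos_of_pos hx p)] at h
    have hxp : x ^ p = x ^ (p - 1) * x := by
      rw [← Real.rpow_add_one hx.ne']; ring_nf
    have e : (1 + p * (y / x - 1)) * x ^ p = x ^ p - p * x ^ (p - 1) * (x - y) := by
      rw [hxp]; field_simp; ring
    linarith

/-- The duality map `z ↦ |z|^{ρ-2} conj z`. -/
noncomputable def dualityMap (ρ : ℝ) (z : ℂ) : ℂ := ((‖z‖ ^ (ρ - 2) : ℝ) : ℂ) * starRingEnd ℂ z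

theorem norm_dualityMap {ρ : ℝ} (hρ : 2 ≤ ρ) (z : ℂ) : ‖dualityMap ρ z‖ = ‖z‖ ^ (ρ - 1) := by
  rw [dualityMap, norm_mul, Complex.norm_real, Real.norm_of_nonneg (by positivity), RCLike.norm_conj,
    ← Real.rpow_add_one' (norm_nonneg z) (by linarith)]
  ring_nf

theorem continuous_dualityMap {ρ : ℝ} (hρ : 2 ≤ ρ) : Continuous (dualityMap ρ) := by
  unfold dualityMap
  refine (Complex.continuous_ofReal.comp ?_).mul Complex.continuous_conj
  exact continuous_norm.rpow_const fun _ => Or.inr (by linarith)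

/-- The same tangent inequality for z ↦ |z|^ρ on ℂ, whose gradient at c is encoded by ρ times the
duality map. -/
theorem norm_rpow_sub_le {ρ : ℝ} (hρ : 2 ≤ ρ) (c a : ℂ) :
    ‖c‖ ^ ρ - ‖a‖ ^ ρ ≤ ρ * (dualityMap ρ c * (c - a)).re := by
  have h1 := rpow_sub_rpow_le (norm_nonneg c) (norm_nonneg a) (show 1 ≤ ρ by linarith)
  have h2 : ‖c‖ * (‖c‖ - ‖a‖) ≤ (starRingEnd ℂ c * (c - a)).re := by
    rw [mul_sub (starRingEnd ℂ c), Complex.sub_re, mul_comm _ c, Complex.mul_conj, Complex.ofReal_re,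
      Complex.normSq_eq_norm_sq]
    have := Complex.re_le_norm (starRingEnd ℂ c * a)
    rw [norm_mul, RCLike.norm_conj] at this
    nlinarith
  have h3 : ‖c‖ ^ (ρ - 1) = ‖c‖ ^ (ρ - 2) * ‖c‖ := by
    rw [← Real.rpow_add_one' (norm_nonneg c) (by linarith)]; ring_nf
  rw [dualityMap, mul_assoc, Complex.re_ofReal_mul]
  calc _ ≤ ρ * ‖c‖ ^ (ρ - 1) * (‖c‖ - ‖a‖) := h1
    _ = ρ * (‖c‖ ^ (ρ - 2) * (‖c‖ * (‖c‖ - ‖a‖))) := by rw [h3]; ring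
    _ ≤ _ := by gcongr

/-- The duality map is homogeneous of degree ρ - 1, hence Lipschitz with a constant of size
|z|^{ρ-2}; this lets increments of S control increments of |S|^{ρ-2} conj(S). -/
theorem norm_dualityMap_sub_le {ρ : ℝ} (hρ : 2 ≤ ρ) (a b : ℂ) :
    ‖dualityMap ρ a - dualityMap ρ b‖ ≤ ρ * ((‖a‖ ^ (ρ - 2) + ‖b‖ ^ (ρ - 2)) * ‖a - b‖) := by
  wlog hab : ‖b‖ ≤ ‖a‖ generalizing a b
  · have := this b a (le_of_not_ge hab)
    rw [norm_sub_rev, norm_sub_rev b, add_comm] at this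
    exact this
  have e : dualityMap ρ a - dualityMap ρ b = ((‖a‖ ^ (ρ - 2) : ℝ) : ℂ) * starRingEnd ℂ (a - b) +
      ((‖a‖ ^ (ρ - 2) - ‖b‖ ^ (ρ - 2) : ℝ) : ℂ) * starRingEnd ℂ b := by
    simp only [dualityMap, map_sub]; push_cast; ring
  have hmono : ‖b‖ ^ (ρ - 2) ≤ ‖a‖ ^ (ρ - 2) := by gcongr
  -- The tangent inequality is used with exponent ρ - 1 ≥ 1, since ρ - 2 may be below 1. Subtracting
  -- |a|^{ρ-2}(|a| - |b|) from it gives the bound `h3` on the increment of the modulus factor.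
  have h1 := rpow_sub_rpow_le (norm_nonneg a) (norm_nonneg b) (show 1 ≤ ρ - 1 by linarith)
  have ha : ‖a‖ ^ (ρ - 1) = ‖a‖ ^ (ρ - 2) * ‖a‖ := by
    rw [← Real.rpow_add_one' (norm_nonneg a) (by linarith)]; ring_nf
  have hb : ‖b‖ ^ (ρ - 1) = ‖b‖ ^ (ρ - 2) * ‖b‖ := by
    rw [← Real.rpow_add_one' (norm_nonneg b) (by linarith)]; ring_nf
  rw [show ρ - 1 - 1 = ρ - 2 by ring, ha, hb] at h1
  have h2 : ‖a‖ - ‖b‖ ≤ ‖a - b‖ := norm_sub_norm_le a b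
  have hA : 0 ≤ ‖a‖ ^ (ρ - 2) := by positivity
  have hB : 0 ≤ ‖b‖ ^ (ρ - 2) := by positivity
  rw [e]
  refine (norm_add_le _ _).trans ?_
  rw [norm_mul, norm_mul, Complex.norm_real, Complex.norm_real, Real.norm_of_nonneg hA,
    Real.norm_of_nonneg (by linarith), RCLike.norm_conj, RCLike.norm_conj]
  have h3 : (‖a‖ ^ (ρ - 2) - ‖b‖ ^ (ρ - 2)) * ‖b‖ ≤ (ρ - 2) * ‖a‖ ^ (ρ - 2) * (‖a‖ - ‖b‖) := by
    linarith
  have h4 : (ρ - 2) * ‖a‖ ^ (ρ - 2) * (‖a‖ - ‖b‖) ≤ (ρ - 2) * ‖a‖ ^ (ρ - 2) * ‖a - b‖ := by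
    gcongr
  have h5 : 0 ≤ ‖a‖ ^ (ρ - 2) * ‖a - b‖ := by positivity
  have h6 : 0 ≤ ρ * (‖b‖ ^ (ρ - 2) * ‖a - b‖) := by positivity
  nlinarith

variable {E : Type*} [NormedAddCommGroup E] [InnerProductSpace ℝ E] [FiniteDimensional ℝ E]
  [MeasurableSpace E] [BorelSpace E]

/-- Hölder with weights 1/r, (r-2)/r and 1/r; the middle weight is allowed to be zero, which covers
r = 2. -/
theorem lintegral_mul_rpow_mul_le {F S D : E → ℂ} {r : ℝ≥0∞} (hr2 : 2 ≤ r) (hr : r ≠ ⊤)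
    (hF : AEStronglyMeasurable F volume) (hS : AEStronglyMeasurable S volume)
    (hD : AEStronglyMeasurable D volume) :
    ∫⁻ x, ‖F x‖ₑ * (‖S x‖ₑ ^ (r.toReal - 2) * ‖D x‖ₑ) ≤
      eLpNorm F r volume * (eLpNorm S r volume ^ (r.toReal - 2) * eLpNorm D r volume) := by
  set ρ := r.toReal with hρ
  have hρ2 : 2 ≤ ρ := by
    rw [hρ, ← ENNReal.toReal_ofNat]; exact ENNReal.toReal_mono hr hr2
  have hr0 : r ≠ 0 := (zero_lt_two.trans_le hr2).ne'
  have hρ0 : ρ ≠ 0 := by positivity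
  have key := ENNReal.lintegral_prod_norm_pow_le (μ := (volume : Measure E)) Finset.univ
    (f := ![fun x => ‖F x‖ₑ ^ ρ, fun x => ‖S x‖ₑ ^ ρ, fun x => ‖D x‖ₑ ^ ρ])
    (p := ![1 / ρ, (ρ - 2) / ρ, 1 / ρ]) (by
      intro i _
      fin_cases i
      · exact hF.enorm.pow_const _
      · exact hS.enorm.pow_const _
      · exact hD.enorm.pow_const _) (by
      simp only [Fin.sum_univ_three, Matrix.cons_val]
      field_simp; ring) (by
      intro i _
      fin_cases i
      · simp; positivity
      · exact div_nonneg (by linarith) (by linarith)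
      · simp; positivity)
  simp only [Fin.prod_univ_three, Matrix.cons_val, ← ENNReal.rpow_mul, mul_one_div_cancel hρ0,
    ENNReal.rpow_one, mul_div_cancel₀ _ hρ0] at key
  rw [eLpNorm_eq_lintegral_rpow_enorm_toReal hr0 hr, eLpNorm_eq_lintegral_rpow_enorm_toReal hr0 hr,
    eLpNorm_eq_lintegral_rpow_enorm_toReal hr0 hr, ← ENNReal.rpow_mul, ← hρ]
  calc _ = _ := lintegral_congr fun x => by rw [← mul_assoc]
    _ ≤ _ := key
    _ = _ := by
      rw [← mul_assoc]; congr 3; field_simp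

theorem memLp_dualityMap {S : E → ℂ} {r q : ℝ≥0∞} [hq : r.HolderConjugate q] (hr2 : 2 ≤ r)
    (hr : r ≠ ⊤) (hS : MemLp S r volume) :
    MemLp (fun x => dualityMap r.toReal (S x)) q volume := by
  set ρ := r.toReal with hρ
  have hρ2 : 2 ≤ ρ := by
    rw [hρ, ← ENNReal.toReal_ofNat]; exact ENNReal.toReal_mono hr hr2
  have h1 := hS.norm_rpow_div (ENNReal.ofReal (ρ - 1))
  rw [ENNReal.toReal_ofReal (by linarith)] at h1
  have hq' : r / ENNReal.ofReal (ρ - 1) = q := by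
    have h2 : r = ENNReal.ofReal ρ := (ENNReal.ofReal_toReal hr).symm
    have h3 := hq.inv_add_inv_eq_inv
    have h4 : q⁻¹ = 1 - r⁻¹ := by
      rw [inv_one] at h3
      rw [← h3, ENNReal.add_sub_cancel_left]
      rw [ENNReal.inv_ne_top]; exact (zero_lt_two.trans_le hr2).ne'
    rw [← inv_inj, h4, h2, ENNReal.inv_div (by simp) (by right; simp; linarith),
      ← ENNReal.ofReal_inv_of_pos (by linarith), ← ENNReal.ofReal_one,
      ← ENNReal.ofReal_sub _ (by positivity), ← ENNReal.ofReal_div_of_pos (by linarith)]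
    congr 1; field_simp
  rw [hq'] at h1
  refine h1.of_le ((continuous_dualityMap hρ2).comp_aestronglyMeasurable hS.1)
    (ae_of_all _ fun x => ?_)
  rw [norm_dualityMap hρ2, Real.norm_of_nonneg (by positivity)]

/-- The pairing of `|S|^{r-2} conj S` with a convolution whose kernel has mean zero. -/
theorem norm_integral_dualityMap_mul_conv_le {S F : E → ℂ} {r : ℝ≥0∞} (hr2 : 2 ≤ r) (hr : r ≠ ⊤)
    (hS : MemLp S r volume) (hF : MemLp F r volume) (K : 𝓢(E, ℂ)) (hK : ∫ x, K x = 0) {L : ℝ}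
    (hL : 0 ≤ L)
    (hSL : ∀ y, eLpNorm (fun x => S (x + y) - S x) r volume ≤ ENNReal.ofReal (L * ‖y‖)) :
    ‖∫ x, dualityMap r.toReal (S x) * conv K F x‖ ≤
      2 * r.toReal * lpNorm S r volume ^ (r.toReal - 2) * lpNorm F r volume * L *
        ∫ y, ‖K y‖ * ‖y‖ := by
  have hr1 : 1 ≤ r := le_trans (by norm_num) hr2
  have hq := ENNReal.HolderConjugate.inv_one_sub_inv' hr1
  set q : ℝ≥0∞ := (1 - r⁻¹)⁻¹ with hqdef
  have hq1 : 1 ≤ q := by simp [hqdef]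
  have hg : MemLp (fun x => dualityMap r.toReal (S x)) q volume := memLp_dualityMap hr2 hr hS
  set ρ := r.toReal with hρ
  have hρ2 : 2 ≤ ρ := by
    rw [hρ, ← ENNReal.toReal_ofNat]; exact ENNReal.toReal_mono hr hr2
  set g := fun x => dualityMap ρ (S x) with hgdef
  have hK1 : Integrable (fun y => ‖K y‖ * ‖y‖) volume := by
    simpa [mul_comm] using K.integrable_pow_mul volume 1
  -- The convolution is moved onto g, and since K has mean zero the value g(z) may be subtracted for
  -- free; only increments of g remain.
  have e1 : ∫ x, g x * conv K F x = ∫ z, F z * ∫ y, K y * (g (z + y) - g z) := by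
    simp_rw [mul_comm (g _)]
    rw [integral_conv_mul (p := r) (q := q) K hF hg]
    congr 1; ext z; congr 1
    have e2 : ∫ y, K y * (g (z + y) - g z) = ∫ x, K (x - z) * (g x - g z) := by
      rw [← integral_add_right_eq_self (fun x => K (x - z) * (g x - g z)) z]
      congr 1; ext y; simp [add_comm]
    have i1 : Integrable (fun x => K (x - z) * g x) volume := by
      have := integrable_kernel_mul (reflect K) hq1 hg z
      simpa using this
    have i2 : Integrable (fun x => K (x - z) * g z) volume :=
      (K.integrable.comp_sub_right z).mul_const _
    rw [e2]
    simp_rw [mul_sub]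
    rw [integral_sub i1 i2, integral_mul_const, integral_sub_right_eq_self (fun x => K x) z, hK,
      zero_mul, sub_zero]
    simp [conv]
  have hSy : ∀ y, AEStronglyMeasurable (fun x => S (x + y)) volume := fun y =>
    hS.1.comp_measurePreserving (measurePreserving_add_right volume y)
  have hSyn : ∀ y, eLpNorm (fun x => S (x + y)) r volume = eLpNorm S r volume := fun y =>
    eLpNorm_comp_measurePreserving hS.1 (measurePreserving_add_right volume y)
  have hinner : ∀ y, ∫⁻ z, ‖F z‖ₑ * (‖K y‖ₑ * ‖g (z + y) - g z‖ₑ) ≤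
      ENNReal.ofReal (2 * ρ * lpNorm S r volume ^ (ρ - 2) * lpNorm F r volume * L *
        (‖K y‖ * ‖y‖)) := by
    intro y
    have hpt : ∀ z, ‖F z‖ₑ * (‖K y‖ₑ * ‖g (z + y) - g z‖ₑ) ≤ (‖K y‖ₑ * ENNReal.ofReal ρ) *
        (‖F z‖ₑ * (‖S (z + y)‖ₑ ^ (ρ - 2) * ‖S (z + y) - S z‖ₑ) +
          ‖F z‖ₑ * (‖S z‖ₑ ^ (ρ - 2) * ‖S (z + y) - S z‖ₑ)) := by
      intro z
      have h1 : ‖g (z + y) - g z‖ₑ ≤ ENNReal.ofReal ρ *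
          ((‖S (z + y)‖ₑ ^ (ρ - 2) + ‖S z‖ₑ ^ (ρ - 2)) * ‖S (z + y) - S z‖ₑ) := by
        rw [← ofReal_norm, ← ofReal_norm, ← ofReal_norm, ← ofReal_norm,
          ENNReal.ofReal_rpow_of_nonneg (norm_nonneg _) (by linarith),
          ENNReal.ofReal_rpow_of_nonneg (norm_nonneg _) (by linarith),
          ← ENNReal.ofReal_add (by positivity) (by positivity), ← ENNReal.ofReal_mul (by positivity),
          ← ENNReal.ofReal_mul (by positivity)]
        exact ENNReal.ofReal_le_ofReal (norm_dualityMap_sub_le hρ2 _ _)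
      calc _ ≤ ‖F z‖ₑ * (‖K y‖ₑ * (ENNReal.ofReal ρ *
          ((‖S (z + y)‖ₑ ^ (ρ - 2) + ‖S z‖ₑ ^ (ρ - 2)) * ‖S (z + y) - S z‖ₑ))) := by gcongr
        _ = _ := by ring
    have hmS := hS.1
    have hmF := hF.1
    have hmD : AEStronglyMeasurable (fun z => S (z + y) - S z) volume := (hSy y).sub hS.1
    calc _ ≤ _ := lintegral_mono hpt
      _ = (‖K y‖ₑ * ENNReal.ofReal ρ) *
        ((∫⁻ z, ‖F z‖ₑ * (‖S (z + y)‖ₑ ^ (ρ - 2) * ‖S (z + y) - S z‖ₑ)) +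
          ∫⁻ z, ‖F z‖ₑ * (‖S z‖ₑ ^ (ρ - 2) * ‖S (z + y) - S z‖ₑ)) := by
        rw [lintegral_const_mul' _ _ (ENNReal.mul_ne_top enorm_ne_top ENNReal.ofReal_ne_top),
          lintegral_add_left']
        exact hmF.enorm.mul (((hSy y).enorm.pow_const _).mul hmD.enorm)
      _ ≤ (‖K y‖ₑ * ENNReal.ofReal ρ) *
        (eLpNorm F r volume * (eLpNorm S r volume ^ (ρ - 2) * ENNReal.ofReal (L * ‖y‖)) +
          eLpNorm F r volume * (eLpNorm S r volume ^ (ρ - 2) * ENNReal.ofReal (L * ‖y‖))) := by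
        gcongr
        · refine (lintegral_mul_rpow_mul_le hr2 hr hmF (hSy y) hmD).trans ?_
          rw [hSyn y]
          gcongr
          exact hSL y
        · refine (lintegral_mul_rpow_mul_le hr2 hr hmF hmS hmD).trans ?_
          gcongr
          exact hSL y
      _ = _ := by
        have hl1 : 0 ≤ lpNorm F r volume := lpNorm_nonneg
        have hl2 : 0 ≤ lpNorm S r volume := lpNorm_nonneg
        rw [← ofReal_lpNorm hF, ← ofReal_lpNorm hS, ENNReal.ofReal_rpow_of_nonneg hl2 (by linarith),
          ← ofReal_norm, ← ENNReal.ofReal_mul (by positivity), ← ENNReal.ofReal_mul (by positivity),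
          ← ENNReal.ofReal_mul (by positivity), ← ENNReal.ofReal_add (by positivity) (by positivity),
          ← ENNReal.ofReal_mul (by positivity)]
        congr 1; ring
  have hC : 0 ≤ 2 * ρ * lpNorm S r volume ^ (ρ - 2) * lpNorm F r volume * L := by
    have hl1 : 0 ≤ lpNorm F r volume := lpNorm_nonneg
    have hl2 : 0 ≤ lpNorm S r volume := lpNorm_nonneg
    positivity
  have hfin : ‖∫ x, g x * conv K F x‖ₑ ≤ ENNReal.ofReal
      (2 * ρ * lpNorm S r volume ^ (ρ - 2) * lpNorm F r volume * L * ∫ y, ‖K y‖ * ‖y‖) := by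
    rw [e1]
    calc _ ≤ ∫⁻ z, ‖F z * ∫ y, K y * (g (z + y) - g z)‖ₑ := enorm_integral_le_lintegral_enorm _
      _ ≤ ∫⁻ z, ∫⁻ y, ‖F z‖ₑ * (‖K y‖ₑ * ‖g (z + y) - g z‖ₑ) := by
        refine lintegral_mono fun z => ?_
        rw [enorm_mul, lintegral_const_mul' _ _ enorm_ne_top]
        gcongr
        refine (enorm_integral_le_lintegral_enorm _).trans (le_of_eq ?_)
        simp_rw [enorm_mul]
      _ = ∫⁻ y, ∫⁻ z, ‖F z‖ₑ * (‖K y‖ₑ * ‖g (z + y) - g z‖ₑ) := by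
        have hgm : AEStronglyMeasurable g volume := hg.1
        have hgadd : AEStronglyMeasurable (fun z : E × E => g (z.1 + z.2)) (volume.prod volume) :=
          hgm.comp_quasiMeasurePreserving
            (quasiMeasurePreserving_add volume volume)
        refine lintegral_lintegral_swap ?_
        have hKm : AEMeasurable (fun z : E × E => ‖K z.2‖ₑ) (volume.prod volume) :=
          (K.continuous.comp continuous_snd).aestronglyMeasurable.enorm
        exact hF.1.enorm.comp_fst.mul (hKm.mul (hgadd.sub hgm.comp_fst).enorm)
      _ ≤ ∫⁻ y, ENNReal.ofReal (2 * ρ * lpNorm S r volume ^ (ρ - 2) * lpNorm F r volume * L *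
        (‖K y‖ * ‖y‖)) := lintegral_mono hinner
      _ = _ := by
        rw [← ofReal_integral_eq_lintegral_ofReal (hK1.const_mul _)
          (ae_of_all _ fun y => mul_nonneg hC (by positivity)), integral_const_mul]
  rw [← ofReal_norm] at hfin
  exact (ENNReal.ofReal_le_ofReal_iff
    (mul_nonneg hC (integral_nonneg fun y => by positivity))).1 hfin

end

/-! ### The embedding of ℓ²L^r into L^r for localized pieces -/

section

/-- An injective choice of nonnegative exponents gives a subsum of one geometric series. -/
theorem sum_rpow_le {ρ : ℝ} (hρ : 0 < ρ) (J : Finset ℤ) (n : ℤ → ℤ) (hn : ∀ j ∈ J, 0 ≤ n j)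
    (hinj : Set.InjOn n J) :
    ∑ j ∈ J, (2 : ℝ) ^ (-ρ * (n j : ℝ)) ≤ (1 - (2 : ℝ) ^ (-ρ))⁻¹ := by
  have hx0 : (0 : ℝ) ≤ 2 ^ (-ρ) := by positivity
  have hx1 : (2 : ℝ) ^ (-ρ) < 1 := Real.rpow_lt_one_of_one_lt_of_neg one_lt_two (by linarith)
  have hinj' : Set.InjOn (fun j => (n j).toNat) J := by
    intro a ha b hb hab
    have h1 := hn a ha
    have h2 := hn b hb
    apply hinj ha hb
    simp only at hab
    omega
  calc ∑ j ∈ J, (2 : ℝ) ^ (-ρ * (n j : ℝ)) = ∑ j ∈ J, ((2 : ℝ) ^ (-ρ)) ^ (n j).toNat := by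
        refine Finset.sum_congr rfl fun j hj => ?_
        rw [Real.rpow_mul (by norm_num), ← Real.rpow_natCast]
        congr 1
        exact_mod_cast (Int.toNat_of_nonneg (hn j hj)).symm
    _ = ∑ m ∈ J.image fun j => (n j).toNat, ((2 : ℝ) ^ (-ρ)) ^ m := by
        rw [Finset.sum_image hinj']
    _ ≤ ∑' m : ℕ, ((2 : ℝ) ^ (-ρ)) ^ m :=
        (summable_geometric_of_lt_one hx0 hx1).sum_le_tsum _ fun m _ => by positivity
    _ = _ := tsum_geometric_of_lt_one hx0 hx1

theorem sum_filter_le_rpow_le {ρ : ℝ} (hρ : 0 < ρ) (J : Finset ℤ) (k : ℤ) :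
    ∑ j ∈ J with j ≤ k, (2 : ℝ) ^ (ρ * ((j : ℝ) - k)) ≤ (1 - (2 : ℝ) ^ (-ρ))⁻¹ := by
  refine le_trans (le_of_eq ?_) (sum_rpow_le hρ {j ∈ J | j ≤ k} (fun j => k - j) ?_ ?_)
  · refine Finset.sum_congr rfl fun j _ => ?_
    push_cast; ring_nf
  · intro j hj
    have := (Finset.mem_filter.1 hj).2
    omega
  · intro a _ b _ h
    simp only at h
    omega

theorem sum_filter_ge_rpow_le {ρ : ℝ} (hρ : 0 < ρ) (J : Finset ℤ) (k : ℤ) :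
    ∑ j ∈ J with k ≤ j, (2 : ℝ) ^ (ρ * ((k : ℝ) - j)) ≤ (1 - (2 : ℝ) ^ (-ρ))⁻¹ := by
  refine le_trans (le_of_eq ?_) (sum_rpow_le hρ {j ∈ J | k ≤ j} (fun j => j - k) ?_ ?_)
  · refine Finset.sum_congr rfl fun j _ => ?_
    push_cast; ring_nf
  · intro j hj
    have := (Finset.mem_filter.1 hj).2
    omega
  · intro a _ b _ h
    simp only at h
    omega

/-- Schur's test: bound the product by half the sum of squares; rows and columns of 2^{j-a} each sum
to at most 1/(1 - 1/2) = 2. -/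
theorem sum_sum_mul_rpow_le (J : Finset ℤ) (α : ℤ → ℝ) :
    ∑ a ∈ J, ∑ j ∈ J with j ≤ a, α a * α j * (2 : ℝ) ^ ((j : ℝ) - a) ≤ 2 * ∑ j ∈ J, α j ^ 2 := by
  have h2 : (1 - (2 : ℝ) ^ (-(1 : ℝ)))⁻¹ = 2 := by
    rw [Real.rpow_neg_one]; norm_num
  have h3 : ∑ a ∈ J, ∑ j ∈ J with j ≤ a, α a * α j * (2 : ℝ) ^ ((j : ℝ) - a) ≤
      ∑ a ∈ J, ∑ j ∈ J with j ≤ a, (α a ^ 2 / 2 * (2 : ℝ) ^ ((j : ℝ) - a) +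
        α j ^ 2 / 2 * (2 : ℝ) ^ ((j : ℝ) - a)) := by
    refine Finset.sum_le_sum fun a _ => Finset.sum_le_sum fun j _ => ?_
    rw [← add_mul]
    gcongr
    nlinarith [sq_nonneg (α a - α j)]
  refine h3.trans ?_
  simp_rw [Finset.sum_add_distrib]
  have h4 : ∑ a ∈ J, ∑ j ∈ J with j ≤ a, α a ^ 2 / 2 * (2 : ℝ) ^ ((j : ℝ) - a) ≤
      ∑ a ∈ J, α a ^ 2 := by
    refine Finset.sum_le_sum fun a _ => ?_
    rw [← Finset.mul_sum]
    have := sum_filter_le_rpow_le one_pos J a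
    simp_rw [one_mul] at this
    rw [h2] at this
    calc _ ≤ α a ^ 2 / 2 * 2 := by gcongr
      _ = _ := by ring
  have h5 : ∑ a ∈ J, ∑ j ∈ J with j ≤ a, α j ^ 2 / 2 * (2 : ℝ) ^ ((j : ℝ) - a) ≤
      ∑ j ∈ J, α j ^ 2 := by
    simp_rw [Finset.sum_filter]
    rw [Finset.sum_comm]
    simp_rw [← Finset.sum_filter]
    refine Finset.sum_le_sum fun j _ => ?_
    rw [← Finset.mul_sum]
    have := sum_filter_ge_rpow_le one_pos J j
    simp_rw [one_mul] at this
    rw [h2] at this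
    calc _ ≤ α j ^ 2 / 2 * 2 := by gcongr
      _ = _ := by ring
  linarith

variable {E : Type*} [NormedAddCommGroup E] [InnerProductSpace ℝ E] [FiniteDimensional ℝ E]
  [MeasurableSpace E] [BorelSpace E]

theorem lpNorm_rpow_eq {F : E → ℂ} {r : ℝ≥0∞} (hr0 : r ≠ 0) (hr : r ≠ ⊤)
    (hF : AEStronglyMeasurable F volume) :
    lpNorm F r volume ^ r.toReal = ∫ x, ‖F x‖ ^ r.toReal := by
  have h : r.toReal ≠ 0 := (ENNReal.toReal_pos hr0 hr).ne'
  rw [lpNorm_eq_integral_norm_rpow_toReal hr0 hr hF, ← Real.rpow_mul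
    (integral_nonneg fun x => by positivity), inv_mul_cancel₀ h, Real.rpow_one]

/-- By convexity the increment of the r-th power is at most r|∫|S|^{r-2} conj(S) f_a|. As f_a is
reproduced by a mean-zero kernel of scale 2^{-a}, the pairing sees only the oscillation of S at that
scale, to which f_j contributes 2^{j-a}‖f_j‖_r. This is a gain when a is the largest index. -/
theorem exists_lpNorm_insert_rpow_le {r : ℝ≥0∞} (hr2 : 2 ≤ r) (hr : r ≠ ⊤) :
    ∃ B : ℝ, 0 ≤ B ∧ ∀ (f : ℤ → E → ℂ) (J : Finset ℤ) (a : ℤ), a ∉ J →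
      (∀ j, MemLp (f j) r volume) → (∀ j, Localized j (f j)) →
      lpNorm (∑ j ∈ insert a J, f j) r volume ^ r.toReal ≤
        lpNorm (∑ j ∈ J, f j) r volume ^ r.toReal +
          B * lpNorm (∑ j ∈ insert a J, f j) r volume ^ (r.toReal - 2) *
            ∑ j ∈ insert a J, lpNorm (f a) r volume * lpNorm (f j) r volume *
              (2 : ℝ) ^ ((j : ℝ) - a) := by
  have hr1 : 1 ≤ r := le_trans (by norm_num) hr2
  have hr0 : r ≠ 0 := (zero_lt_two.trans_le hr2).ne'
  obtain ⟨C, hC⟩ := exists_eLpNorm_conv_sub_translate_le (annulusKernel E)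
  have hM0 : 0 ≤ ∫ x, ‖annulusKernel E x‖ * ‖x‖ := integral_nonneg fun x => by positivity
  set M := ∫ x, ‖annulusKernel E x‖ * ‖x‖ with hM
  have hq := ENNReal.HolderConjugate.inv_one_sub_inv' hr1
  have hρ2 : 2 ≤ r.toReal := by
    rw [← ENNReal.toReal_ofNat]; exact ENNReal.toReal_mono hr hr2
  refine ⟨r.toReal * (2 * r.toReal * C * M), by positivity, fun f J a haJ hf hloc => ?_⟩
  set S := ∑ j ∈ insert a J, f j with hS
  have hSm : MemLp S r volume := memLp_finsetSum' _ fun j _ => hf j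
  have hS'm : MemLp (∑ j ∈ J, f j) r volume := memLp_finsetSum' _ fun j _ => hf j
  have hdiff : ∀ x, S x - (∑ j ∈ J, f j) x = f a x := fun x => by
    rw [hS, Finset.sum_insert haJ, Pi.add_apply]; ring
  have hg : MemLp (fun x => dualityMap r.toReal (S x)) (1 - r⁻¹)⁻¹ volume :=
    memLp_dualityMap hr2 hr hSm
  have hgf : Integrable (fun x => dualityMap r.toReal (S x) * f a x) volume := by
    have : ENNReal.HolderConjugate (1 - r⁻¹)⁻¹ r := hq.symm
    have := (hf a).mul' hg (r := 1)
    rwa [memLp_one_iff_integrable] at this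
  have hI1 : Integrable (fun x => ‖S x‖ ^ r.toReal) volume := hSm.integrable_norm_rpow hr0 hr
  have hI2 : Integrable (fun x => ‖(∑ j ∈ J, f j) x‖ ^ r.toReal) volume :=
    hS'm.integrable_norm_rpow hr0 hr
  have h1 : lpNorm S r volume ^ r.toReal - lpNorm (∑ j ∈ J, f j) r volume ^ r.toReal ≤
      r.toReal * ‖∫ x, dualityMap r.toReal (S x) * f a x‖ := by
    rw [lpNorm_rpow_eq hr0 hr hSm.1, lpNorm_rpow_eq hr0 hr hS'm.1, ← integral_sub hI1 hI2]
    calc _ ≤ ∫ x, r.toReal * (dualityMap r.toReal (S x) * f a x).re := by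
          refine integral_mono (hI1.sub hI2) (hgf.re.const_mul _) fun x => ?_
          have := norm_rpow_sub_le hρ2 (S x) ((∑ j ∈ J, f j) x)
          rw [hdiff] at this
          exact this
      _ = r.toReal * (∫ x, dualityMap r.toReal (S x) * f a x).re := by
          rw [integral_const_mul]
          congr 1
          exact integral_re hgf
      _ ≤ _ := by gcongr; exact Complex.re_le_norm _
  have h2 : ∫ x, dualityMap r.toReal (S x) * f a x =
      ∫ x, dualityMap r.toReal (S x) * conv (dil a (annulusKernel E)) (f a) x := by
    refine integral_congr_ae ?_
    filter_upwards [hloc a] with x hx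
    rw [← hx]
  have hN : ∀ j, 0 ≤ lpNorm (f j) r volume := fun j => lpNorm_nonneg
  have hL : ∀ y, eLpNorm (fun x => S (x + y) - S x) r volume ≤
      ENNReal.ofReal ((C * ∑ j ∈ insert a J, (2 : ℝ) ^ j * lpNorm (f j) r volume) * ‖y‖) := by
    intro y
    have hmem : ∀ j, MemLp (fun x => f j (x + y) - f j x) r volume := fun j =>
      ((hf j).comp_measurePreserving (measurePreserving_add_right volume y)).sub (hf j)
    have e1 : (fun x => S (x + y) - S x) = ∑ j ∈ insert a J, fun x => f j (x + y) - f j x := by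
      ext x; simp [hS, Finset.sum_apply, Finset.sum_sub_distrib]
    rw [e1]
    refine (eLpNorm_sum_le (fun j _ => (hmem j).1) hr1).trans ?_
    rw [Finset.mul_sum, Finset.sum_mul, ENNReal.ofReal_sum_of_nonneg (fun j _ => by
      have := hN j; positivity)]
    refine Finset.sum_le_sum fun j _ => ?_
    have e2 : eLpNorm (fun x => f j (x + y) - f j x) r volume =
        eLpNorm (fun x => conv (dil j (annulusKernel E)) (f j) x -
          conv (dil j (annulusKernel E)) (f j) (x - (-y))) r volume := by
      rw [← eLpNorm_neg]
      refine eLpNorm_congr_ae ?_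
      have h' := (measurePreserving_add_right (volume : Measure E) y).quasiMeasurePreserving.ae_eq_comp
        (hloc j)
      filter_upwards [hloc j, h'] with x hx hx'
      simp only [Function.comp] at hx'
      rw [Pi.neg_apply, sub_neg_eq_add, ← hx, ← hx']; ring
    rw [e2]
    refine (hC j r (f j) (-y) hr1 (hf j)).trans (le_of_eq ?_)
    rw [norm_neg, ← ofReal_lpNorm (hf j), ← ENNReal.ofReal_coe_nnreal,
      ← ENNReal.ofReal_mul C.coe_nonneg, ← ENNReal.ofReal_mul (by positivity)]
    congr 1; ring
  have hL0 : 0 ≤ C * ∑ j ∈ insert a J, (2 : ℝ) ^ j * lpNorm (f j) r volume :=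
    mul_nonneg C.coe_nonneg (Finset.sum_nonneg fun j _ => mul_nonneg (by positivity) (hN j))
  have h3 := norm_integral_dualityMap_mul_conv_le hr2 hr hSm (hf a) (dil a (annulusKernel E))
    (by rw [integral_dil, integral_annulusKernel]) hL0 hL
  rw [integral_norm_dil_mul_norm, ← hM] at h3
  rw [h2] at h1
  have h4 : r.toReal * ‖∫ x, dualityMap r.toReal (S x) * conv (dil a (annulusKernel E)) (f a) x‖ ≤
      r.toReal * (2 * r.toReal * lpNorm S r volume ^ (r.toReal - 2) * lpNorm (f a) r volume *
        (C * ∑ j ∈ insert a J, (2 : ℝ) ^ j * lpNorm (f j) r volume) * (((2 : ℝ) ^ a)⁻¹ * M)) := by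
    gcongr
  have h5 : r.toReal * (2 * r.toReal * lpNorm S r volume ^ (r.toReal - 2) * lpNorm (f a) r volume *
        (C * ∑ j ∈ insert a J, (2 : ℝ) ^ j * lpNorm (f j) r volume) * (((2 : ℝ) ^ a)⁻¹ * M)) =
      r.toReal * (2 * r.toReal * C * M) * lpNorm S r volume ^ (r.toReal - 2) *
            ∑ j ∈ insert a J, lpNorm (f a) r volume * lpNorm (f j) r volume *
              (2 : ℝ) ^ ((j : ℝ) - a) := by
    have e : ∑ j ∈ insert a J, lpNorm (f a) r volume * lpNorm (f j) r volume *
              (2 : ℝ) ^ ((j : ℝ) - a) = lpNorm (f a) r volume * ((2 : ℝ) ^ a)⁻¹ *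
                ∑ j ∈ insert a J, (2 : ℝ) ^ j * lpNorm (f j) r volume := by
      rw [Finset.mul_sum]
      refine Finset.sum_congr rfl fun j _ => ?_
      rw [Real.rpow_sub (by norm_num), Real.rpow_intCast, Real.rpow_intCast]
      ring
    rw [e]; ring
  linarith

/-- The embedding of `ℓ² L^r` into `L^r` for localized pieces, `2 ≤ r < ∞`. -/
theorem exists_lpNorm_sum_le_sqrt {r : ℝ≥0∞} (hr2 : 2 ≤ r) (hr : r ≠ ⊤) :
    ∃ C : ℝ, 0 ≤ C ∧ ∀ (f : ℤ → E → ℂ), (∀ j, MemLp (f j) r volume) →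
      (∀ j, Localized j (f j)) → ∀ J : Finset ℤ,
      lpNorm (∑ j ∈ J, f j) r volume ≤ C * √(∑ j ∈ J, lpNorm (f j) r volume ^ 2) := by
  obtain ⟨B, hB0, hB⟩ := exists_lpNorm_insert_rpow_le (E := E) hr2 hr
  have hρ2 : 2 ≤ r.toReal := by
    rw [← ENNReal.toReal_ofNat]; exact ENNReal.toReal_mono hr hr2
  refine ⟨√(2 * B), by positivity, fun f hf hloc => ?_⟩
  have hN : ∀ j, 0 ≤ lpNorm (f j) r volume := fun j => lpNorm_nonneg
  -- Blocks are added in increasing order of frequency, so that only weights with j ≤ a appear. The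
  -- number m bounds the norms of all initial segments, and hence the factors of power r - 2.
  have tele : ∀ (m : ℝ) (J : Finset ℤ), 0 ≤ m →
      (∀ a ∈ J, lpNorm (∑ j ∈ J with j ≤ a, f j) r volume ≤ m) →
      lpNorm (∑ j ∈ J, f j) r volume ^ r.toReal ≤ B * m ^ (r.toReal - 2) *
        ∑ a ∈ J, ∑ j ∈ J with j ≤ a, lpNorm (f a) r volume * lpNorm (f j) r volume *
              (2 : ℝ) ^ ((j : ℝ) - a) := by
    intro m J hm
    induction J using Finset.induction_on_max with
    | empty =>
      intro _
      simp [Real.zero_rpow (by linarith : r.toReal ≠ 0)]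
    | insert a J hlt ih =>
      intro hall
      have haJ : a ∉ J := fun h => lt_irrefl _ (hlt a h)
      have hfilt : ∀ b ∈ J, {j ∈ insert a J | j ≤ b} = {j ∈ J | j ≤ b} := fun b hb => by
        rw [Finset.filter_insert, if_neg (not_le.2 (hlt b hb))]
      have hfilta : {j ∈ insert a J | j ≤ a} = insert a J := by
        refine Finset.filter_true_of_mem fun j hj => ?_
        rcases Finset.mem_insert.1 hj with rfl | hj
        · exact le_rfl
        · exact (hlt j hj).le
      have ih' := ih fun b hb => by
        have := hall b (Finset.mem_insert_of_mem hb)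
        rwa [hfilt b hb] at this
      have hSm := hall a (Finset.mem_insert_self a J)
      rw [hfilta] at hSm
      rw [Finset.sum_insert haJ (f := fun a' => ∑ j ∈ insert a J with j ≤ a', _), hfilta, mul_add,
        add_comm]
      refine (hB f J a haJ hf hloc).trans ?_
      have hsum0 : 0 ≤ ∑ j ∈ insert a J, lpNorm (f a) r volume * lpNorm (f j) r volume *
              (2 : ℝ) ^ ((j : ℝ) - a) :=
        Finset.sum_nonneg fun j _ => mul_nonneg (mul_nonneg (hN a) (hN j)) (by positivity)
      have e : ∑ a' ∈ J, ∑ j ∈ insert a J with j ≤ a', lpNorm (f a') r volume *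
          lpNorm (f j) r volume * (2 : ℝ) ^ ((j : ℝ) - a') = ∑ a' ∈ J, ∑ j ∈ J with j ≤ a',
          lpNorm (f a') r volume * lpNorm (f j) r volume * (2 : ℝ) ^ ((j : ℝ) - a') :=
        Finset.sum_congr rfl fun b hb => by rw [hfilt b hb]
      rw [e]
      refine add_le_add ih' ?_
      have : lpNorm (∑ j ∈ insert a J, f j) r volume ^ (r.toReal - 2) ≤ m ^ (r.toReal - 2) :=
        Real.rpow_le_rpow lpNorm_nonneg hSm (by linarith)
      gcongr
  intro J
  induction J using Finset.strongInduction with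
  | H J ih =>
  set X := lpNorm (∑ j ∈ J, f j) r volume with hX
  set Q := ∑ j ∈ J, lpNorm (f j) r volume ^ 2 with hQ
  have hQ0 : 0 ≤ Q := Finset.sum_nonneg fun j _ => sq_nonneg _
  -- If the bound fails for J, every proper initial segment still satisfies it by induction and so
  -- has norm below X. Therefore m = X is allowed in `tele`, and dividing by X^{r-2} contradicts the
  -- failure.
  by_contra! hlt
  have hX0 : 0 < X := lt_of_le_of_lt (by positivity) hlt
  have h1 := tele X J hX0.le fun a ha => by
    by_cases h : {j ∈ J | j ≤ a} = J
    · rw [h]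
    · have hss : {j ∈ J | j ≤ a} ⊂ J := (Finset.filter_subset _ _).ssubset_of_ne h
      refine (ih _ hss).trans (le_trans ?_ hlt.le)
      gcongr
      exact Finset.sum_le_sum_of_subset_of_nonneg (Finset.filter_subset _ _)
        fun j _ _ => sq_nonneg _
  have h2 := sum_sum_mul_rpow_le J fun j => lpNorm (f j) r volume
  have h3 : X ^ r.toReal ≤ B * X ^ (r.toReal - 2) * (2 * Q) := by
    refine h1.trans ?_
    gcongr
  have h4 : X ^ r.toReal = X ^ (r.toReal - 2) * X ^ 2 := by
    rw [← Real.rpow_natCast X 2, ← Real.rpow_add hX0]; congr 1; push_cast; ring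
  rw [h4] at h3
  have h5 : X ^ 2 ≤ 2 * B * Q := by
    have hp : 0 < X ^ (r.toReal - 2) := by positivity
    refine le_of_mul_le_mul_left ?_ hp
    linarith
  have h6 : X ≤ √(2 * B) * √Q := by
    rw [← Real.sqrt_mul (by positivity)]
    exact Real.le_sqrt_of_sq_le h5
  linarith

/-- The Sobolev embedding of `ℓ² L^p` with the scaling weights into `L^r`,
`2 ≤ p ≤ r < ∞`. -/
theorem exists_lpNorm_sum_le_sqrt_of_le {p r : ℝ≥0∞} (hp : 2 ≤ p) (hpr : p ≤ r) (hr : r ≠ ⊤) :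
    ∃ C : ℝ, 0 ≤ C ∧ ∀ (f : ℤ → E → ℂ), (∀ j, MemLp (f j) p volume) →
      (∀ j, Localized j (f j)) → ∀ J : Finset ℤ,
      lpNorm (∑ j ∈ J, f j) r volume ≤ C * √(∑ j ∈ J,
        ((2 : ℝ) ^ ((j : ℝ) * (Module.finrank ℝ E * (p⁻¹.toReal - r⁻¹.toReal))) *
          lpNorm (f j) p volume) ^ 2) := by
  obtain ⟨C₁, hC₁, h₁⟩ := exists_lpNorm_le_of_localized (E := E) p r (le_trans (by norm_num) hp) hpr
  obtain ⟨C₂, hC₂, h₂⟩ := exists_lpNorm_sum_le_sqrt (E := E) (hp.trans hpr) hr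
  refine ⟨C₂ * C₁, by positivity, fun f hf hloc J => ?_⟩
  refine (h₂ f (fun j => (h₁ j (f j) (hf j) (hloc j)).1) hloc J).trans ?_
  rw [mul_assoc]
  gcongr
  rw [← Real.sqrt_sq hC₁, ← Real.sqrt_mul (by positivity), Finset.mul_sum]
  refine Real.sqrt_le_sqrt (Finset.sum_le_sum fun j _ => ?_)
  rw [← mul_pow, ← mul_assoc]
  exact pow_le_pow_left₀ lpNorm_nonneg (h₁ j (f j) (hf j) (hloc j)).2 2

end

/-! ### Hybrid weights, low-pass sums and paraproducts -/

section

/-- The logarithm of the dyadic weight with regularity `s` at low frequency and `t` at high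
frequency. -/
noncomputable def logWeight (s t : ℝ) (j : ℤ) : ℝ := if j ≤ 0 then j * s else j * t

theorem logWeight_add (s t s' t' : ℝ) (j : ℤ) :
    logWeight (s + s') (t + t') j = logWeight s t j + logWeight s' t' j := by
  unfold logWeight; split_ifs <;> ring

theorem logWeight_neg (s t : ℝ) (j : ℤ) : logWeight (-s) (-t) j = -logWeight s t j := by
  unfold logWeight; split_ifs <;> ring

/-- The weight is Lipschitz in the index, so comparable frequencies have comparable weights; this
pays for the bounded shifts in the paraproducts. -/
theorem abs_logWeight_add_sub_le (s t : ℝ) (k m : ℤ) :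
    |logWeight s t (k + m) - logWeight s t k| ≤ (|s| + |t|) * |(m : ℝ)| := by
  have hs := abs_nonneg s
  have ht := abs_nonneg t
  have hmul : ∀ x y : ℝ, |x| ≤ |y| → ∀ u : ℝ, |x * u| ≤ |y| * |u| := fun x y h u => by
    rw [abs_mul]; gcongr
  unfold logWeight
  push_cast
  split_ifs with h1 h2 h2
  · rw [show ((k : ℝ) + m) * s - k * s = m * s by ring, abs_mul]
    nlinarith [abs_nonneg (m : ℝ)]
  · have hk : (0 : ℝ) < k := by exact_mod_cast not_le.1 h2
    have hkm : (k : ℝ) + m ≤ 0 := by exact_mod_cast h1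
    have hm : |(m : ℝ)| = -m := abs_of_neg (by linarith)
    have e1 := hmul (k + m) m (by rw [hm, abs_of_nonpos hkm]; linarith) s
    have e2 := hmul k m (by rw [hm, abs_of_pos hk]; linarith) t
    calc _ ≤ |((k : ℝ) + m) * s| + |(k : ℝ) * t| := abs_sub _ _
      _ ≤ _ := by linarith
  · have hk : (k : ℝ) ≤ 0 := by exact_mod_cast h2
    have hkm : 0 < (k : ℝ) + m := by exact_mod_cast not_le.1 h1
    have hm : |(m : ℝ)| = m := abs_of_pos (by linarith)
    have e1 := hmul (k + m) m (by rw [hm, abs_of_pos hkm]; linarith) t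
    have e2 := hmul k m (by rw [hm, abs_of_nonpos hk]; linarith) s
    calc _ ≤ |((k : ℝ) + m) * t| + |(k : ℝ) * s| := abs_sub _ _
      _ ≤ _ := by linarith
  · rw [show ((k : ℝ) + m) * t - k * t = m * t by ring, abs_mul]
    nlinarith [abs_nonneg (m : ℝ)]

/-- The exponent on the left is the Sobolev loss minus the available regularity. At low frequency it
increases with j because s ≤ A; at positive j it is at most jη, and η ≥ 0 lets j be replaced by k.
-/
theorem sub_logWeight_le {A s t σ η : ℝ} (hs : s ≤ A) (hσ : σ ≤ A - s) (hη : 0 ≤ η)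
    (ht : A - t ≤ η) {j k : ℤ} (hjk : j ≤ k) : j * A - logWeight s t j ≤ logWeight σ η k := by
  have hjk' : (j : ℝ) ≤ k := by exact_mod_cast hjk
  unfold logWeight
  split_ifs with h1 h2 h2
  · have hk : (k : ℝ) ≤ 0 := by exact_mod_cast h2
    nlinarith
  · have hk : (0 : ℝ) < k := by exact_mod_cast not_le.1 h2
    have hj : (j : ℝ) ≤ 0 := by exact_mod_cast h1
    nlinarith
  · omega
  · have hj : (0 : ℝ) < j := by exact_mod_cast not_le.1 h1
    nlinarith

/-- The square-summed form of `sub_logWeight_le`, needed for r = ∞. Strict inequality s < A sums the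
negative indices. For positive indices either η > 0, and the series is dominated by its top term, or
A < t, and it converges while the weight on the right is at least 1. -/
theorem exists_sum_rpow_sub_logWeight_le {A s t σ η : ℝ} (hs : s < A) (hσ : σ ≤ A - s) (hη : 0 ≤ η)
    (ht : A - t ≤ η) (h : 0 < η ∨ A < t) :
    ∃ C : ℝ, 0 ≤ C ∧ ∀ (J : Finset ℤ) (k : ℤ),
      ∑ j ∈ J with j ≤ k, ((2 : ℝ) ^ (j * A - logWeight s t j)) ^ 2 ≤
        C * ((2 : ℝ) ^ logWeight σ η k) ^ 2 := by
  have hsq : ∀ x : ℝ, ((2 : ℝ) ^ x) ^ 2 = 2 ^ (2 * x) := fun x => by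
    rw [← Real.rpow_natCast, ← Real.rpow_mul (by norm_num)]; push_cast; ring_nf
  set C₁ := (1 - (2 : ℝ) ^ (-(2 * (A - s))))⁻¹ with hC₁
  have low : ∀ (J : Finset ℤ) (k : ℤ), k ≤ 0 →
      ∑ j ∈ J with j ≤ k, ((2 : ℝ) ^ (j * A - logWeight s t j)) ^ 2 ≤
        C₁ * ((2 : ℝ) ^ logWeight σ η k) ^ 2 := by
    intro J k hk
    have h1 := sum_filter_le_rpow_le (show 0 < 2 * (A - s) by linarith) J k
    have hk' : (k : ℝ) ≤ 0 := by exact_mod_cast hk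
    have h2 : (2 : ℝ) ^ (2 * (A - s) * k) ≤ ((2 : ℝ) ^ logWeight σ η k) ^ 2 := by
      rw [hsq]
      refine Real.rpow_le_rpow_of_exponent_le one_le_two ?_
      rw [logWeight, if_pos hk]; nlinarith
    have h3 : ∑ j ∈ J with j ≤ k, ((2 : ℝ) ^ (j * A - logWeight s t j)) ^ 2 =
        (∑ j ∈ J with j ≤ k, (2 : ℝ) ^ (2 * (A - s) * ((j : ℝ) - k))) *
          (2 : ℝ) ^ (2 * (A - s) * k) := by
      rw [Finset.sum_mul]
      refine Finset.sum_congr rfl fun j hj => ?_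
      have hj0 : j ≤ 0 := (Finset.mem_filter.1 hj).2.trans hk
      rw [hsq, ← Real.rpow_add (by norm_num), logWeight, if_pos hj0]
      ring_nf
    rw [h3]
    exact mul_le_mul h1 h2 (by positivity) (le_trans (Finset.sum_nonneg fun j _ => by positivity) h1)
  have high : ∃ C₂ : ℝ, 0 ≤ C₂ ∧ ∀ (J : Finset ℤ) (k : ℤ), 0 < k →
      ∑ j ∈ J with 0 < j ∧ j ≤ k, ((2 : ℝ) ^ (j * A - logWeight s t j)) ^ 2 ≤
        C₂ * ((2 : ℝ) ^ logWeight σ η k) ^ 2 := by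
    rcases h with h | h
    · refine ⟨(1 - (2 : ℝ) ^ (-(2 * η)))⁻¹, inv_nonneg.2 (sub_nonneg.2
        (Real.rpow_le_one_of_one_le_of_nonpos one_le_two (by linarith))), fun J k hk => ?_⟩
      have h1 := sum_filter_le_rpow_le (show 0 < 2 * η by linarith) {j ∈ J | 0 < j} k
      rw [Finset.filter_filter] at h1
      have h3 : ∑ j ∈ J with 0 < j ∧ j ≤ k, ((2 : ℝ) ^ (j * A - logWeight s t j)) ^ 2 ≤
          (∑ j ∈ J with 0 < j ∧ j ≤ k, (2 : ℝ) ^ (2 * η * ((j : ℝ) - k))) *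
            ((2 : ℝ) ^ logWeight σ η k) ^ 2 := by
        rw [Finset.sum_mul]
        refine Finset.sum_le_sum fun j hj => ?_
        have hj0 : 0 < j := (Finset.mem_filter.1 hj).2.1
        have hj0' : (0 : ℝ) < j := by exact_mod_cast hj0
        rw [hsq, hsq, ← Real.rpow_add (by norm_num), logWeight, if_neg (not_le.2 hj0), logWeight,
          if_neg (not_le.2 hk)]
        refine Real.rpow_le_rpow_of_exponent_le one_le_two ?_
        nlinarith
      refine h3.trans ?_
      gcongr
    · refine ⟨(1 - (2 : ℝ) ^ (-(2 * (t - A))))⁻¹, inv_nonneg.2 (sub_nonneg.2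
        (Real.rpow_le_one_of_one_le_of_nonpos one_le_two (by linarith))), fun J k hk => ?_⟩
      have h1 := sum_filter_ge_rpow_le (show 0 < 2 * (t - A) by linarith) J 0
      have hk' : (0 : ℝ) < k := by exact_mod_cast hk
      have h2 : (1 : ℝ) ≤ ((2 : ℝ) ^ logWeight σ η k) ^ 2 := by
        rw [hsq]
        refine Real.one_le_rpow one_le_two ?_
        rw [logWeight, if_neg (not_le.2 hk)]; positivity
      have h3 : ∑ j ∈ J with 0 < j ∧ j ≤ k, ((2 : ℝ) ^ (j * A - logWeight s t j)) ^ 2 ≤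
          ∑ j ∈ J with 0 ≤ j, (2 : ℝ) ^ (2 * (t - A) * (((0 : ℤ) : ℝ) - j)) := by
        refine le_trans (le_of_eq ?_) (Finset.sum_le_sum_of_subset_of_nonneg
          (s := {j ∈ J | 0 < j ∧ j ≤ k}) ?_ fun j _ _ => by positivity)
        · refine Finset.sum_congr rfl fun j hj => ?_
          have hj0 : 0 < j := (Finset.mem_filter.1 hj).2.1
          rw [hsq, logWeight, if_neg (not_le.2 hj0)]
          push_cast; ring_nf
        · intro j hj
          simp only [Finset.mem_filter] at hj ⊢
          exact ⟨hj.1, hj.2.1.le⟩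
      refine (h3.trans h1).trans (le_mul_of_one_le_right ?_ h2)
      exact le_trans (Finset.sum_nonneg fun j _ => by positivity) h1
  obtain ⟨C₂, hC₂0, hC₂⟩ := high
  have hC₁0 : 0 ≤ C₁ := inv_nonneg.2 (sub_nonneg.2
    (Real.rpow_le_one_of_one_le_of_nonpos one_le_two (by linarith)))
  refine ⟨C₁ + C₂, by positivity, fun J k => ?_⟩
  rcases le_or_gt k 0 with hk | hk
  · refine (low J k hk).trans ?_
    gcongr
    linarith
  · have hsplit : ∑ j ∈ J with j ≤ k, ((2 : ℝ) ^ (j * A - logWeight s t j)) ^ 2 =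
        ∑ j ∈ J with j ≤ 0, ((2 : ℝ) ^ (j * A - logWeight s t j)) ^ 2 +
          ∑ j ∈ J with 0 < j ∧ j ≤ k, ((2 : ℝ) ^ (j * A - logWeight s t j)) ^ 2 := by
      rw [← Finset.sum_union]
      · congr 1
        ext j
        simp only [Finset.mem_union, Finset.mem_filter]
        constructor
        · rintro ⟨h1, h2⟩
          rcases le_or_gt j 0 with h3 | h3
          · exact Or.inl ⟨h1, h3⟩
          · exact Or.inr ⟨h1, h3, h2⟩
        · rintro (⟨h1, h2⟩ | ⟨h1, h2, h3⟩)
          · exact ⟨h1, h2.trans hk.le⟩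
          · exact ⟨h1, h3⟩
      · rw [Finset.disjoint_left]
        intro j h1 h2
        exact absurd (Finset.mem_filter.1 h2).2.1 (not_lt.2 (Finset.mem_filter.1 h1).2)
    have hk' : (0 : ℝ) < k := by exact_mod_cast hk
    have h0 : ((2 : ℝ) ^ logWeight σ η 0) ^ 2 ≤ ((2 : ℝ) ^ logWeight σ η k) ^ 2 := by
      rw [hsq, hsq]
      refine Real.rpow_le_rpow_of_exponent_le one_le_two ?_
      have e : logWeight σ η 0 = 0 := by simp [logWeight]
      rw [e, logWeight, if_neg (not_le.2 hk)]; simp; positivity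
    rw [hsplit, add_mul]
    refine add_le_add ((low J 0 le_rfl).trans ?_) (hC₂ J k hk)
    gcongr

variable {E : Type*} [NormedAddCommGroup E] [InnerProductSpace ℝ E] [FiniteDimensional ℝ E]
  [MeasurableSpace E] [BorelSpace E]

/-- A family of `L^p` functions, the `j`-th one having frequencies of size `2^j`. -/
structure DyadicFamily (p : ℝ≥0∞) (f : ℤ → E → ℂ) : Prop where
  memLp : ∀ j, MemLp (f j) p volume
  localized : ∀ j, Localized j (f j)

/-- The weighted `ℓ² L^p` norm of the part of a family indexed by `J`. -/
noncomputable def besovSum (s t : ℝ) (p : ℝ≥0∞) (J : Finset ℤ) (f : ℤ → E → ℂ) : ℝ :=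
  √(∑ j ∈ J, ((2 : ℝ) ^ logWeight s t j * lpNorm (f j) p volume) ^ 2)

theorem besovSum_nonneg (s t : ℝ) (p : ℝ≥0∞) (J : Finset ℤ) (f : ℤ → E → ℂ) :
    0 ≤ besovSum s t p J f := Real.sqrt_nonneg _

/-- Bounds for the low-pass filtered sums of a family. -/
theorem exists_lpNorm_lowpass_le {p r : ℝ≥0∞} (hp : 2 ≤ p) (hpr : p ≤ r) {A s t σ η : ℝ}
    (hA : A = Module.finrank ℝ E * (p⁻¹.toReal - r⁻¹.toReal)) (hs : s ≤ A) (hσ : σ ≤ A - s)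
    (hη : 0 ≤ η) (ht : A - t ≤ η) (hs' : r = ⊤ → s < A) (ht' : r = ⊤ → 0 < η ∨ A < t) :
    ∃ C : ℝ, 0 ≤ C ∧ ∀ (f : ℤ → E → ℂ), DyadicFamily p f → ∀ (J : Finset ℤ) (k : ℤ),
      MemLp (∑ j ∈ J with j ≤ k, f j) r volume ∧
      lpNorm (∑ j ∈ J with j ≤ k, f j) r volume ≤
        C * (2 : ℝ) ^ logWeight σ η k * besovSum s t p J f := by
  have hp1 : 1 ≤ p := le_trans (by norm_num) hp
  obtain ⟨C₁, hC₁, h₁⟩ := exists_lpNorm_le_of_localized (E := E) p r hp1 hpr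
  have hmem : ∀ (f : ℤ → E → ℂ), DyadicFamily p f → ∀ I : Finset ℤ,
      MemLp (∑ j ∈ I, f j) r volume := fun f hf I =>
    memLp_finsetSum' _ fun j _ => (h₁ j (f j) (hf.memLp j) (hf.localized j)).1
  have hsplit : ∀ (f : ℤ → E → ℂ) (j : ℤ), (2 : ℝ) ^ ((j : ℝ) * A) * lpNorm (f j) p volume =
      (2 : ℝ) ^ (j * A - logWeight s t j) *
        ((2 : ℝ) ^ logWeight s t j * lpNorm (f j) p volume) := fun f j => by
    rw [← mul_assoc, ← Real.rpow_add (by norm_num), sub_add_cancel]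
  -- For r = ∞ the triangle inequality and Cauchy–Schwarz in j are used, at the price of the strict
  -- hypotheses. For r < ∞ the ℓ² embedding applies and a pointwise comparison of weights suffices.
  by_cases hr : r = ⊤
  · obtain ⟨C₂, hC₂, h₂⟩ := exists_sum_rpow_sub_logWeight_le (hs' hr) hσ hη ht (ht' hr)
    refine ⟨C₁ * √C₂, by positivity, fun f hf J k => ⟨hmem f hf _, ?_⟩⟩
    calc lpNorm (∑ j ∈ J with j ≤ k, f j) r volume
        ≤ ∑ j ∈ J with j ≤ k, lpNorm (f j) r volume :=
          lpNorm_sum_le (fun j _ => (h₁ j (f j) (hf.memLp j) (hf.localized j)).1) (hp1.trans hpr)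
      _ ≤ ∑ j ∈ J with j ≤ k, C₁ * ((2 : ℝ) ^ (j * A - logWeight s t j) *
          ((2 : ℝ) ^ logWeight s t j * lpNorm (f j) p volume)) := by
          refine Finset.sum_le_sum fun j _ => ?_
          refine (h₁ j (f j) (hf.memLp j) (hf.localized j)).2.trans (le_of_eq ?_)
          rw [← hsplit, hA, mul_assoc]
      _ ≤ C₁ * (√(∑ j ∈ J with j ≤ k, ((2 : ℝ) ^ (j * A - logWeight s t j)) ^ 2) *
          √(∑ j ∈ J with j ≤ k, ((2 : ℝ) ^ logWeight s t j * lpNorm (f j) p volume) ^ 2)) := by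
          rw [← Finset.mul_sum]
          gcongr
          exact Real.sum_mul_le_sqrt_mul_sqrt _ _ _
      _ ≤ C₁ * (√(C₂ * ((2 : ℝ) ^ logWeight σ η k) ^ 2) * besovSum s t p J f) := by
          gcongr
          · exact h₂ J k
          · exact Real.sqrt_le_sqrt (Finset.sum_le_sum_of_subset_of_nonneg
              (Finset.filter_subset _ _) fun j _ _ => sq_nonneg _)
      _ = _ := by
          rw [Real.sqrt_mul hC₂, Real.sqrt_sq (by positivity)]; ring
  · obtain ⟨C₂, hC₂, h₂⟩ := exists_lpNorm_sum_le_sqrt_of_le (E := E) hp hpr hr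
    refine ⟨C₂, hC₂, fun f hf J k => ⟨hmem f hf _, ?_⟩⟩
    refine (h₂ f hf.memLp hf.localized _).trans ?_
    rw [mul_assoc]
    gcongr
    rw [← Real.sqrt_sq (show 0 ≤ (2 : ℝ) ^ logWeight σ η k by positivity), besovSum,
      ← Real.sqrt_mul (by positivity), Finset.mul_sum]
    refine Real.sqrt_le_sqrt ?_
    refine (Finset.sum_le_sum (g := fun j => ((2 : ℝ) ^ logWeight σ η k) ^ 2 *
      ((2 : ℝ) ^ logWeight s t j * lpNorm (f j) p volume) ^ 2) fun j hj => ?_).trans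
      (Finset.sum_le_sum_of_subset_of_nonneg (Finset.filter_subset _ _) fun j _ _ => by positivity)
    rw [← mul_pow, ← hA, hsplit]
    have hl : 0 ≤ lpNorm (f j) p volume := lpNorm_nonneg
    gcongr
    · exact one_le_two
    · exact sub_logWeight_le hs hσ hη ht (Finset.mem_filter.1 hj).2

theorem norm_integral_mul_mul_le {F G H : E → ℂ} {p q r : ℝ≥0∞} (h : r⁻¹ + p⁻¹ + q⁻¹ = 1)
    (hF : MemLp F r volume) (hG : MemLp G p volume) (hH : MemLp H q volume) :
    Integrable (fun x => F x * G x * H x) volume ∧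
    ‖∫ x, F x * G x * H x‖ ≤ lpNorm F r volume * lpNorm G p volume * lpNorm H q volume := by
  have t₀ : ENNReal.HolderTriple r p (r⁻¹ + p⁻¹)⁻¹ := ⟨by simp⟩
  have t₁ : ENNReal.HolderTriple (r⁻¹ + p⁻¹)⁻¹ q 1 := ⟨by simp [h]⟩
  have hFG : MemLp (fun x => F x * G x) (r⁻¹ + p⁻¹)⁻¹ volume := hG.mul' hF
  have hint := hH.mul' hFG (r := 1)
  rw [memLp_one_iff_integrable] at hint
  refine ⟨hint, ?_⟩
  have h1 : ‖∫ x, F x * G x * H x‖ₑ ≤ ENNReal.ofReal (lpNorm F r volume * lpNorm G p volume *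
      lpNorm H q volume) := by
    refine (enorm_integral_le_lintegral_enorm _).trans ?_
    rw [← eLpNorm_one_eq_lintegral_enorm, ENNReal.ofReal_mul (mul_nonneg lpNorm_nonneg lpNorm_nonneg),
      ENNReal.ofReal_mul lpNorm_nonneg, ofReal_lpNorm hF, ofReal_lpNorm hG, ofReal_lpNorm hH]
    refine (eLpNorm_mul_le (p := (r⁻¹ + p⁻¹)⁻¹) (q := q) (r := 1) hFG.1 hH.1).trans ?_
    gcongr
    exact eLpNorm_mul_le (p := r) (q := p) (r := (r⁻¹ + p⁻¹)⁻¹) hF.1 hG.1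
  rw [← ofReal_norm] at h1
  exact (ENNReal.ofReal_le_ofReal_iff
    (mul_nonneg (mul_nonneg lpNorm_nonneg lpNorm_nonneg) lpNorm_nonneg)).1 h1

theorem sum_sq_shift_le (a : ℤ → ℝ) (J K : Finset ℤ) (m : ℤ) (hK : ∀ k ∈ K, k + m ∈ J) :
    ∑ k ∈ K, a (k + m) ^ 2 ≤ ∑ j ∈ J, a j ^ 2 := by
  have e := Finset.sum_map K (addRightEmbedding m) fun j => a j ^ 2
  simp only [addRightEmbedding_apply] at e
  rw [← e]
  refine Finset.sum_le_sum_of_subset_of_nonneg (fun j hj => ?_) fun j _ _ => sq_nonneg _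
  obtain ⟨k, hk, rfl⟩ := Finset.mem_map.1 hj
  exact hK k hk

/-- Paraproduct bound: the first family is at low frequency. -/
theorem exists_sum_norm_integral_lowpass_le {p₁ p₂ p₃ r : ℝ≥0∞} (hp : 2 ≤ p₁) (hpr : p₁ ≤ r)
    (hr : r⁻¹ + p₂⁻¹ + p₃⁻¹ = 1) {A s₁ s₂ s₃ t₁ t₂ t₃ : ℝ}
    (hA : A = Module.finrank ℝ E * (p₁⁻¹.toReal - r⁻¹.toReal)) (hs : s₁ ≤ A)
    (hsum : s₁ + s₂ + s₃ ≤ A) (htsum : A ≤ t₁ + t₂ + t₃) (ht : 0 ≤ t₂ + t₃)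
    (hs' : r = ⊤ → s₁ < A) (ht' : r = ⊤ → 0 < t₂ + t₃ ∨ A < t₁) (m n : ℤ) :
    ∃ C : ℝ, 0 ≤ C ∧ ∀ f g h : ℤ → E → ℂ, DyadicFamily p₁ f → DyadicFamily p₂ g →
      DyadicFamily p₃ h → ∀ J K : Finset ℤ, (∀ k ∈ K, k + m ∈ J ∧ k + n ∈ J) →
      ∑ k ∈ K, ‖∫ x, (∑ j ∈ J with j ≤ k, f j) x * g (k + m) x * h (k + n) x‖ ≤
        C * (besovSum s₁ t₁ p₁ J f * besovSum s₂ t₂ p₂ J g * besovSum s₃ t₃ p₃ J h) := by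
  obtain ⟨C, hC, hlow⟩ := exists_lpNorm_lowpass_le (E := E) hp hpr hA hs
    (show s₂ + s₃ ≤ A - s₁ by linarith) ht (show A - t₁ ≤ t₂ + t₃ by linarith) hs' ht'
  -- The cost of moving the weights of the second and third families from k to k + m and k + n.
  set D : ℝ := 2 ^ ((|s₂| + |t₂|) * |(m : ℝ)| + (|s₃| + |t₃|) * |(n : ℝ)|) with hD
  refine ⟨C * D, by positivity, fun f g h hf hg hh J K hK => ?_⟩
  set β : ℤ → ℝ := fun k => (2 : ℝ) ^ logWeight s₂ t₂ k * lpNorm (g k) p₂ volume with hβ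
  set γ : ℤ → ℝ := fun k => (2 : ℝ) ^ logWeight s₃ t₃ k * lpNorm (h k) p₃ volume with hγ
  have hβ0 : ∀ k, 0 ≤ β k := fun k => mul_nonneg (by positivity) lpNorm_nonneg
  have hγ0 : ∀ k, 0 ≤ γ k := fun k => mul_nonneg (by positivity) lpNorm_nonneg
  have hB0 := besovSum_nonneg s₁ t₁ p₁ J f
  have hterm : ∀ k ∈ K, ‖∫ x, (∑ j ∈ J with j ≤ k, f j) x * g (k + m) x * h (k + n) x‖ ≤
      C * D * besovSum s₁ t₁ p₁ J f * (β (k + m) * γ (k + n)) := by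
    intro k _
    refine (norm_integral_mul_mul_le hr (hlow f hf J k).1 (hg.memLp _) (hh.memLp _)).2.trans ?_
    have e : (2 : ℝ) ^ logWeight (s₂ + s₃) (t₂ + t₃) k ≤
        D * ((2 : ℝ) ^ logWeight s₂ t₂ (k + m) * (2 : ℝ) ^ logWeight s₃ t₃ (k + n)) := by
      rw [hD, ← Real.rpow_add (by norm_num), ← Real.rpow_add (by norm_num), logWeight_add]
      refine Real.rpow_le_rpow_of_exponent_le one_le_two ?_
      have h1 := neg_abs_le (logWeight s₂ t₂ (k + m) - logWeight s₂ t₂ k)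
      have h2 := neg_abs_le (logWeight s₃ t₃ (k + n) - logWeight s₃ t₃ k)
      have h3 := abs_logWeight_add_sub_le s₂ t₂ k m
      have h4 := abs_logWeight_add_sub_le s₃ t₃ k n
      linarith
    have hG : 0 ≤ lpNorm (g (k + m)) p₂ volume := lpNorm_nonneg
    have hH : 0 ≤ lpNorm (h (k + n)) p₃ volume := lpNorm_nonneg
    calc _ ≤ C * (2 : ℝ) ^ logWeight (s₂ + s₃) (t₂ + t₃) k * besovSum s₁ t₁ p₁ J f *
        lpNorm (g (k + m)) p₂ volume * lpNorm (h (k + n)) p₃ volume := by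
          gcongr
          exact (hlow f hf J k).2
      _ ≤ C * (D * ((2 : ℝ) ^ logWeight s₂ t₂ (k + m) * (2 : ℝ) ^ logWeight s₃ t₃ (k + n))) *
        besovSum s₁ t₁ p₁ J f * lpNorm (g (k + m)) p₂ volume * lpNorm (h (k + n)) p₃ volume := by
          gcongr
      _ = _ := by rw [hβ, hγ]; ring
  refine (Finset.sum_le_sum hterm).trans ?_
  rw [← Finset.mul_sum]
  -- The low-pass factor is already bounded uniformly after normalization, so only two
  -- square-summable sequences in k remain.
  have hCS : ∑ k ∈ K, β (k + m) * γ (k + n) ≤ besovSum s₂ t₂ p₂ J g * besovSum s₃ t₃ p₃ J h := by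
    refine (Real.sum_mul_le_sqrt_mul_sqrt _ _ _).trans ?_
    exact mul_le_mul (Real.sqrt_le_sqrt (sum_sq_shift_le β J K m fun k hk => (hK k hk).1))
      (Real.sqrt_le_sqrt (sum_sq_shift_le γ J K n fun k hk => (hK k hk).2)) (Real.sqrt_nonneg _)
      (Real.sqrt_nonneg _)
  calc _ ≤ C * D * besovSum s₁ t₁ p₁ J f * (besovSum s₂ t₂ p₂ J g * besovSum s₃ t₃ p₃ J h) := by
        gcongr
    _ = _ := by ring

end

/-! ### The trilinear estimate for finite sums -/

section

/-- Reindexing of a sum over a neighbourhood of the diagonal by the (shifted) minimum. -/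
theorem sum_near_diagonal_le (Q : ℤ → ℤ → ℤ → ℝ) (hQ : ∀ i k l, 0 ≤ Q i k l) (J : Finset ℤ)
    {a b : ℤ} (ha : 0 ≤ a ∧ a ≤ 1) (hb : 0 ≤ b ∧ b ≤ 1) :
    ∑ x ∈ J ×ˢ J with |x.1 - x.2| ≤ 5, Q (min (x.1 - a) (x.2 - b)) x.1 x.2 ≤
      ∑ y ∈ Finset.Icc (0 : ℤ) 6 ×ˢ Finset.Icc (0 : ℤ) 6,
        ∑ i ∈ J.image (fun k => k - y.1) with i + y.2 ∈ J, Q i (i + y.1) (i + y.2) := by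
  rw [Finset.sum_sigma']
  -- A pair (k, l) is recorded as its offsets from the shifted minimum i together with i. Both
  -- offsets lie in [0, 6], since |k - l| ≤ 5 and the shifts a, b are at most 1.
  set e : ℤ × ℤ → (_ : ℤ × ℤ) × ℤ := fun x =>
    ⟨(x.1 - min (x.1 - a) (x.2 - b), x.2 - min (x.1 - a) (x.2 - b)), min (x.1 - a) (x.2 - b)⟩ with he
  have hinj : Function.Injective e := by
    rintro ⟨k, l⟩ ⟨k', l'⟩ h
    simp only [he, Sigma.mk.injEq, Prod.mk.injEq, heq_eq_eq] at h
    ext <;> simp only <;> omega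
  have h1 : ∑ x ∈ J ×ˢ J with |x.1 - x.2| ≤ 5, Q (min (x.1 - a) (x.2 - b)) x.1 x.2 =
      ∑ z ∈ ({x ∈ J ×ˢ J | |x.1 - x.2| ≤ 5}).image e, Q z.2 (z.2 + z.1.1) (z.2 + z.1.2) := by
    rw [Finset.sum_image hinj.injOn]
    refine Finset.sum_congr rfl fun x _ => ?_
    simp only [he, add_sub_cancel]
  rw [h1]
  refine Finset.sum_le_sum_of_subset_of_nonneg (fun z hz => ?_) fun _ _ _ => hQ _ _ _
  obtain ⟨⟨k, l⟩, hx, rfl⟩ := Finset.mem_image.1 hz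
  simp only [Finset.mem_filter, Finset.mem_product, abs_le] at hx
  simp only [he, Finset.mem_sigma, Finset.mem_product, Finset.mem_Icc, Finset.mem_filter,
    Finset.mem_image, add_sub_cancel]
  refine ⟨by omega, ⟨k, hx.1.1, by ring⟩, hx.1.2⟩

variable {E : Type*} [NormedAddCommGroup E] [InnerProductSpace ℝ E] [FiniteDimensional ℝ E]
  [MeasurableSpace E] [BorelSpace E]

/-- The conditions on the indices in the trilinear estimate, in dimension `n`. -/
structure Admissible (n : ℝ) (p : Fin 3 → ℝ≥0∞) (s t : Fin 3 → ℝ) : Prop where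
  two_le : ∀ a, 2 ≤ p a
  one_le : 1 ≤ (p 0)⁻¹.toReal + (p 1)⁻¹.toReal + (p 2)⁻¹.toReal
  low_le : ∀ a, s a ≤ n * ((p 0)⁻¹.toReal + (p 1)⁻¹.toReal + (p 2)⁻¹.toReal - 1)
  low_sum_le : s 0 + s 1 + s 2 ≤ n * ((p 0)⁻¹.toReal + (p 1)⁻¹.toReal + (p 2)⁻¹.toReal - 1)
  le_high_sum : n * ((p 0)⁻¹.toReal + (p 1)⁻¹.toReal + (p 2)⁻¹.toReal - 1) ≤ t 0 + t 1 + t 2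
  high_le : ∀ a, t a ≤ t 0 + t 1 + t 2
  low_lt : ∀ a, s a < n * (p a)⁻¹.toReal
  not_endpoint : ∀ a a' a'', a ≠ a' → a ≠ a'' → a' ≠ a'' → p a' = 2 → p a'' = 2 →
    t a' + t a'' = 0 → t a ≠ n * (p a)⁻¹.toReal

theorem sum_of_pairwise_ne {a a' a'' : Fin 3} (h₁ : a ≠ a') (h₂ : a ≠ a'') (h₃ : a' ≠ a'')
    (v : Fin 3 → ℝ) : v a + v a' + v a'' = v 0 + v 1 + v 2 := by
  fin_cases a <;> fin_cases a' <;> fin_cases a'' <;> simp_all <;> ring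

theorem toReal_inv_le_half {p : ℝ≥0∞} (h : 2 ≤ p) : p⁻¹.toReal ≤ 1 / 2 := by
  have := ENNReal.toReal_mono (by simp) (ENNReal.inv_le_inv.2 h)
  simpa using this

theorem inv_ne_top_of_two_le {p : ℝ≥0∞} (h : 2 ≤ p) : p⁻¹ ≠ ⊤ :=
  ENNReal.inv_ne_top.2 (lt_of_lt_of_le (by norm_num) h).ne'

theorem inv_add_inv_le_one {p q : ℝ≥0∞} (hp : 2 ≤ p) (hq : 2 ≤ q) : p⁻¹ + q⁻¹ ≤ 1 := by
  calc p⁻¹ + q⁻¹ ≤ 2⁻¹ + 2⁻¹ := add_le_add (ENNReal.inv_le_inv.2 hp) (ENNReal.inv_le_inv.2 hq)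
    _ = 1 := ENNReal.inv_two_add_inv_two

/-- The sum over the triples whose first index is the lowest. -/
theorem Admissible.exists_norm_sum_le {p : Fin 3 → ℝ≥0∞} {s t : Fin 3 → ℝ}
    (H : Admissible (Module.finrank ℝ E : ℝ) p s t) {i i' i'' : Fin 3} (h₁ : i ≠ i') (h₂ : i ≠ i'')
    (h₃ : i' ≠ i'') {a b : ℤ} (ha : 0 ≤ a ∧ a ≤ 1) (hb : 0 ≤ b ∧ b ≤ 1) :
    ∃ C : ℝ, 0 ≤ C ∧ ∀ f g h : ℤ → E → ℂ, DyadicFamily (p i) f → DyadicFamily (p i') g →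
      DyadicFamily (p i'') h →
      (∀ j k l, Integrable (fun x => f j x * g k x * h l x) volume) ∧ ∀ J : Finset ℤ,
      ‖∑ k ∈ J, ∑ l ∈ J, ∑ j ∈ J with j ≤ min (k - a) (l - b), ∫ x, f j x * g k x * h l x‖ ≤
        C * (besovSum (s i) (t i) (p i) J f * besovSum (s i') (t i') (p i') J g *
          besovSum (s i'') (t i'') (p i'') J h) := by
  set n : ℝ := (Module.finrank ℝ E : ℝ) with hn
  have hn0 : 0 ≤ n := Nat.cast_nonneg _
  have hsum := sum_of_pairwise_ne h₁ h₂ h₃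
  have hb' := hsum fun a => (p a)⁻¹.toReal
  have hle := inv_add_inv_le_one (H.two_le i') (H.two_le i'')
  -- The Hölder exponent left for the lowest factor; the bound p i ≤ r is equivalent to the three
  -- reciprocals summing to at least 1.
  set r : ℝ≥0∞ := (1 - ((p i')⁻¹ + (p i'')⁻¹))⁻¹ with hr
  have hr1 : r⁻¹ + (p i')⁻¹ + (p i'')⁻¹ = 1 := by
    rw [hr, inv_inv, add_assoc, tsub_add_cancel_of_le hle]
  have hrR : r⁻¹.toReal = 1 - ((p i')⁻¹.toReal + (p i'')⁻¹.toReal) := by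
    rw [hr, inv_inv, ENNReal.toReal_sub_of_le hle ENNReal.one_ne_top,
      ENNReal.toReal_add (inv_ne_top_of_two_le (H.two_le i')) (inv_ne_top_of_two_le (H.two_le i''))]
    simp
  have hpr : p i ≤ r := by
    rw [← ENNReal.inv_le_inv, ← ENNReal.toReal_le_toReal (by simp [hr])
      (inv_ne_top_of_two_le (H.two_le i)), hrR]
    linarith [H.one_le]
  have hA : n * ((p 0)⁻¹.toReal + (p 1)⁻¹.toReal + (p 2)⁻¹.toReal - 1) =
      n * ((p i)⁻¹.toReal - r⁻¹.toReal) := by rw [hrR, ← hb']; ring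
  -- Two reciprocals, each at most 1/2, can add up to 1 only if both exponents equal 2.
  have htop : r = ⊤ → p i' = 2 ∧ p i'' = 2 ∧ r⁻¹.toReal = 0 := by
    intro h
    have h0 : r⁻¹.toReal = 0 := by rw [h]; simp
    have e1 := toReal_inv_le_half (H.two_le i')
    have e2 := toReal_inv_le_half (H.two_le i'')
    have key : ∀ q : ℝ≥0∞, 2 ≤ q → q⁻¹.toReal = 1 / 2 → q = 2 := fun q hq hq' => by
      rw [← inv_inj, ← ENNReal.toReal_eq_toReal_iff' (inv_ne_top_of_two_le hq) (by simp), hq']; simp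
    exact ⟨key _ (H.two_le i') (by linarith), key _ (H.two_le i'') (by linarith), h0⟩
  have hs := H.low_le i
  have hss := H.low_sum_le
  have hts := H.le_high_sum
  rw [hA] at hs hss hts
  have e1 := hsum s
  have e2 := hsum t
  have ht0 : 0 ≤ t i' + t i'' := by linarith [H.high_le i]
  have hs' : r = ⊤ → s i < n * ((p i)⁻¹.toReal - r⁻¹.toReal) := fun h => by
    rw [(htop h).2.2, sub_zero]; exact H.low_lt i
  -- If t i' + t i'' = 0, the lower bound on the sum of the t's gives d/p ≤ t i, and equality is
  -- precisely the excluded endpoint.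
  have ht' : r = ⊤ → 0 < t i' + t i'' ∨ n * ((p i)⁻¹.toReal - r⁻¹.toReal) < t i := fun h => by
    obtain ⟨q1, q2, q3⟩ := htop h
    by_contra! hcon
    have h0 : t i' + t i'' = 0 := le_antisymm hcon.1 ht0
    refine H.not_endpoint i i' i'' h₁ h₂ h₃ q1 q2 h0 ?_
    rw [q3, sub_zero] at hts hcon
    linarith
  choose C hC hpara using fun y : ℤ × ℤ => exists_sum_norm_integral_lowpass_le (E := E)
    (s₂ := s i') (s₃ := s i'') (t₁ := t i) (H.two_le i) hpr hr1 rfl hs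
    (by linarith) (by linarith) ht0 hs' ht' y.1 y.2
  obtain ⟨B, hB, hBern⟩ := exists_lpNorm_le_of_localized (E := E) (p i) r
    (le_trans (by norm_num) (H.two_le i)) hpr
  refine ⟨∑ y ∈ Finset.Icc (0 : ℤ) 6 ×ˢ Finset.Icc (0 : ℤ) 6, C y,
    Finset.sum_nonneg fun y _ => hC y, fun f g h hf hg hh => ?_⟩
  have hfr : ∀ j, MemLp (f j) r volume := fun j => (hBern j _ (hf.memLp j) (hf.localized j)).1
  have hint : ∀ j k l, Integrable (fun x => f j x * g k x * h l x) volume := fun j k l =>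
    (norm_integral_mul_mul_le hr1 (hfr j) (hg.memLp k) (hh.memLp l)).1
  refine ⟨hint, fun J => ?_⟩
  set Q : ℤ → ℤ → ℤ → ℝ := fun i k l =>
    ‖∫ x, (∑ j ∈ J with j ≤ i, f j) x * g k x * h l x‖ with hQ
  have hinner : ∀ i k l, ∑ j ∈ J with j ≤ i, ∫ x, f j x * g k x * h l x =
      ∫ x, (∑ j ∈ J with j ≤ i, f j) x * g k x * h l x := fun i k l => by
    rw [← integral_finsetSum _ fun j _ => hint j k l]
    simp only [Finset.sum_apply, Finset.sum_mul]
  -- When k and l differ by at least 6, the larger one also dominates j, which lies below both.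
  have hzero : ∀ k l, ¬ |k - l| ≤ 5 →
      ∑ j ∈ J with j ≤ min (k - a) (l - b), ∫ x, f j x * g k x * h l x = 0 := fun k l hkl => by
    refine Finset.sum_eq_zero fun j hj => ?_
    have hj' := (Finset.mem_filter.1 hj).2
    refine integral_mul_mul_eq_zero_of_localized hr1 (hfr j) (hg.memLp k) (hh.memLp l)
      (hf.localized j) (hg.localized k) (hh.localized l) ?_
    rw [abs_le] at hkl
    omega
  calc _ ≤ ∑ x ∈ J ×ˢ J with |x.1 - x.2| ≤ 5, Q (min (x.1 - a) (x.2 - b)) x.1 x.2 := by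
        rw [← Finset.sum_product', ← Finset.sum_filter_of_ne
          (p := fun x : ℤ × ℤ => |x.1 - x.2| ≤ 5) fun x _ hx => by
            by_contra hx'; exact hx (hzero x.1 x.2 hx')]
        refine (norm_sum_le _ _).trans (Finset.sum_le_sum fun x _ => ?_)
        rw [hinner]
    _ ≤ _ := sum_near_diagonal_le Q (fun _ _ _ => norm_nonneg _) J ha hb
    _ ≤ _ := by
        rw [Finset.sum_mul]
        refine Finset.sum_le_sum fun y _ => ?_
        refine hpara y f g h hf hg hh J _ fun k hk => ?_
        obtain ⟨hk1, hk2⟩ := Finset.mem_filter.1 hk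
        obtain ⟨k', hk', rfl⟩ := Finset.mem_image.1 hk1
        exact ⟨by simpa using hk', hk2⟩

/-- The trilinear estimate for finite sums of localized functions. -/
theorem Admissible.exists_norm_integral_sum_le {p : Fin 3 → ℝ≥0∞} {s t : Fin 3 → ℝ}
    (H : Admissible (Module.finrank ℝ E : ℝ) p s t) :
    ∃ C : ℝ, 0 ≤ C ∧ ∀ f : Fin 3 → ℤ → E → ℂ, (∀ a, DyadicFamily (p a) (f a)) →
      ∀ J : Finset ℤ,
      Integrable (fun x => (∑ j ∈ J, f 0 j x) * (∑ j ∈ J, f 1 j x) * ∑ j ∈ J, f 2 j x) volume ∧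
      ‖∫ x, (∑ j ∈ J, f 0 j x) * (∑ j ∈ J, f 1 j x) * ∑ j ∈ J, f 2 j x‖ ≤
        C * ∏ a, besovSum (s a) (t a) (p a) J (f a) := by
  obtain ⟨C₀, hC₀, h₀⟩ := H.exists_norm_sum_le (E := E) (i := 0) (i' := 1) (i'' := 2) (by decide)
    (by decide) (by decide) (a := 0) (b := 0) (by decide) (by decide)
  obtain ⟨C₁, hC₁, h₁⟩ := H.exists_norm_sum_le (E := E) (i := 1) (i' := 0) (i'' := 2) (by decide)
    (by decide) (by decide) (a := 1) (b := 0) (by decide) (by decide)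
  obtain ⟨C₂, hC₂, h₂⟩ := H.exists_norm_sum_le (E := E) (i := 2) (i' := 0) (i'' := 1) (by decide)
    (by decide) (by decide) (a := 1) (b := 1) (by decide) (by decide)
  refine ⟨C₀ + C₁ + C₂, by positivity, fun f hf J => ?_⟩
  obtain ⟨hint, b₀⟩ := h₀ _ _ _ (hf 0) (hf 1) (hf 2)
  have b₁ := (h₁ _ _ _ (hf 1) (hf 0) (hf 2)).2 J
  have b₂ := (h₂ _ _ _ (hf 2) (hf 0) (hf 1)).2 J
  specialize b₀ J
  have hexp : (fun x => (∑ j ∈ J, f 0 j x) * (∑ j ∈ J, f 1 j x) * ∑ j ∈ J, f 2 j x) =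
      fun x => ∑ k ∈ J, ∑ l ∈ J, ∑ j ∈ J, f 0 j x * f 1 k x * f 2 l x := by
    ext x
    simp only [Finset.sum_mul, Finset.mul_sum]
    rw [Finset.sum_comm' (t' := J) (s' := fun _ => J) (by tauto)]
  rw [hexp]
  have hint2 : ∀ k l, Integrable (fun x => ∑ j ∈ J, f 0 j x * f 1 k x * f 2 l x) volume :=
    fun k l => integrable_finsetSum _ fun j _ => hint j k l
  have hint1 : ∀ k, Integrable (fun x => ∑ l ∈ J, ∑ j ∈ J, f 0 j x * f 1 k x * f 2 l x) volume :=
    fun k => integrable_finsetSum _ fun l _ => hint2 k l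
  refine ⟨integrable_finsetSum _ fun k _ => hint1 k, ?_⟩
  set τ : ℤ → ℤ → ℤ → ℂ := fun j k l => ∫ x, f 0 j x * f 1 k x * f 2 l x with hτ
  have e0 : ∫ x, ∑ k ∈ J, ∑ l ∈ J, ∑ j ∈ J, f 0 j x * f 1 k x * f 2 l x =
      ∑ k ∈ J, ∑ l ∈ J, ∑ j ∈ J, τ j k l := by
    rw [integral_finsetSum _ fun k _ => hint1 k]
    refine Finset.sum_congr rfl fun k _ => ?_
    rw [integral_finsetSum _ fun l _ => hint2 k l]
    refine Finset.sum_congr rfl fun l _ => ?_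
    rw [integral_finsetSum _ fun j _ => hint j k l]
  have e1 : ∀ j k l, ∫ x, f 1 k x * f 0 j x * f 2 l x = τ j k l := fun j k l => by
    simp only [hτ]; congr 1; ext x; ring
  have e2 : ∀ j k l, ∫ x, f 2 l x * f 0 j x * f 1 k x = τ j k l := fun j k l => by
    simp only [hτ]; congr 1; ext x; ring
  simp only [e1] at b₁
  simp only [e2] at b₂
  -- Ties for the lowest index are broken in the order j, k, l: each triple belongs to exactly one
  -- sum. This is the origin of the shifts 0 and 1 in the three paraproducts.
  have hsplit : ∑ k ∈ J, ∑ l ∈ J, ∑ j ∈ J, τ j k l =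
      (∑ k ∈ J, ∑ l ∈ J, ∑ j ∈ J with j ≤ min (k - 0) (l - 0), τ j k l) +
      (∑ j ∈ J, ∑ l ∈ J, ∑ k ∈ J with k ≤ min (j - 1) (l - 0), τ j k l) +
      ∑ j ∈ J, ∑ k ∈ J, ∑ l ∈ J with l ≤ min (j - 1) (k - 1), τ j k l := by
    have c1 : ∑ j ∈ J, ∑ l ∈ J, ∑ k ∈ J with k ≤ min (j - 1) (l - 0), τ j k l =
        ∑ k ∈ J, ∑ l ∈ J, ∑ j ∈ J, if k ≤ min (j - 1) (l - 0) then τ j k l else 0 := by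
      simp only [Finset.sum_filter]
      rw [Finset.sum_comm]
      rw [Finset.sum_congr rfl fun l _ => Finset.sum_comm]
      rw [Finset.sum_comm]
    have c2 : ∑ j ∈ J, ∑ k ∈ J, ∑ l ∈ J with l ≤ min (j - 1) (k - 1), τ j k l =
        ∑ k ∈ J, ∑ l ∈ J, ∑ j ∈ J, if l ≤ min (j - 1) (k - 1) then τ j k l else 0 := by
      simp only [Finset.sum_filter]
      rw [Finset.sum_comm]
      exact Finset.sum_congr rfl fun k _ => Finset.sum_comm
    rw [c1, c2]
    simp only [Finset.sum_filter, ← Finset.sum_add_distrib]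
    refine Finset.sum_congr rfl fun k _ => Finset.sum_congr rfl fun l _ =>
      Finset.sum_congr rfl fun j _ => ?_
    simp only [le_min_iff]
    split_ifs <;> first | (exfalso; omega) | simp
  rw [e0, hsplit, Fin.prod_univ_three]
  refine (norm_add₃_le).trans ?_
  have m1 : ∀ x y z : ℝ, C₁ * (x * y * z) = C₁ * (y * x * z) := fun x y z => by ring
  have m2 : ∀ x y z : ℝ, C₂ * (x * y * z) = C₂ * (y * z * x) := fun x y z => by ring
  rw [m1] at b₁
  rw [m2] at b₂
  linarith

/-- The trilinear estimate for finite sums of localized functions, over different finite sets. -/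
theorem Admissible.exists_norm_integral_sum_le' {p : Fin 3 → ℝ≥0∞} {s t : Fin 3 → ℝ}
    (H : Admissible (Module.finrank ℝ E : ℝ) p s t) :
    ∃ C : ℝ, 0 ≤ C ∧ ∀ f : Fin 3 → ℤ → E → ℂ, (∀ a, DyadicFamily (p a) (f a)) →
      ∀ J : Fin 3 → Finset ℤ,
      Integrable (fun x => (∑ j ∈ J 0, f 0 j x) * (∑ j ∈ J 1, f 1 j x) * ∑ j ∈ J 2, f 2 j x)
        volume ∧
      ‖∫ x, (∑ j ∈ J 0, f 0 j x) * (∑ j ∈ J 1, f 1 j x) * ∑ j ∈ J 2, f 2 j x‖ ≤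
        C * ∏ a, besovSum (s a) (t a) (p a) (J a) (f a) := by
  obtain ⟨C, hC, h⟩ := H.exists_norm_integral_sum_le (E := E)
  refine ⟨C, hC, fun f hf J => ?_⟩
  set U : Finset ℤ := Finset.univ.biUnion J with hU
  have hsub : ∀ a, J a ⊆ U := fun a => Finset.subset_biUnion_of_mem J (Finset.mem_univ a)
  -- Extension by zero, which keeps every piece localized, reduces to a common index set.
  set g : Fin 3 → ℤ → E → ℂ := fun a j => if j ∈ J a then f a j else 0 with hg
  have hgd : ∀ a, DyadicFamily (p a) (g a) := fun a => by
    constructor <;> intro j <;> simp only [hg] <;> split_ifs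
    · exact (hf a).memLp j
    · exact MemLp.zero
    · exact (hf a).localized j
    · exact localized_zero j
  have hsum : ∀ a x, ∑ j ∈ U, g a j x = ∑ j ∈ J a, f a j x := fun a x => by
    rw [← Finset.sum_subset (hsub a)]
    · exact Finset.sum_congr rfl fun j hj => by simp only [hg, if_pos hj]
    · intro j _ hj; simp only [hg, if_neg hj, Pi.zero_apply]
  have hbes : ∀ a, besovSum (s a) (t a) (p a) U (g a) = besovSum (s a) (t a) (p a) (J a) (f a) :=
    fun a => by
      unfold besovSum
      rw [← Finset.sum_subset (hsub a)]
      · congr 1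
        exact Finset.sum_congr rfl fun j hj => by simp only [hg, if_pos hj]
      · intro j _ hj; simp [hg, if_neg hj]
  have := h g hgd U
  simpa only [hsum, hbes] using this

end

/-! ### Approximate identities and blocks of Schwartz functions -/

section

variable {E : Type*} [NormedAddCommGroup E] [InnerProductSpace ℝ E] [FiniteDimensional ℝ E]
  [MeasurableSpace E] [BorelSpace E]

theorem exists_norm_sub_le (ψ : 𝓢(E, ℂ)) :
    ∃ C : ℝ, 0 ≤ C ∧ ∀ x y : E, ‖ψ (x - y) - ψ x‖ ≤ C * ‖y‖ := by
  set D := SchwartzMap.fderivCLM ℝ E ℂ ψ with hD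
  obtain ⟨C, hC⟩ := D.decay 0 0
  simp only [pow_zero, norm_iteratedFDeriv_zero, one_mul] at hC
  refine ⟨C, hC.1.le, fun x y => ?_⟩
  have := Convex.norm_image_sub_le_of_norm_fderiv_le (𝕜 := ℝ) (f := ψ) (s := Set.univ) (C := C)
    (fun z _ => ψ.differentiable z) (fun z _ => hC.2 z) convex_univ (Set.mem_univ x)
    (Set.mem_univ (x - y))
  simpa using this

/-- A dilated kernel acts on Schwartz functions as an approximate multiple of the identity. -/
theorem exists_eLpNorm_conv_dil_sub_le (K ψ : 𝓢(E, ℂ)) {q : ℝ≥0∞} (hq : 1 ≤ q) :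
    ∃ C : ℝ≥0, ∀ j : ℤ, eLpNorm (fun x => conv (dil j K) ψ x - (∫ y, K y) * ψ x) q volume ≤
      C * ENNReal.ofReal ((2 : ℝ) ^ (-j)) := by
  obtain ⟨C₁, hC₁, h₁⟩ := exists_integral_norm_sub_translate_le ψ
  obtain ⟨C₂, hC₂, h₂⟩ := exists_norm_sub_le ψ
  set B : ℝ := (C₁ + C₂) * ∫ x, ‖K x‖ * ‖x‖ with hB
  have hB0 : 0 ≤ B := mul_nonneg (by positivity) (integral_nonneg fun x => by positivity)
  refine ⟨B.toNNReal, fun j => ?_⟩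
  set b : ℝ := B * (2 : ℝ) ^ (-j) with hb
  have hb0 : 0 ≤ b := by positivity
  rw [ENNReal.ofNNReal_toNNReal, ← ENNReal.ofReal_mul hB0, ← hb]
  set G : E → ℂ := fun x => conv (dil j K) ψ x - (∫ y, K y) * ψ x with hG
  -- Subtracting the mean turns the convolution into an average of increments of ψ. The L¹ and L^∞
  -- bounds then both follow from the first moment of the kernel, of size 2^{-j}, and L^q follows by
  -- interpolation.
  have hGrep : ∀ x, G x = ∫ y, dil j K y * (ψ (x - y) - ψ x) := fun x => by
    have e1 : conv (dil j K) ψ x = ∫ y, dil j K y * ψ (x - y) := by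
      rw [conv, ← integral_sub_left_eq_self (fun y => dil j K y * ψ (x - y)) volume x]
      simp only [sub_sub_cancel]
    have hi := integrable_kernel_mul (dil j K) le_rfl (ψ.memLp 1 volume) x
    have hi' : Integrable (fun y => dil j K y * ψ (x - y)) volume := by
      have := hi.comp_sub_left x
      simpa only [sub_sub_cancel] using this
    rw [hG]
    simp only
    rw [e1, ← integral_dil j K, ← integral_mul_const, ← integral_sub hi'
      ((dil j K).integrable.mul_const _)]
    simp only [mul_sub]
  have hKint : Integrable (fun y => ‖dil j K y‖ * ‖y‖) volume := by
    have := (dil j K).integrable_pow_mul (volume : Measure E) 1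
    simpa [mul_comm] using this
  have hmom : ∀ C : ℝ, 0 ≤ C → C ≤ C₁ + C₂ → ∫ y, ‖dil j K y‖ * (C * ‖y‖) ≤ b := fun C hC hle => by
    have : ∫ y, ‖dil j K y‖ * (C * ‖y‖) = C * ∫ y, ‖dil j K y‖ * ‖y‖ := by
      rw [← integral_const_mul]; congr 1; ext y; ring
    rw [this, integral_norm_dil_mul_norm, hb, hB, zpow_neg]
    have h0 : 0 ≤ ∫ x, ‖K x‖ * ‖x‖ := integral_nonneg fun x => by positivity
    calc C * (((2 : ℝ) ^ j)⁻¹ * ∫ x, ‖K x‖ * ‖x‖) ≤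
        (C₁ + C₂) * (((2 : ℝ) ^ j)⁻¹ * ∫ x, ‖K x‖ * ‖x‖) := by gcongr
      _ = _ := by ring
  have hGmeas : AEStronglyMeasurable G volume :=
    (aestronglyMeasurable_conv (dil j K).continuous ψ.continuous.aestronglyMeasurable).sub
      (ψ.continuous.aestronglyMeasurable.const_mul _)
  have htop : eLpNorm G ⊤ volume ≤ ENNReal.ofReal b := by
    rw [eLpNorm_exponent_top]
    refine eLpNormEssSup_le_of_ae_bound (ae_of_all _ fun x => ?_)
    rw [hGrep]
    refine (norm_integral_le_of_norm_le (g := fun y => ‖dil j K y‖ * (C₂ * ‖y‖)) ?_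
      (ae_of_all _ fun y => ?_)).trans (hmom C₂ hC₂ (by linarith))
    · refine (hKint.const_mul C₂).congr (ae_of_all _ fun y => by simp only; ring)
    · rw [norm_mul]
      gcongr
      exact h₂ x y
  have hone : eLpNorm G 1 volume ≤ ENNReal.ofReal b := by
    rw [eLpNorm_one_eq_lintegral_enorm]
    calc ∫⁻ x, ‖G x‖ₑ ≤ ∫⁻ x, ∫⁻ y, ‖dil j K y‖ₑ * ‖ψ (x - y) - ψ x‖ₑ := by
          refine lintegral_mono fun x => ?_
          rw [hGrep]
          refine (enorm_integral_le_lintegral_enorm _).trans (le_of_eq ?_)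
          simp only [enorm_mul]
      _ = ∫⁻ y, ∫⁻ x, ‖dil j K y‖ₑ * ‖ψ (x - y) - ψ x‖ₑ := by
          refine lintegral_lintegral_swap ?_
          have c1 := (dil j K).continuous
          have c2 := ψ.continuous
          have h3 : Continuous fun z : E × E => dil j K z.2 * (ψ (z.1 - z.2) - ψ z.1) := by fun_prop
          refine h3.enorm.aemeasurable.congr (ae_of_all _ fun z => ?_)
          simp only [Function.uncurry, enorm_mul]
      _ ≤ ∫⁻ y, ENNReal.ofReal (‖dil j K y‖ * (C₁ * ‖y‖)) := by
          refine lintegral_mono fun y => ?_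
          rw [lintegral_const_mul' _ _ enorm_ne_top, ENNReal.ofReal_mul (norm_nonneg _), ofReal_norm]
          gcongr
          refine le_trans (le_of_eq ?_) (ENNReal.ofReal_le_ofReal (h₁ y))
          rw [ofReal_integral_eq_lintegral_ofReal ?_ (ae_of_all _ fun x => norm_nonneg _)]
          · refine lintegral_congr fun x => ?_
            rw [ofReal_norm, ← enorm_neg, neg_sub]
          · exact (ψ.integrable.sub (ψ.integrable.comp_sub_right y)).norm
      _ = ENNReal.ofReal (∫ y, ‖dil j K y‖ * (C₁ * ‖y‖)) := by
          rw [ofReal_integral_eq_lintegral_ofReal ?_ (ae_of_all _ fun y => by positivity)]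
          exact (hKint.const_mul C₁).congr (ae_of_all _ fun y => by simp only; ring)
      _ ≤ _ := ENNReal.ofReal_le_ofReal (hmom C₁ hC₁ (by linarith))
  refine (eLpNorm_le_interpolate hGmeas le_rfl hq).trans ?_
  have hq1 : q⁻¹.toReal ≤ 1 := by
    have := ENNReal.toReal_mono ENNReal.one_ne_top (ENNReal.inv_le_one.2 hq)
    simpa using this
  rw [ENNReal.toReal_one, one_mul]
  calc _ ≤ ENNReal.ofReal b ^ q⁻¹.toReal * ENNReal.ofReal b ^ (1 - q⁻¹.toReal) := by
        refine mul_le_mul' (ENNReal.rpow_le_rpow hone ENNReal.toReal_nonneg)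
          (ENNReal.rpow_le_rpow htop (by linarith))
    _ = _ := by
        rw [← ENNReal.rpow_add_of_nonneg _ _ ENNReal.toReal_nonneg (by linarith)]
        simp

theorem toReal_inv_lt_one {q : ℝ≥0∞} (hq : 1 < q) : q⁻¹.toReal < 1 := by
  have := (ENNReal.toReal_lt_toReal (by simp; exact (zero_lt_one.trans hq).ne') ENNReal.one_ne_top).2
    (ENNReal.inv_lt_one.2 hq)
  simpa using this

/-- The low frequency part of a Schwartz function is small in `L^q`. -/
theorem exists_eLpNorm_conv_dil_schwartz_le (K ψ : 𝓢(E, ℂ)) {q : ℝ≥0∞} (hq : 1 ≤ q) :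
    ∃ C : ℝ≥0, ∀ j : ℤ, eLpNorm (conv (dil j K) ψ) q volume ≤
      C * ENNReal.ofReal ((2 : ℝ) ^ ((j : ℝ) * (Module.finrank ℝ E * (1 - q⁻¹.toReal)))) := by
  obtain ⟨C, hC⟩ := exists_eLpNorm_conv_dil_le K 1 q le_rfl hq
  refine ⟨C * (eLpNorm ψ 1 volume).toNNReal, fun j => ?_⟩
  refine (hC j ψ ψ.continuous.aestronglyMeasurable).trans (le_of_eq ?_)
  rw [ENNReal.coe_mul, ENNReal.coe_toNNReal (ψ.memLp 1 volume).2.ne]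
  simp only [inv_one, ENNReal.toReal_one]
  ring

theorem tendsto_ofReal_two_rpow {a : ℝ} (ha : 0 < a) {u : ℕ → ℝ} (hu : Tendsto u atTop atBot)
    (C : ℝ≥0) : Tendsto (fun N => (C : ℝ≥0∞) * ENNReal.ofReal ((2 : ℝ) ^ (u N * a))) atTop (𝓝 0) := by
  have h1 : Tendsto (fun N => (2 : ℝ) ^ (u N * a)) atTop (𝓝 0) :=
    (tendsto_rpow_atBot_of_base_gt_one 2 one_lt_two).comp (hu.atBot_mul_const ha)
  have h2 := ENNReal.tendsto_ofReal h1
  rw [ENNReal.ofReal_zero] at h2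
  simpa using ENNReal.Tendsto.const_mul h2 (Or.inr (ENNReal.coe_ne_top (r := C)))

/-- Uniformly bounded additive operators which tend to zero on Schwartz functions tend to zero on
L^r, by density for r < ∞. -/
theorem tendsto_of_dense {r : ℝ≥0∞} (hr : 1 ≤ r) (hr' : r ≠ ⊤) {T : ℕ → (E → ℂ) → E → ℂ} {M : ℝ≥0}
    (hT : ∀ N F G, MemLp F r volume → MemLp G r volume → T N (F + G) =ᵐ[volume] T N F + T N G)
    (hM : ∀ N F, MemLp F r volume →
      AEStronglyMeasurable (T N F) volume ∧ eLpNorm (T N F) r volume ≤ M * eLpNorm F r volume)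
    (hψ : ∀ ψ : 𝓢(E, ℂ), Tendsto (fun N => eLpNorm (T N ψ) r volume) atTop (𝓝 0)) {F : E → ℂ}
    (hF : MemLp F r volume) : Tendsto (fun N => eLpNorm (T N F) r volume) atTop (𝓝 0) := by
  rw [ENNReal.tendsto_nhds_zero]
  intro ε hε
  obtain ⟨δ, hδ0, hδ⟩ : ∃ δ : ℝ, 0 < δ ∧ M * ENNReal.ofReal δ ≤ ε / 2 := by
    have h0 : Tendsto (fun δ : ℝ => (M : ℝ≥0∞) * ENNReal.ofReal δ) (𝓝[>] 0) (𝓝 0) := by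
      have h1 : Tendsto (fun δ : ℝ => ENNReal.ofReal δ) (𝓝[>] 0) (𝓝 0) := by
        have := (ENNReal.continuous_ofReal.tendsto 0).mono_left (nhdsWithin_le_nhds (s := Set.Ioi 0))
        simpa using this
      simpa using ENNReal.Tendsto.const_mul h1 (Or.inr (ENNReal.coe_ne_top (r := M)))
    have h2 := (ENNReal.tendsto_nhds_zero.1 h0) (ε / 2) (ENNReal.half_pos hε.ne')
    obtain ⟨δ, h3, h4⟩ := (h2.and self_mem_nhdsWithin).exists
    exact ⟨δ, h4, h3⟩
  obtain ⟨g, hg₁, hg₂, hg₃⟩ := MemLp.exist_eLpNorm_sub_le hr' hr hF hδ0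
  set ψ := hg₁.toSchwartzMap hg₂ with hψdef
  have hψg : ⇑ψ = g := rfl
  rw [← hψg] at hg₃
  have hFψ : MemLp (F - ⇑ψ) r volume := hF.sub (ψ.memLp r volume)
  filter_upwards [(ENNReal.tendsto_nhds_zero.1 (hψ ψ)) (ε / 2) (ENNReal.half_pos hε.ne')] with N hN
  have e1 : T N F =ᵐ[volume] T N (F - ⇑ψ) + T N ψ := by
    have := hT N (F - ⇑ψ) ψ hFψ (ψ.memLp r volume)
    rwa [sub_add_cancel] at this
  rw [eLpNorm_congr_ae e1]
  refine (eLpNorm_add_le (hM N _ hFψ).1 (hM N _ (ψ.memLp r volume)).1 hr).trans ?_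
  rw [← ENNReal.add_halves ε]
  refine add_le_add (((hM N _ hFψ).2.trans ?_).trans hδ) hN
  gcongr

theorem conv_add (K : 𝓢(E, ℂ)) {F G : E → ℂ} {p : ℝ≥0∞} (hp : 1 ≤ p) (hF : MemLp F p volume)
    (hG : MemLp G p volume) : conv K (F + G) = conv K F + conv K G := by
  ext x
  simp only [conv, Pi.add_apply, mul_add]
  exact integral_add (integrable_kernel_mul K hp hF x) (integrable_kernel_mul K hp hG x)

variable [Nontrivial E]

/-- Approximate identities converge in `L^r`. -/
theorem tendsto_eLpNorm_conv_dil_sub (K : 𝓢(E, ℂ)) (hK : ∫ y, K y = 1) {r : ℝ≥0∞} (hr : 1 ≤ r)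
    (hr' : r ≠ ⊤) {F : E → ℂ} (hF : MemLp F r volume) :
    Tendsto (fun N : ℕ => eLpNorm (conv (dil N K) F - F) r volume) atTop (𝓝 0) := by
  refine tendsto_of_dense (T := fun N F => conv (dil N K) F - F)
    (M := (eLpNorm K 1 volume).toNNReal + 1) hr hr' (fun N F G hF hG => ?_) (fun N F hF => ?_)
    (fun ψ => ?_) hF
  · rw [conv_add _ hr hF hG]
    exact ae_of_all _ fun x => by simp only [Pi.sub_apply, Pi.add_apply]; ring
  · have hm := aestronglyMeasurable_conv (dil (N : ℤ) K).continuous hF.1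
    refine ⟨hm.sub hF.1, (eLpNorm_sub_le hm hF.1 hr).trans ?_⟩
    rw [ENNReal.coe_add, ENNReal.coe_toNNReal (K.memLp 1 volume).2.ne, add_mul, ENNReal.coe_one,
      one_mul]
    gcongr
    rw [← eLpNorm_one_dil (N : ℤ) K]
    exact eLpNorm_conv_le (dil (N : ℤ) K).continuous hF.1 hr
  · obtain ⟨C, hC⟩ := exists_eLpNorm_conv_dil_sub_le K ψ hr
    rw [hK] at hC
    have h1 := tendsto_ofReal_two_rpow one_pos (u := fun N : ℕ => -(N : ℝ))
      (tendsto_neg_atTop_atBot.comp tendsto_natCast_atTop_atTop) C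
    refine tendsto_of_tendsto_of_tendsto_of_le_of_le tendsto_const_nhds h1 (fun _ => zero_le)
      fun N => ?_
    refine le_trans (le_of_eq ?_) ((hC N).trans (le_of_eq ?_))
    · congr 1; ext x; simp
    · congr 2
      rw [mul_one, ← Real.rpow_intCast]; push_cast; rfl

/-- The low frequency part of an `L^r` function tends to zero. -/
theorem tendsto_eLpNorm_conv_dil_neg (K : 𝓢(E, ℂ)) {r : ℝ≥0∞} (hr : 1 < r) (hr' : r ≠ ⊤)
    {F : E → ℂ} (hF : MemLp F r volume) :
    Tendsto (fun N : ℕ => eLpNorm (conv (dil (-(N : ℤ) - 1) K) F) r volume) atTop (𝓝 0) := by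
  refine tendsto_of_dense (T := fun N F => conv (dil (-(N : ℤ) - 1) K) F)
    (M := (eLpNorm K 1 volume).toNNReal) hr.le hr' (fun N F G hF hG => ?_) (fun N F hF => ?_)
    (fun ψ => ?_) hF
  · rw [conv_add _ hr.le hF hG]
  · refine ⟨aestronglyMeasurable_conv (dil (-(N : ℤ) - 1) K).continuous hF.1, ?_⟩
    rw [ENNReal.coe_toNNReal (K.memLp 1 volume).2.ne, ← eLpNorm_one_dil (-(N : ℤ) - 1) K]
    exact eLpNorm_conv_le (dil (-(N : ℤ) - 1) K).continuous hF.1 hr.le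
  · obtain ⟨C, hC⟩ := exists_eLpNorm_conv_dil_schwartz_le K ψ hr.le
    have hd : (0 : ℝ) < Module.finrank ℝ E := by exact_mod_cast Module.finrank_pos
    have h1 := tendsto_ofReal_two_rpow (mul_pos hd (sub_pos.2 (toReal_inv_lt_one hr)))
      (u := fun N : ℕ => -(N : ℝ) - 1)
      ((tendsto_neg_atTop_atBot.comp tendsto_natCast_atTop_atTop).atBot_add tendsto_const_nhds) C
    refine tendsto_of_tendsto_of_tendsto_of_le_of_le tendsto_const_nhds h1 (fun _ => zero_le)
      fun N => ?_
    refine (hC _).trans (le_of_eq ?_)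
    push_cast; rfl

/-- The Littlewood-Paley blocks of a Schwartz function are summable in `L^q`. -/
theorem tsum_eLpNorm_conv_dil_lt_top (K ψ : 𝓢(E, ℂ)) (hK : ∫ y, K y = 0) {q : ℝ≥0∞} (hq : 1 < q) :
    ∑' j : ℤ, eLpNorm (conv (dil j K) ψ) q volume < ⊤ := by
  obtain ⟨C₁, h₁⟩ := exists_eLpNorm_conv_dil_schwartz_le K ψ hq.le
  obtain ⟨C₂, h₂⟩ := exists_eLpNorm_conv_dil_sub_le K ψ hq.le
  simp only [hK, zero_mul, sub_zero] at h₂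
  have hd : (0 : ℝ) < Module.finrank ℝ E := by exact_mod_cast Module.finrank_pos
  set κ : ℝ := Module.finrank ℝ E * (1 - q⁻¹.toReal) with hκ
  have hκ0 : 0 < κ := mul_pos hd (sub_pos.2 (toReal_inv_lt_one hq))
  have geo : ∀ a : ℝ, 0 < a → Summable fun n : ℕ => (2 : ℝ) ^ (-(n : ℝ) * a) := fun a ha => by
    have : ∀ n : ℕ, (2 : ℝ) ^ (-(n : ℝ) * a) = ((2 : ℝ) ^ (-a)) ^ n := fun n => by
      rw [← Real.rpow_natCast, ← Real.rpow_mul (by norm_num)]; ring_nf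
    simp_rw [this]
    exact summable_geometric_of_lt_one (by positivity)
      (Real.rpow_lt_one_of_one_lt_of_neg one_lt_two (by linarith))
  -- For j ≥ 0 the vanishing mean of the kernel gives decay 2^{-j}; for j < 0 Bernstein from L¹
  -- gives 2^{jκ}, where κ > 0 because q > 1.
  set b : ℤ → ℝ := fun j => if 0 ≤ j then C₂ * (2 : ℝ) ^ (-j) else C₁ * (2 : ℝ) ^ ((j : ℝ) * κ)
    with hb
  have hb0 : ∀ j, 0 ≤ b j := fun j => by simp only [hb]; split_ifs <;> positivity
  have hsum : Summable b := by
    refine Summable.of_nat_of_neg_add_one ?_ ?_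
    · refine ((geo 1 one_pos).mul_left (C₂ : ℝ)).congr fun n => ?_
      simp only [hb]
      rw [if_pos (by positivity), ← Real.rpow_intCast]
      push_cast; rw [mul_one]
    · refine ((geo κ hκ0).mul_left ((C₁ : ℝ) * (2 : ℝ) ^ (-κ))).congr fun n => ?_
      simp only [hb]
      rw [if_neg (by omega), mul_assoc, ← Real.rpow_add (by norm_num)]
      push_cast; ring_nf
  have hle : ∀ j, eLpNorm (conv (dil j K) ψ) q volume ≤ ENNReal.ofReal (b j) := fun j => by
    simp only [hb]
    split_ifs with hj
    · rw [ENNReal.ofReal_mul C₂.coe_nonneg, ENNReal.ofReal_coe_nnreal]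
      exact h₂ j
    · rw [ENNReal.ofReal_mul C₁.coe_nonneg, ENNReal.ofReal_coe_nnreal]
      exact h₁ j
  refine (ENNReal.tsum_le_tsum hle).trans_lt ?_
  rw [← ENNReal.ofReal_tsum_of_nonneg hb0 hsum]
  exact ENNReal.ofReal_lt_top

end

/-! ### Norming functionals in L^q -/

section

variable {E : Type*} [NormedAddCommGroup E] [InnerProductSpace ℝ E] [FiniteDimensional ℝ E]
  [MeasurableSpace E] [BorelSpace E]

/-- Norming functionals in `L^q`, `1 < q < ∞`. -/
theorem exists_dual {V : E → ℂ} {q q' : ℝ≥0∞} [hqq : q.HolderConjugate q'] (hq : 1 < q)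
    (hq' : q ≠ ⊤) (hV : MemLp V q volume) :
    ∃ D : E → ℂ, MemLp D q' volume ∧ lpNorm D q' volume ≤ 1 ∧
      ∫ x, V x * D x = (lpNorm V q volume : ℂ) := by
  set ρ := q.toReal with hρ
  have hρ1 : 1 < ρ := by
    rw [hρ, ← ENNReal.toReal_one]; exact (ENNReal.toReal_lt_toReal ENNReal.one_ne_top hq').2 hq
  have hq0 : q ≠ 0 := (zero_lt_one.trans hq).ne'
  set N := lpNorm V q volume with hN
  have hN0 : 0 ≤ N := lpNorm_nonneg
  rcases hN0.eq_or_lt with h0 | hpos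
  · refine ⟨0, MemLp.zero, by simp, ?_⟩
    rw [← h0]; simp
  have hqmul : q' * ENNReal.ofReal (ρ - 1) = q := by
    have h2 : q = ENNReal.ofReal ρ := (ENNReal.ofReal_toReal hq').symm
    have h3 := hqq.inv_add_inv_eq_inv
    have h4 : q'⁻¹ = 1 - q⁻¹ := by
      rw [inv_one] at h3
      rw [← h3, ENNReal.add_sub_cancel_left (ENNReal.inv_ne_top.2 hq0)]
    have h5 : q'⁻¹ = ENNReal.ofReal ((ρ - 1) / ρ) := by
      rw [h4, h2, ← ENNReal.ofReal_inv_of_pos (by linarith), ← ENNReal.ofReal_one,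
        ← ENNReal.ofReal_sub _ (by positivity)]
      congr 1; field_simp
    have h6 : q' = ENNReal.ofReal (ρ / (ρ - 1)) := by
      rw [← inv_inv q', h5, ← ENNReal.ofReal_inv_of_pos (div_pos (by linarith) (by linarith)),
        inv_div]
    rw [h6, ← ENNReal.ofReal_mul (div_nonneg (by linarith) (by linarith)),
      div_mul_cancel₀ _ (by linarith), ← h2]
  have hnorm : ∀ z : ℂ, ‖dualityMap ρ z‖ = ‖z‖ ^ (ρ - 1) := fun z => by
    rw [dualityMap, norm_mul, Complex.norm_real, Real.norm_of_nonneg (by positivity),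
      RCLike.norm_conj, ← Real.rpow_add_one' (norm_nonneg z) (by linarith)]
    ring_nf
  -- For q < 2 the modulus carries a negative power, so measurability is checked directly rather
  -- than through continuity of the duality map.
  have hmeas : AEStronglyMeasurable (fun x => dualityMap ρ (V x)) volume := by
    unfold dualityMap
    refine AEStronglyMeasurable.mul ?_ (Complex.continuous_conj.comp_aestronglyMeasurable hV.1)
    exact Complex.continuous_ofReal.comp_aestronglyMeasurable
      (hV.1.norm.aemeasurable.pow_const _).aestronglyMeasurable
  have hnormD : eLpNorm (fun x => dualityMap ρ (V x)) q' volume =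
      eLpNorm V q volume ^ (ρ - 1) := by
    rw [← hqmul, ← eLpNorm_norm_rpow V (by linarith)]
    refine eLpNorm_congr_norm_ae (ae_of_all _ fun x => ?_)
    rw [hnorm, Real.norm_of_nonneg (by positivity)]
  have hmem : MemLp (fun x => dualityMap ρ (V x)) q' volume := by
    refine ⟨hmeas, ?_⟩
    rw [hnormD]
    exact ENNReal.rpow_lt_top_of_nonneg (by linarith) hV.2.ne
  have hlp : lpNorm (fun x => dualityMap ρ (V x)) q' volume = N ^ (ρ - 1) := by
    rw [← toReal_eLpNorm hmeas, hnormD, ← ENNReal.toReal_rpow, toReal_eLpNorm hV.1]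
  -- Dividing |V|^{ρ-2} conj(V), whose dual norm is N^{ρ-1}, by that norm.
  refine ⟨fun x => ((N ^ (1 - ρ) : ℝ) : ℂ) * dualityMap ρ (V x), hmem.const_mul _, ?_, ?_⟩
  · have := lpNorm_const_smul ((N ^ (1 - ρ) : ℝ) : ℂ) (fun x => dualityMap ρ (V x)) (p := q')
      (μ := (volume : Measure E))
    simp only [Pi.smul_def, smul_eq_mul] at this
    rw [this, hlp, coe_nnnorm, Complex.norm_real, Real.norm_of_nonneg (by positivity),
      ← Real.rpow_add hpos]
    simp
  · have h1 : ∀ x, V x * (((N ^ (1 - ρ) : ℝ) : ℂ) * dualityMap ρ (V x)) =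
        ((N ^ (1 - ρ) * ‖V x‖ ^ ρ : ℝ) : ℂ) := fun x => by
      have h2 : ‖V x‖ ^ ρ = ‖V x‖ ^ (ρ - 2) * ‖V x‖ ^ 2 := by
        rcases (norm_nonneg (V x)).eq_or_lt with h | h
        · rw [← h, Real.zero_rpow (by linarith)]; simp
        · rw [← Real.rpow_natCast, ← Real.rpow_add h]; norm_num
      have h3 : V x * starRingEnd ℂ (V x) = ((‖V x‖ ^ 2 : ℝ) : ℂ) := by
        rw [Complex.mul_conj, Complex.normSq_eq_norm_sq]
      rw [h2, dualityMap]
      push_cast at h3 ⊢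
      rw [← h3]; ring
    simp_rw [h1]
    rw [integral_complex_ofReal, integral_const_mul, ← lpNorm_rpow_eq hq0 hq' hV.1, ← hN, ← hρ,
      ← Real.rpow_add hpos]
    simp

end

end LittlewoodPaley

/-! ### Tempered distributions represented by functions, and multipliers -/

namespace HybridBesov

open LittlewoodPaley (conv dil reflect IsKernel Localized DyadicFamily besovSum logWeight annulus
  annulusKernel)

variable {d : ℕ}

local notation "𝔼" => EuclideanSpace ℝ (Fin d)

/-- Testing against smooth compactly supported functions determines a locally integrable function
almost everywhere. In particular the infimum defining `lpNorm` runs over a single class. -/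
theorem Represents.ae_eq {u : 𝓢'(𝔼, ℂ)} {F G : 𝔼 → ℂ} (hF : Represents u F)
    (hG : Represents u G) : F =ᵐ[volume] G := by
  refine ae_eq_of_integral_contDiff_smul_eq hF.1 hG.1 fun g hg hc => ?_
  have hc' : HasCompactSupport fun x => ((g x : ℝ) : ℂ) := hc.comp_left Complex.ofReal_zero
  have hg' : ContDiff ℝ ∞ fun x => ((g x : ℝ) : ℂ) := Complex.ofRealCLM.contDiff.comp hg
  have h := (hF.2 (hc'.toSchwartzMap hg')).2.symm.trans (hG.2 (hc'.toSchwartzMap hg')).2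
  simp only [Complex.real_smul]
  exact h

theorem Represents.aestronglyMeasurable {u : 𝓢'(𝔼, ℂ)} {F : 𝔼 → ℂ} (h : Represents u F) :
    AEStronglyMeasurable F volume := h.1.aestronglyMeasurable

theorem Represents.zero : Represents (0 : 𝓢'(𝔼, ℂ)) 0 :=
  ⟨locallyIntegrable_zero, fun ψ => by simp⟩

theorem Represents.add {u v : 𝓢'(𝔼, ℂ)} {F G : 𝔼 → ℂ} (hu : Represents u F)
    (hv : Represents v G) : Represents (u + v) (F + G) := by
  refine ⟨hu.1.add hv.1, fun ψ => ?_⟩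
  have h1 := hu.2 ψ
  have h2 := hv.2 ψ
  simp only [Pi.add_apply, mul_add]
  refine ⟨h1.1.add h2.1, ?_⟩
  rw [integral_add h1.1 h2.1, ← h1.2, ← h2.2]
  rfl

theorem Represents.neg {u : 𝓢'(𝔼, ℂ)} {F : 𝔼 → ℂ} (hu : Represents u F) :
    Represents (-u) (-F) := by
  refine ⟨hu.1.neg, fun ψ => ?_⟩
  have h1 := hu.2 ψ
  simp only [Pi.neg_apply, mul_neg]
  refine ⟨h1.1.neg, ?_⟩
  rw [integral_neg, ← h1.2]
  rfl

theorem Represents.sub {u v : 𝓢'(𝔼, ℂ)} {F G : 𝔼 → ℂ} (hu : Represents u F)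
    (hv : Represents v G) : Represents (u - v) (F - G) := by
  rw [sub_eq_add_neg, sub_eq_add_neg]
  exact hu.add hv.neg

theorem Represents.sum {ι : Type*} {u : ι → 𝓢'(𝔼, ℂ)} {F : ι → 𝔼 → ℂ} (J : Finset ι)
    (h : ∀ i ∈ J, Represents (u i) (F i)) : Represents (∑ i ∈ J, u i) (∑ i ∈ J, F i) := by
  classical
  induction J using Finset.induction_on with
  | empty => simpa using Represents.zero
  | insert i J hi ih =>
    rw [Finset.sum_insert hi, Finset.sum_insert hi]
    exact (h i (Finset.mem_insert_self _ _)).add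
      (ih fun k hk => h k (Finset.mem_insert_of_mem hk))

theorem integrable_schwartz_mul {F : 𝔼 → ℂ} {p : ℝ≥0∞} (hp : 1 ≤ p) (hF : MemLp F p volume)
    (ψ : 𝓢(𝔼, ℂ)) : Integrable (fun x => ψ x * F x) volume := by
  have := ENNReal.HolderConjugate.conjExponent hp
  have h := (ψ.memLp p.conjExponent volume)
  exact memLp_one_iff_integrable.1 (hF.mul' h (r := 1))

theorem exists_represents {F : 𝔼 → ℂ} {p : ℝ≥0∞} (hp : 1 ≤ p) (hF : MemLp F p volume) :
    ∃ u : 𝓢'(𝔼, ℂ), Represents u F := by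
  have : Fact (1 ≤ p) := ⟨hp⟩
  refine ⟨Lp.toTemperedDistribution hF.toLp, hF.locallyIntegrable hp, fun ψ =>
    ⟨integrable_schwartz_mul hp hF ψ, ?_⟩⟩
  rw [Lp.toTemperedDistribution_apply]
  refine integral_congr_ae ?_
  filter_upwards [hF.coeFn_toLp] with x hx
  rw [hx, smul_eq_mul]

theorem lpNorm_eq {u : 𝓢'(𝔼, ℂ)} {F : 𝔼 → ℂ} (h : Represents u F) (p : ℝ≥0∞) :
    lpNorm p u = eLpNorm F p volume :=
  le_antisymm (iInf₂_le F h) (le_iInf₂ fun _ hG => (eLpNorm_congr_ae (h.ae_eq hG)).le)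

theorem exists_represents_of_lpNorm_lt_top {u : 𝓢'(𝔼, ℂ)} {p : ℝ≥0∞} (h : lpNorm p u < ⊤) :
    ∃ F, Represents u F ∧ MemLp F p volume := by
  simp only [lpNorm, iInf_lt_iff] at h
  obtain ⟨F, hF, hlt⟩ := h
  exact ⟨F, hF, hF.aestronglyMeasurable, hlt⟩

theorem lpNorm_zero (p : ℝ≥0∞) : lpNorm p (0 : 𝓢'(𝔼, ℂ)) = 0 := by
  rw [lpNorm_eq Represents.zero, eLpNorm_zero]

theorem lpNorm_add_le (u v : 𝓢'(𝔼, ℂ)) {p : ℝ≥0∞} (hp : 1 ≤ p) :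
    lpNorm p (u + v) ≤ lpNorm p u + lpNorm p v := by
  by_cases hu : lpNorm p u < ⊤
  · by_cases hv : lpNorm p v < ⊤
    · obtain ⟨F, hF, hF'⟩ := exists_represents_of_lpNorm_lt_top hu
      obtain ⟨G, hG, hG'⟩ := exists_represents_of_lpNorm_lt_top hv
      rw [lpNorm_eq hF, lpNorm_eq hG, lpNorm_eq (hF.add hG)]
      exact eLpNorm_add_le hF'.1 hG'.1 hp
    · rw [not_lt_top_iff.1 hv]; simp
  · rw [not_lt_top_iff.1 hu]; simp

theorem symbol_eq {K : 𝓢(𝔼, ℂ)} {m : 𝔼 → ℝ} (hK : IsKernel K m) :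
    (fun ξ => ((m ((2 * Real.pi) • ξ) : ℝ) : ℂ)) = 𝓕 K := by
  ext ξ; rw [hK ξ]

theorem hasTemperateGrowth_symbol {K : 𝓢(𝔼, ℂ)} {m : 𝔼 → ℝ} (hK : IsKernel K m) :
    Function.HasTemperateGrowth fun ξ => ((m ((2 * Real.pi) • ξ) : ℝ) : ℂ) := by
  rw [symbol_eq hK]; exact (𝓕 K).hasTemperateGrowth

theorem multiplier_multiplier {K L : 𝓢(𝔼, ℂ)} {m n : 𝔼 → ℝ} (hK : IsKernel K m)
    (hL : IsKernel L n) (u : 𝓢'(𝔼, ℂ)) :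
    multiplier m (multiplier n u) = multiplier (fun ξ => n ξ * m ξ) u := by
  unfold multiplier
  rw [TemperedDistribution.fourierMultiplierCLM_fourierMultiplierCLM_apply
    (hasTemperateGrowth_symbol hL) (hasTemperateGrowth_symbol hK)]
  congr 2
  ext ξ
  simp

/-- By transposition, the multiplier acts on test functions as convolution with the reflected
kernel. -/
theorem multiplier_apply {K : 𝓢(𝔼, ℂ)} {m : 𝔼 → ℝ} (hK : IsKernel K m) (u : 𝓢'(𝔼, ℂ))
    (ψ : 𝓢(𝔼, ℂ)) :
    ∃ T : 𝓢(𝔼, ℂ), (∀ x, T x = conv (reflect K) ψ x) ∧ multiplier m u ψ = u T := by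
  refine ⟨_, fun x => ?_, TemperedDistribution.fourierMultiplierCLM_apply_apply _ u ψ⟩
  refine LittlewoodPaley.fourier_mul_fourierInv_apply K ψ _ (fun ξ => ?_) x
  rw [SchwartzMap.smulLeftCLM_apply_apply (hasTemperateGrowth_symbol hK), hK ξ, smul_eq_mul]

/-- Fourier multipliers with smooth symbols act by convolution. -/
theorem Represents.multiplier {K : 𝓢(𝔼, ℂ)} {m : 𝔼 → ℝ} (hK : IsKernel K m) {u : 𝓢'(𝔼, ℂ)}
    {F : 𝔼 → ℂ} {p : ℝ≥0∞} (hp : 1 ≤ p) (hu : Represents u F) (hF : MemLp F p volume) :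
    Represents (multiplier m u) (conv K F) := by
  have hc := LittlewoodPaley.memLp_conv K.continuous K.integrable hp hF
  refine ⟨hc.locallyIntegrable hp, fun ψ => ⟨integrable_schwartz_mul hp hc ψ, ?_⟩⟩
  obtain ⟨T, hT, hT'⟩ := multiplier_apply hK u ψ
  rw [hT', (hu.2 T).2]
  have := (ENNReal.HolderConjugate.conjExponent hp).symm
  have h := LittlewoodPaley.integral_conv_mul (reflect K) (ψ.memLp p.conjExponent volume) hF
  rw [LittlewoodPaley.reflect_reflect] at h
  rw [← h]
  simp only [hT]

/-- Young's inequality. The extra 1 keeps the constant positive, so that the right side is infinite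
when `lpNorm p u` is. -/
theorem lpNorm_multiplier_le {K : 𝓢(𝔼, ℂ)} {m : 𝔼 → ℝ} (hK : IsKernel K m) (u : 𝓢'(𝔼, ℂ))
    {p : ℝ≥0∞} (hp : 1 ≤ p) :
    lpNorm p (multiplier m u) ≤ (1 + eLpNorm K 1 volume) * lpNorm p u := by
  by_cases hu : lpNorm p u < ⊤
  · obtain ⟨F, hF, hF'⟩ := exists_represents_of_lpNorm_lt_top hu
    rw [lpNorm_eq (hF.multiplier hK hp hF'), lpNorm_eq hF]
    refine (LittlewoodPaley.eLpNorm_conv_le K.continuous hF'.1 hp).trans ?_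
    gcongr
    exact le_add_self
  · rw [not_lt_top_iff.1 hu, ENNReal.mul_top (by simp)]
    exact le_top

/-! ### Littlewood–Paley blocks of distributions -/

theorem IsDyadicPartition.exists_isKernel {φ : 𝔼 → ℝ} (h : IsDyadicPartition φ) :
    ∃ K : 𝓢(𝔼, ℂ), IsKernel K φ := by
  refine LittlewoodPaley.exists_isKernel h.smooth (HasCompactSupport.of_support_subset_isCompact
    (isCompact_closedBall 0 2) fun ξ hξ => ?_)
  simpa using (h.support ξ hξ).2

theorem IsLowFreqCutoff.exists_isKernel {χ : 𝔼 → ℝ} (h : IsLowFreqCutoff χ) :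
    ∃ K : 𝓢(𝔼, ℂ), IsKernel K χ := by
  refine LittlewoodPaley.exists_isKernel h.smooth (HasCompactSupport.of_support_subset_isCompact
    (isCompact_closedBall 0 2) fun ξ hξ => ?_)
  by_contra hn
  exact hξ (h.eq_zero ξ (by simpa using (not_le.1 fun h' => hn (by simpa using h')).le))

/-- The convolution kernel of the Littlewood-Paley block. -/
noncomputable def IsDyadicPartition.kernel {φ : 𝔼 → ℝ} (h : IsDyadicPartition φ) : 𝓢(𝔼, ℂ) :=
  h.exists_isKernel.choose

theorem IsDyadicPartition.isKernel {φ : 𝔼 → ℝ} (h : IsDyadicPartition φ) (j : ℤ) :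
    IsKernel (dil j h.kernel) fun ξ => φ ((2 : ℝ) ^ (-j) • ξ) :=
  h.exists_isKernel.choose_spec.dil j

theorem IsDyadicPartition.norm_bounds {φ : 𝔼 → ℝ} (h : IsDyadicPartition φ) {j : ℤ} {ξ : 𝔼}
    (hξ : φ ((2 : ℝ) ^ (-j) • ξ) ≠ 0) : (2 : ℝ) ^ (j - 1) ≤ ‖ξ‖ ∧ ‖ξ‖ ≤ (2 : ℝ) ^ (j + 1) := by
  have h1 := h.support _ hξ
  have h2 : (0 : ℝ) < 2 ^ j := by positivity
  rw [norm_smul, Real.norm_of_nonneg (by positivity), zpow_neg, inv_mul_eq_div, div_le_iff₀ h2,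
    le_div_iff₀ h2] at h1
  rw [zpow_sub₀ (by norm_num), zpow_add₀ (by norm_num), zpow_one]
  exact ⟨by linarith, by linarith⟩

theorem Represents.block {φ : 𝔼 → ℝ} (hφ : IsDyadicPartition φ) {u : 𝓢'(𝔼, ℂ)}
    {F : 𝔼 → ℂ} {p : ℝ≥0∞} (hp : 1 ≤ p) (hu : Represents u F) (hF : MemLp F p volume) (j : ℤ) :
    Represents (block φ j u) (conv (dil j hφ.kernel) F) :=
  hu.multiplier (hφ.isKernel j) hp hF

theorem block_add (φ : 𝔼 → ℝ) (j : ℤ) (u v : 𝓢'(𝔼, ℂ)) :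
    block φ j (u + v) = block φ j u + block φ j v := map_add _ _ _

theorem block_sub (φ : 𝔼 → ℝ) (j : ℤ) (u v : 𝓢'(𝔼, ℂ)) :
    block φ j (u - v) = block φ j u - block φ j v := map_sub _ _ _

/-- The wider cutoff equals 1 on the support of φ. This makes each block reproduced by one fixed
dilated kernel, which is all that `Localized` records. -/
theorem IsDyadicPartition.multiplier_annulus {φ : 𝔼 → ℝ} (h : IsDyadicPartition φ) (j : ℤ)
    (u : 𝓢'(𝔼, ℂ)) :
    multiplier (fun ξ => annulus 𝔼 ((2 : ℝ) ^ (-j) • ξ)) (block φ j u) = block φ j u := by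
  rw [block, multiplier_multiplier (LittlewoodPaley.isKernel_annulusKernel.dil j) (h.isKernel j)]
  congr 2
  ext ξ
  by_cases hξ : φ ((2 : ℝ) ^ (-j) • ξ) = 0
  · rw [hξ, zero_mul]
  · rw [LittlewoodPaley.annulus_eq_one (h.support _ hξ).1 (h.support _ hξ).2, mul_one]

theorem IsDyadicPartition.localized {φ : 𝔼 → ℝ} (h : IsDyadicPartition φ) {j : ℤ}
    {u : 𝓢'(𝔼, ℂ)} {F : 𝔼 → ℂ} {p : ℝ≥0∞} (hp : 1 ≤ p) (hF : Represents (HybridBesov.block φ j u) F)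
    (hFp : MemLp F p volume) : Localized j F := by
  have h1 := hF.multiplier (LittlewoodPaley.isKernel_annulusKernel.dil j) hp hFp
  rw [h.multiplier_annulus] at h1
  exact hF.ae_eq h1

theorem block_multiplier_comm {φ χ : 𝔼 → ℝ} (hφ : IsDyadicPartition φ) (hχ : IsLowFreqCutoff χ)
    (j : ℤ) (u : 𝓢'(𝔼, ℂ)) : block φ j (multiplier χ u) = multiplier χ (block φ j u) := by
  obtain ⟨K, hK⟩ := hχ.exists_isKernel
  rw [block, block, multiplier_multiplier (hφ.isKernel j) hK,
    multiplier_multiplier hK (hφ.isKernel j)]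
  simp only [mul_comm]

/-- The frequencies of the block have size at most 2^{j+1} ≤ 1, where χ = 1. -/
theorem multiplier_block_eq_self {φ χ : 𝔼 → ℝ} (hφ : IsDyadicPartition φ)
    (hχ : IsLowFreqCutoff χ) {j : ℤ} (hj : j ≤ -1) (u : 𝓢'(𝔼, ℂ)) :
    multiplier χ (block φ j u) = block φ j u := by
  obtain ⟨K, hK⟩ := hχ.exists_isKernel
  rw [block, multiplier_multiplier hK (hφ.isKernel j)]
  congr 2
  ext ξ
  by_cases hξ : φ ((2 : ℝ) ^ (-j) • ξ) = 0
  · rw [hξ, zero_mul]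
  · rw [hχ.eq_one, mul_one]
    refine (hφ.norm_bounds hξ).2.trans ?_
    exact zpow_le_one_of_nonpos₀ (by norm_num) (by omega)

/-- The frequencies of the block have size at least 2^{j-1} ≥ 2, where χ = 0. -/
theorem multiplier_block_eq_zero {φ χ : 𝔼 → ℝ} (hφ : IsDyadicPartition φ)
    (hχ : IsLowFreqCutoff χ) {j : ℤ} (hj : 2 ≤ j) (u : 𝓢'(𝔼, ℂ)) :
    multiplier χ (block φ j u) = 0 := by
  obtain ⟨K, hK⟩ := hχ.exists_isKernel
  rw [block, multiplier_multiplier hK (hφ.isKernel j)]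
  have : (fun ξ => φ ((2 : ℝ) ^ (-j) • ξ) * χ ξ) = fun _ => 0 := by
    ext ξ
    by_cases hξ : φ ((2 : ℝ) ^ (-j) • ξ) = 0
    · rw [hξ, zero_mul]
    · rw [hχ.eq_zero, mul_zero]
      refine le_trans ?_ (hφ.norm_bounds hξ).1
      calc (2 : ℝ) = 2 ^ (1 : ℤ) := by norm_num
        _ ≤ 2 ^ (j - 1) := zpow_le_zpow_right₀ (by norm_num) (by omega)
  rw [this]
  unfold multiplier
  simp [TemperedDistribution.fourierMultiplierCLM_const]

/-! ### Equivalence of the hybrid norm with a weighted norm of the blocks -/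

/-- The weighted `ℓ² L^p` norm of the Littlewood-Paley blocks, with a weight that changes at
frequency `1`. -/
noncomputable def blockNorm (φ : 𝔼 → ℝ) (i : Index) (u : 𝓢'(𝔼, ℂ)) : ℝ≥0∞ :=
  (∑' j : ℤ, (ENNReal.ofReal ((2 : ℝ) ^ logWeight i.low i.high j) *
    lpNorm i.exponent (block φ j u)) ^ 2) ^ (1 / 2 : ℝ)

theorem sq_rpow_half (x : ℝ≥0∞) : (x ^ (1 / 2 : ℝ)) ^ 2 = x := by
  rw [← ENNReal.rpow_natCast, ← ENNReal.rpow_mul]; norm_num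

theorem rpow_half_sq (x : ℝ≥0∞) : (x ^ 2) ^ (1 / 2 : ℝ) = x := by
  rw [← ENNReal.rpow_natCast, ← ENNReal.rpow_mul]; norm_num

theorem tsum_sq_rpow_half_le_mul {ι : Type*} {x y : ι → ℝ≥0∞} {D : ℝ≥0∞}
    (h : ∀ j, x j ≤ D * y j) :
    (∑' j, x j ^ 2) ^ (1 / 2 : ℝ) ≤ D * (∑' j, y j ^ 2) ^ (1 / 2 : ℝ) := by
  calc (∑' j, x j ^ 2) ^ (1 / 2 : ℝ) ≤ (∑' j, D ^ 2 * y j ^ 2) ^ (1 / 2 : ℝ) := by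
        refine ENNReal.rpow_le_rpow (ENNReal.tsum_le_tsum fun j => ?_) (by norm_num)
        rw [← mul_pow]
        exact pow_le_pow_left' (h j) 2
    _ = _ := by
        rw [ENNReal.tsum_mul_left, ENNReal.mul_rpow_of_nonneg _ _ (by norm_num), rpow_half_sq]

theorem tsum_sq_rpow_half_add_le {ι : Type*} (x y : ι → ℝ≥0∞) :
    (∑' j, (x j + y j) ^ 2) ^ (1 / 2 : ℝ) ≤
      2 * ((∑' j, x j ^ 2) ^ (1 / 2 : ℝ) + (∑' j, y j ^ 2) ^ (1 / 2 : ℝ)) := by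
  set X := (∑' j, x j ^ 2) ^ (1 / 2 : ℝ) with hX
  set Y := (∑' j, y j ^ 2) ^ (1 / 2 : ℝ) with hY
  have hX' : ∑' j, x j ^ 2 = X ^ 2 := (sq_rpow_half _).symm
  have hY' : ∑' j, y j ^ 2 = Y ^ 2 := (sq_rpow_half _).symm
  rw [← rpow_half_sq (2 * (X + Y))]
  refine ENNReal.rpow_le_rpow ?_ (by norm_num)
  calc ∑' j, (x j + y j) ^ 2 ≤ ∑' j, 4 * (x j ^ 2 + y j ^ 2) := by
        refine ENNReal.tsum_le_tsum fun j => ?_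
        rcases le_total (x j) (y j) with h | h
        · calc (x j + y j) ^ 2 ≤ (y j + y j) ^ 2 := by gcongr
            _ = 4 * y j ^ 2 := by ring
            _ ≤ _ := by gcongr; exact le_add_self
        · calc (x j + y j) ^ 2 ≤ (x j + x j) ^ 2 := by gcongr
            _ = 4 * x j ^ 2 := by ring
            _ ≤ _ := by gcongr; exact le_self_add
    _ = 4 * (X ^ 2 + Y ^ 2) := by
        rw [ENNReal.tsum_mul_left, ENNReal.tsum_add, hX', hY']
    _ ≤ (2 * (X + Y)) ^ 2 := by
        have : (2 * (X + Y)) ^ 2 = 4 * (X ^ 2 + Y ^ 2) + 8 * (X * Y) := by ring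
        rw [this]; exact le_self_add

theorem logWeight_le_low_add (s t : ℝ) {j : ℤ} (hj : j ≤ 1) :
    |logWeight s t j - j * s| ≤ |s| + |t| := by
  have hs := abs_nonneg s
  have ht := abs_nonneg t
  unfold logWeight
  split_ifs with h
  · simp; positivity
  · obtain rfl : j = 1 := by omega
    rw [← mul_sub, Int.cast_one, one_mul, add_comm]; exact abs_sub _ _

theorem logWeight_le_high_add (s t : ℝ) {j : ℤ} (hj : 0 ≤ j) :
    |logWeight s t j - j * t| ≤ |s| + |t| := by
  have hs := abs_nonneg s
  have ht := abs_nonneg t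
  unfold logWeight
  split_ifs with h
  · obtain rfl : j = 0 := by omega
    simp; positivity
  · simp; positivity

theorem ofReal_rpow_le_mul {x y D : ℝ} (h : x ≤ y + D) :
    ENNReal.ofReal ((2 : ℝ) ^ x) ≤ ENNReal.ofReal ((2 : ℝ) ^ D) * ENNReal.ofReal ((2 : ℝ) ^ y) := by
  rw [← ENNReal.ofReal_mul (by positivity), ← Real.rpow_add (by norm_num)]
  exact ENNReal.ofReal_le_ofReal (Real.rpow_le_rpow_of_exponent_le one_le_two (by linarith))

/-- The low part contributes only for j ≤ 1 and the high part only for j ≥ 0; in these ranges the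
hybrid weight differs from the pure one by a bounded factor. -/
theorem exists_blockNorm_le_norm {χ φ : 𝔼 → ℝ} (hχ : IsLowFreqCutoff χ)
    (hφ : IsDyadicPartition φ) (i : Index) (hi : 1 ≤ i.exponent) :
    ∃ C : ℝ≥0, ∀ u, blockNorm φ i u ≤ C * norm χ φ i u := by
  set D : ℝ≥0 := (2 : ℝ≥0) ^ (|i.low| + |i.high|) with hD
  have hD' : (D : ℝ≥0∞) = ENNReal.ofReal ((2 : ℝ) ^ (|i.low| + |i.high|)) := by
    rw [hD, ENNReal.ofReal]
    congr 1
    ext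
    rw [NNReal.coe_rpow, Real.coe_toNNReal _ (by positivity)]; rfl
  refine ⟨D * 2, fun u => ?_⟩
  have key : ∀ j : ℤ, ENNReal.ofReal ((2 : ℝ) ^ logWeight i.low i.high j) *
      lpNorm i.exponent (block φ j u) ≤ D *
      (ENNReal.ofReal ((2 : ℝ) ^ ((j : ℝ) * i.low)) *
        lpNorm i.exponent (block φ j (multiplier χ u)) +
      ENNReal.ofReal ((2 : ℝ) ^ ((j : ℝ) * i.high)) *
        lpNorm i.exponent (block φ j (u - multiplier χ u))) := by
    intro j
    have h1 : block φ j u = block φ j (multiplier χ u) + block φ j (u - multiplier χ u) := by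
      rw [← block_add, add_sub_cancel]
    rw [mul_add, ← mul_assoc, ← mul_assoc]
    refine (mul_le_mul_right ((congrArg (lpNorm i.exponent) h1).trans_le
      (lpNorm_add_le _ _ hi)) _).trans ?_
    rw [mul_add]
    refine add_le_add ?_ ?_
    · rcases le_or_gt j 1 with hj | hj
      · gcongr
        rw [hD']
        exact ofReal_rpow_le_mul (by linarith [(abs_le.1 (logWeight_le_low_add i.low i.high hj)).2])
      · rw [block_multiplier_comm hφ hχ, multiplier_block_eq_zero hφ hχ (by omega), lpNorm_zero]
        simp
    · rcases le_or_gt 0 j with hj | hj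
      · gcongr
        rw [hD']
        exact ofReal_rpow_le_mul (by linarith [(abs_le.1 (logWeight_le_high_add i.low i.high hj)).2])
      · rw [block_sub, block_multiplier_comm hφ hχ, multiplier_block_eq_self hφ hχ (by omega),
          sub_self, lpNorm_zero]
        simp
  refine (tsum_sq_rpow_half_le_mul key).trans ?_
  rw [ENNReal.coe_mul, mul_assoc]
  gcongr
  exact tsum_sq_rpow_half_add_le _ _

/-- The converse: P and Q are bounded on L^p uniformly over the blocks, and outside the overlapping
range one of the two parts of each block vanishes. -/
theorem exists_norm_le_blockNorm {χ φ : 𝔼 → ℝ} (hχ : IsLowFreqCutoff χ)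
    (hφ : IsDyadicPartition φ) (i : Index) (hi : 1 ≤ i.exponent) :
    ∃ C : ℝ≥0, ∀ u, norm χ φ i u ≤ C * blockNorm φ i u := by
  obtain ⟨K, hK⟩ := hχ.exists_isKernel
  set D : ℝ≥0 := (2 : ℝ≥0) ^ (|i.low| + |i.high|) with hD
  have hD' : (D : ℝ≥0∞) = ENNReal.ofReal ((2 : ℝ) ^ (|i.low| + |i.high|)) := by
    rw [hD, ENNReal.ofReal]
    congr 1
    ext
    rw [NNReal.coe_rpow, Real.coe_toNNReal _ (by positivity)]; rfl
  have hKtop : eLpNorm K 1 volume ≠ ⊤ := (K.memLp 1 volume).2.ne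
  set M : ℝ≥0 := (eLpNorm K 1 volume).toNNReal with hM
  have hM' : (M : ℝ≥0∞) = eLpNorm K 1 volume := ENNReal.coe_toNNReal hKtop
  refine ⟨D * (1 + M) + D * (2 + M), fun u => ?_⟩
  have hw : ∀ {x y : ℝ} {j : ℤ}, |x - y| ≤ |i.low| + |i.high| →
      ENNReal.ofReal ((2 : ℝ) ^ y) ≤ D * ENNReal.ofReal ((2 : ℝ) ^ x) := fun {x y j} h => by
    rw [hD']
    exact ofReal_rpow_le_mul (by linarith [(abs_le.1 h).1])
  have low : ∀ j : ℤ, ENNReal.ofReal ((2 : ℝ) ^ ((j : ℝ) * i.low)) *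
      lpNorm i.exponent (block φ j (multiplier χ u)) ≤ (D * (1 + M) : ℝ≥0∞) *
      (ENNReal.ofReal ((2 : ℝ) ^ logWeight i.low i.high j) * lpNorm i.exponent (block φ j u)) := by
    intro j
    rw [block_multiplier_comm hφ hχ]
    rcases le_or_gt j 1 with hj | hj
    · refine (mul_le_mul' (hw (j := j) (logWeight_le_low_add i.low i.high hj))
        (lpNorm_multiplier_le hK (block φ j u) hi)).trans (le_of_eq ?_)
      rw [hM']; ring
    · rw [multiplier_block_eq_zero hφ hχ (by omega), lpNorm_zero]
      simp
  have high : ∀ j : ℤ, ENNReal.ofReal ((2 : ℝ) ^ ((j : ℝ) * i.high)) *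
      lpNorm i.exponent (block φ j (u - multiplier χ u)) ≤ (D * (2 + M) : ℝ≥0∞) *
      (ENNReal.ofReal ((2 : ℝ) ^ logWeight i.low i.high j) * lpNorm i.exponent (block φ j u)) := by
    intro j
    rw [block_sub, block_multiplier_comm hφ hχ]
    rcases le_or_gt 0 j with hj | hj
    · have h1 : lpNorm i.exponent (block φ j u - multiplier χ (block φ j u)) ≤
          (2 + M) * lpNorm i.exponent (block φ j u) := by
        by_cases hu : lpNorm i.exponent (block φ j u) < ⊤
        · obtain ⟨F, hF, hF'⟩ := exists_represents_of_lpNorm_lt_top hu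
          rw [lpNorm_eq (hF.sub (hF.multiplier hK hi hF')), lpNorm_eq hF]
          refine (eLpNorm_sub_le hF'.1
            (LittlewoodPaley.aestronglyMeasurable_conv K.continuous hF'.1) hi).trans ?_
          calc _ ≤ eLpNorm F i.exponent volume + M * eLpNorm F i.exponent volume := by
                gcongr
                rw [hM']
                exact LittlewoodPaley.eLpNorm_conv_le K.continuous hF'.1 hi
            _ = (1 + M) * eLpNorm F i.exponent volume := by ring
            _ ≤ _ := by gcongr; norm_num
        · rw [not_lt_top_iff.1 hu, ENNReal.mul_top (by simp)]
          exact le_top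
      refine (mul_le_mul' (hw (j := j) (logWeight_le_high_add i.low i.high hj)) h1).trans
        (le_of_eq ?_)
      ring
    · rw [multiplier_block_eq_self hφ hχ (by omega), sub_self, lpNorm_zero]
      simp
  refine (add_le_add (tsum_sq_rpow_half_le_mul low) (tsum_sq_rpow_half_le_mul high)).trans
    (le_of_eq ?_)
  rw [← add_mul]
  push_cast
  rfl

theorem lpNorm_block_lt_top {φ : 𝔼 → ℝ} {i : Index} {u : 𝓢'(𝔼, ℂ)} (h : blockNorm φ i u < ⊤)
    (j : ℤ) : lpNorm i.exponent (block φ j u) < ⊤ := by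
  rw [blockNorm, ENNReal.rpow_lt_top_iff_of_pos (by norm_num)] at h
  have h1 := (ENNReal.le_tsum j).trans_lt h
  rw [ENNReal.pow_lt_top_iff] at h1
  have h2 := h1.resolve_right (by norm_num)
  by_contra h3
  rw [not_lt_top_iff.1 h3, ENNReal.mul_top] at h2
  · exact lt_irrefl _ h2
  · rw [Ne, ENNReal.ofReal_eq_zero, not_le]; positivity

theorem exists_dyadicFamily {φ : 𝔼 → ℝ} (hφ : IsDyadicPartition φ) {i : Index}
    (hi : 1 ≤ i.exponent) {u : 𝓢'(𝔼, ℂ)} (h : blockNorm φ i u < ⊤) :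
    ∃ F : ℤ → 𝔼 → ℂ, (∀ j, Represents (block φ j u) (F j)) ∧ DyadicFamily i.exponent F := by
  choose F hF hF' using fun j => exists_represents_of_lpNorm_lt_top (lpNorm_block_lt_top h j)
  exact ⟨F, hF, hF', fun j => hφ.localized hi (hF j) (hF' j)⟩

theorem ofReal_weight_mul_lpNorm {F : 𝔼 → ℂ} {p : ℝ≥0∞} (hF : MemLp F p volume) (w : ℝ) :
    ENNReal.ofReal (((2 : ℝ) ^ w * MeasureTheory.lpNorm F p volume) ^ 2) =
      (ENNReal.ofReal ((2 : ℝ) ^ w) * eLpNorm F p volume) ^ 2 := by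
  have : 0 ≤ MeasureTheory.lpNorm F p volume := lpNorm_nonneg
  rw [ENNReal.ofReal_pow (by positivity), ENNReal.ofReal_mul (by positivity), ofReal_lpNorm hF]

/-- The squares of the weighted norms of a family representing the blocks are summable. -/
theorem summable_besov {φ : 𝔼 → ℝ} {i : Index} {u : 𝓢'(𝔼, ℂ)} (h : blockNorm φ i u < ⊤)
    {F : ℤ → 𝔼 → ℂ} (hF : ∀ j, Represents (block φ j u) (F j))
    (hF' : ∀ j, MemLp (F j) i.exponent volume) :
    Summable fun j => ((2 : ℝ) ^ logWeight i.low i.high j *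
      MeasureTheory.lpNorm (F j) i.exponent volume) ^ 2 := by
  rw [blockNorm, ENNReal.rpow_lt_top_iff_of_pos (by norm_num)] at h
  have h1 := ENNReal.summable_toReal h.ne
  refine h1.congr fun j => ?_
  rw [lpNorm_eq (hF j), ← ofReal_weight_mul_lpNorm (hF' j), ENNReal.toReal_ofReal (sq_nonneg _)]

theorem ofReal_besovSum_le {φ : 𝔼 → ℝ} {i : Index} {u : 𝓢'(𝔼, ℂ)}
    {F : ℤ → 𝔼 → ℂ} (hF : ∀ j, Represents (block φ j u) (F j))
    (hF' : ∀ j, MemLp (F j) i.exponent volume) (J : Finset ℤ) :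
    ENNReal.ofReal (besovSum i.low i.high i.exponent J F) ≤ blockNorm φ i u := by
  rw [besovSum, blockNorm, Real.sqrt_eq_rpow,
    ← ENNReal.ofReal_rpow_of_nonneg (Finset.sum_nonneg fun j _ => sq_nonneg _) (by norm_num)]
  refine ENNReal.rpow_le_rpow ?_ (by norm_num)
  rw [ENNReal.ofReal_sum_of_nonneg fun j _ => sq_nonneg _]
  refine le_trans (le_of_eq ?_) (ENNReal.sum_le_tsum J)
  refine Finset.sum_congr rfl fun j _ => ?_
  rw [lpNorm_eq (hF j), ofReal_weight_mul_lpNorm (hF' j)]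

/-! ### Telescoping of the dyadic partition and convergence of truncations -/

theorem fourier_injective {K L : 𝓢(𝔼, ℂ)} (h : ∀ ξ, 𝓕 K ξ = 𝓕 L ξ) : K = L := by
  have h1 : 𝓕 K = 𝓕 L := by ext ξ; exact h ξ
  have h2 : 𝓕⁻ (𝓕 K) = 𝓕⁻ (𝓕 L) := by rw [h1]
  simpa using h2

/-- The dyadic partition is a telescoping sum. -/
theorem exists_telescoping {χ φ : 𝔼 → ℝ} (hχ : IsLowFreqCutoff χ) (hφ : IsDyadicPartition φ) :
    ∃ L : 𝓢(𝔼, ℂ), ∫ x, L x = 1 ∧ ∀ j, dil j hφ.kernel = dil j L - dil (j - 1) L := by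
  have vanish : ∀ ξ : 𝔼, (‖ξ‖ < 1 / 2 ∨ 2 < ‖ξ‖) → φ ξ = 0 := fun ξ h => by
    by_contra h'
    have := hφ.support ξ h'
    rcases h with h | h <;> linarith
  -- The terms j = 0, -1, -2 of the partition; by the support of φ no others are nonzero for 1/4 <
  -- |ξ| < 1.
  set S : 𝔼 → ℝ := fun ξ => φ ξ + φ ((2 : ℝ) • ξ) + φ ((4 : ℝ) • ξ) with hS
  -- A smooth version of the sum of φ(2^{-j}ξ) over j ≤ 0, extended by 1 through the origin. It
  -- equals 1 for |ξ| < 1/2 and S for |ξ| ≥ 1/2. The function χ serves only as a smooth cutoff: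
  -- χ(4ξ) varies only in 1/4 ≤ |ξ| ≤ 1/2, where the two definitions agree.
  set Φ : 𝔼 → ℝ := fun ξ => χ ((4 : ℝ) • ξ) + (1 - χ ((4 : ℝ) • ξ)) * S ξ with hΦ
  have nsmul : ∀ (c : ℝ) (ξ : 𝔼), 0 ≤ c → ‖c • ξ‖ = c * ‖ξ‖ := fun c ξ hc => by
    rw [norm_smul, Real.norm_of_nonneg hc]
  have hS1 : ∀ ξ : 𝔼, 1 / 4 < ‖ξ‖ → ‖ξ‖ < 1 → S ξ = 1 := fun ξ h1 h2 => by
    have hξ : ξ ≠ 0 := by rintro rfl; norm_num at h1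
    have hsum := hφ.sum_eq_one ξ hξ
    have hfin : HasSum (fun j : ℤ => φ ((2 : ℝ) ^ (-j) • ξ))
        (∑ j ∈ ({0, -1, -2} : Finset ℤ), φ ((2 : ℝ) ^ (-j) • ξ)) := by
      refine hasSum_sum_of_ne_finset_zero fun j hj => ?_
      simp only [Finset.mem_insert, Finset.mem_singleton, not_or] at hj
      apply vanish
      rw [nsmul _ _ (by positivity)]
      rcases lt_or_gt_of_ne hj.1 with h | h
      · right
        have : (2 : ℝ) ^ (3 : ℤ) ≤ 2 ^ (-j) := zpow_le_zpow_right₀ (by norm_num) (by omega)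
        norm_num at this ⊢
        nlinarith
      · left
        have : (2 : ℝ) ^ (-j) ≤ 2 ^ (-1 : ℤ) := zpow_le_zpow_right₀ (by norm_num) (by omega)
        norm_num at this ⊢
        nlinarith [norm_nonneg ξ]
    have := hfin.unique hsum
    rw [← this, hS]
    simp
    norm_num
    ring
  have hΦ1 : ∀ ξ : 𝔼, ‖ξ‖ < 1 / 2 → Φ ξ = 1 := fun ξ h => by
    simp only [hΦ]
    rcases le_or_gt ‖ξ‖ (1 / 4) with h1 | h1
    · rw [hχ.eq_one _ (by rw [nsmul _ _ (by norm_num)]; linarith)]; ring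
    · rw [hS1 ξ h1 (by linarith)]; ring
  have hΦS : ∀ ξ : 𝔼, 1 / 2 ≤ ‖ξ‖ → Φ ξ = S ξ := fun ξ h => by
    simp only [hΦ]
    rw [hχ.eq_zero _ (by rw [nsmul _ _ (by norm_num)]; linarith)]; ring
  have htel : ∀ ξ : 𝔼, φ ξ = Φ ξ - Φ ((2 : ℝ) • ξ) := fun ξ => by
    have h2 := nsmul 2 ξ (by norm_num)
    rcases lt_or_ge ‖ξ‖ (1 / 2) with h | h
    · have e1 : Φ ((2 : ℝ) • ξ) = 1 := by
        rcases lt_or_ge ‖ξ‖ (1 / 4) with h' | h'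
        · exact hΦ1 _ (by rw [h2]; linarith)
        · rw [hΦS _ (by rw [h2]; linarith), hS1 _ (by rw [h2]; linarith) (by rw [h2]; linarith)]
      rw [vanish ξ (Or.inl h), hΦ1 ξ h, e1, sub_self]
    · rw [hΦS ξ h, hΦS _ (by rw [h2]; linarith)]
      have e8 : φ ((4 : ℝ) • (2 : ℝ) • ξ) = 0 := by
        apply vanish
        right
        rw [nsmul _ _ (by norm_num), h2]; linarith
      simp only [hS]
      rw [e8, smul_smul]
      norm_num
  have hφs := hφ.smooth
  have hχs := hχ.smooth
  have hΦs : ContDiff ℝ ∞ Φ := by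
    simp only [hΦ, hS]
    fun_prop
  have hΦc : HasCompactSupport Φ := by
    refine HasCompactSupport.of_support_subset_isCompact (isCompact_closedBall 0 2) fun ξ hξ => ?_
    by_contra hn
    have h2 : 2 < ‖ξ‖ := by simpa using hn
    apply hξ
    rw [hΦS ξ (by linarith)]
    simp only [hS]
    rw [vanish ξ (Or.inr h2), vanish _ (Or.inr (by rw [nsmul _ _ (by norm_num)]; linarith)),
      vanish _ (Or.inr (by rw [nsmul _ _ (by norm_num)]; linarith))]
    ring
  obtain ⟨L, hL⟩ := LittlewoodPaley.exists_isKernel hΦs hΦc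
  refine ⟨L, ?_, fun j => fourier_injective fun ξ => ?_⟩
  · rw [hL.integral_eq, hΦ1 0 (by simp)]; simp
  · rw [hφ.isKernel j, ((hL.dil j).sub (hL.dil (j - 1))) ξ]
    simp only
    rw [htel, smul_smul (2 : ℝ)]
    congr 4
    rw [neg_sub, sub_eq_add_neg, zpow_add₀ (by norm_num), zpow_one]

theorem conv_sub_kernel (K L : 𝓢(𝔼, ℂ)) {F : 𝔼 → ℂ} {p : ℝ≥0∞} (hp : 1 ≤ p)
    (hF : MemLp F p volume) : conv (K - L : 𝓢(𝔼, ℂ)) F = conv K F - conv L F := by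
  ext x
  simp only [conv, Pi.sub_apply, sub_apply, sub_mul]
  exact integral_sub (LittlewoodPaley.integrable_kernel_mul K hp hF x)
    (LittlewoodPaley.integrable_kernel_mul L hp hF x)

theorem sum_Icc_telescoping {M : Type*} [AddCommGroup M] (g : ℤ → M) (N : ℕ) :
    ∑ j ∈ Finset.Icc (-(N : ℤ)) N, (g j - g (j - 1)) = g N - g (-(N : ℤ) - 1) := by
  induction N with
  | zero => simp
  | succ n ih =>
    have h1 : Finset.Icc (-((n + 1 : ℕ) : ℤ)) ((n + 1 : ℕ) : ℤ) =
        insert (-((n + 1 : ℕ) : ℤ)) (insert ((n + 1 : ℕ) : ℤ) (Finset.Icc (-(n : ℤ)) n)) := by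
      ext j
      simp only [Finset.mem_Icc, Finset.mem_insert]
      omega
    rw [h1, Finset.sum_insert, Finset.sum_insert, ih]
    · have e1 : -((n + 1 : ℕ) : ℤ) = -(n : ℤ) - 1 := by push_cast; ring
      have e2 : ((n + 1 : ℕ) : ℤ) - 1 = n := by push_cast; ring
      rw [e1, e2]
      abel
    · simp only [Finset.mem_Icc]; omega
    · simp only [Finset.mem_Icc, Finset.mem_insert]; omega

theorem sum_conv_dil_eq {φ : 𝔼 → ℝ} {hφ : IsDyadicPartition φ} {L : 𝓢(𝔼, ℂ)}
    (hL : ∀ j, dil j hφ.kernel = dil j L - dil (j - 1) L) {F : 𝔼 → ℂ} {p : ℝ≥0∞} (hp : 1 ≤ p)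
    (hF : MemLp F p volume) (N : ℕ) :
    ∑ j ∈ Finset.Icc (-(N : ℤ)) N, conv (dil j hφ.kernel) F =
      conv (dil N L) F - conv (dil (-(N : ℤ) - 1) L) F := by
  rw [← sum_Icc_telescoping (fun j => conv (dil j L) F)]
  refine Finset.sum_congr rfl fun j _ => ?_
  rw [hL, conv_sub_kernel _ _ hp hF]

/-- The truncations of an `L^r` function converge to it in `L^r`. -/
theorem tendsto_eLpNorm_truncation_sub [Nontrivial 𝔼] {χ φ : 𝔼 → ℝ} (hχ : IsLowFreqCutoff χ)
    (hφ : IsDyadicPartition φ) {F : 𝔼 → ℂ} {r : ℝ≥0∞} (hr : 1 < r) (hr' : r ≠ ⊤)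
    (hF : MemLp F r volume) :
    Tendsto (fun N : ℕ => eLpNorm (∑ j ∈ Finset.Icc (-(N : ℤ)) N, conv (dil j hφ.kernel) F - F)
      r volume) atTop (𝓝 0) := by
  obtain ⟨L, hL1, hL⟩ := exists_telescoping hχ hφ
  have h1 := LittlewoodPaley.tendsto_eLpNorm_conv_dil_sub L hL1 hr.le hr' hF
  have h2 := LittlewoodPaley.tendsto_eLpNorm_conv_dil_neg L hr hr' hF
  have h3 := h1.add h2
  rw [add_zero] at h3
  refine tendsto_of_tendsto_of_tendsto_of_le_of_le tendsto_const_nhds h3 (fun _ => zero_le)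
    fun N => ?_
  simp only
  rw [sum_conv_dil_eq hL hr.le hF N, sub_right_comm]
  exact eLpNorm_sub_le ((LittlewoodPaley.aestronglyMeasurable_conv (dil (N : ℤ) L).continuous
    hF.1).sub hF.1) (LittlewoodPaley.aestronglyMeasurable_conv (dil _ L).continuous hF.1) hr.le

/-- The factors are replaced one at a time; each of the three errors is controlled by Hölder. -/
theorem tendsto_integral_mul_mul {r : Fin 3 → ℝ≥0∞} (hr1 : ∀ a, 1 ≤ r a)
    (hr : (r 0)⁻¹ + (r 1)⁻¹ + (r 2)⁻¹ = 1) {F : Fin 3 → 𝔼 → ℂ} {G : ℕ → Fin 3 → 𝔼 → ℂ}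
    (hF : ∀ a, MemLp (F a) (r a) volume) (hG : ∀ N a, MemLp (G N a) (r a) volume)
    (h : ∀ a, Tendsto (fun N => eLpNorm (G N a - F a) (r a) volume) atTop (𝓝 0)) :
    Tendsto (fun N => ∫ x, G N 0 x * G N 1 x * G N 2 x) atTop (𝓝 (∫ x, F 0 x * F 1 x * F 2 x)) := by
  set ν : Fin 3 → (𝔼 → ℂ) → ℝ := fun a f => MeasureTheory.lpNorm f (r a) volume with hν
  have hD : ∀ N a, MemLp (G N a - F a) (r a) volume := fun N a => (hG N a).sub (hF a)
  have hδ : ∀ a, Tendsto (fun N => ν a (G N a - F a)) atTop (𝓝 0) := fun a => by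
    have := (ENNReal.tendsto_toReal ENNReal.zero_ne_top).comp (h a)
    refine this.congr fun N => ?_
    simp only [Function.comp, hν]
    rw [toReal_eLpNorm (hD N a).1]
  have hν0 : ∀ a f, 0 ≤ ν a f := fun a f => lpNorm_nonneg
  have hGle : ∀ N a, ν a (G N a) ≤ ν a (F a) + ν a (G N a - F a) := fun N a => by
    have := MeasureTheory.lpNorm_add_le (g := G N a - F a) (hF a) (hr1 a)
    simpa using this
  rw [tendsto_iff_norm_sub_tendsto_zero]
  have hb : Tendsto (fun N => ν 0 (G N 0 - F 0) * (ν 1 (F 1) + ν 1 (G N 1 - F 1)) *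
      (ν 2 (F 2) + ν 2 (G N 2 - F 2)) + ν 0 (F 0) * ν 1 (G N 1 - F 1) *
      (ν 2 (F 2) + ν 2 (G N 2 - F 2)) + ν 0 (F 0) * ν 1 (F 1) * ν 2 (G N 2 - F 2))
      atTop (𝓝 0) := by
    have h1 := ((hδ 0).mul ((hδ 1).const_add (ν 1 (F 1)))).mul ((hδ 2).const_add (ν 2 (F 2)))
    have h2 := ((hδ 1).const_mul (ν 0 (F 0))).mul ((hδ 2).const_add (ν 2 (F 2)))
    have h3 := (hδ 2).const_mul (ν 0 (F 0) * ν 1 (F 1))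
    simpa using (h1.add h2).add h3
  refine squeeze_zero (fun _ => norm_nonneg _) (fun N => ?_) hb
  have b1 := LittlewoodPaley.norm_integral_mul_mul_le hr (hD N 0) (hG N 1) (hG N 2)
  have b2 := LittlewoodPaley.norm_integral_mul_mul_le hr (hF 0) (hD N 1) (hG N 2)
  have b3 := LittlewoodPaley.norm_integral_mul_mul_le hr (hF 0) (hF 1) (hD N 2)
  have i1 := (LittlewoodPaley.norm_integral_mul_mul_le hr (hG N 0) (hG N 1) (hG N 2)).1
  have i2 := (LittlewoodPaley.norm_integral_mul_mul_le hr (hF 0) (hF 1) (hF 2)).1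
  have e : ∫ x, G N 0 x * G N 1 x * G N 2 x - F 0 x * F 1 x * F 2 x =
      (∫ x, (G N 0 - F 0) x * G N 1 x * G N 2 x) + (∫ x, F 0 x * (G N 1 - F 1) x * G N 2 x) +
        ∫ x, F 0 x * F 1 x * (G N 2 - F 2) x := by
    rw [← integral_add b1.1 b2.1]
    refine Eq.trans ?_ (integral_add (b1.1.add b2.1) b3.1)
    congr 1; ext x
    simp only [Pi.sub_apply]; ring
  rw [← integral_sub i1 i2, e]
  refine norm_add₃_le.trans (add_le_add (add_le_add (b1.2.trans ?_) (b2.2.trans ?_)) b3.2)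
  · have := hν0 0 (G N 0 - F 0)
    exact mul_le_mul (mul_le_mul_of_nonneg_left (hGle N 1) this) (hGle N 2) (hν0 _ _)
      (mul_nonneg this ((hν0 _ _).trans (hGle N 1)))
  · exact mul_le_mul_of_nonneg_left (hGle N 2) (mul_nonneg (hν0 _ _) (hν0 _ _))

/-! ### Existence of the trilinear integral -/

theorem tendsto_Icc_neg : Tendsto (fun N : ℕ => Finset.Icc (-(N : ℤ)) N) atTop atTop := by
  refine tendsto_atTop_finset_of_monotone (fun m n h => Finset.Icc_subset_Icc (by omega) (by omega))
    fun j => ⟨j.natAbs, ?_⟩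
  rw [Finset.mem_Icc]; omega

/-- The part of the square sum of a family outside of `[-N, N]`. -/
theorem exists_besovSum_tail {s t : ℝ} {p : ℝ≥0∞} {F : ℤ → 𝔼 → ℂ}
    (h : Summable fun j => ((2 : ℝ) ^ logWeight s t j *
      MeasureTheory.lpNorm (F j) p volume) ^ 2) :
    ∃ τ : ℕ → ℝ, Tendsto τ atTop (𝓝 0) ∧ ∀ N M : ℕ, N ≤ M →
      besovSum s t p (Finset.Icc (-(M : ℤ)) M \ Finset.Icc (-(N : ℤ)) N) F ≤ τ N := by
  set b : ℤ → ℝ := fun j => ((2 : ℝ) ^ logWeight s t j * MeasureTheory.lpNorm (F j) p volume) ^ 2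
    with hb
  refine ⟨fun N => √(∑' j, b j - ∑ j ∈ Finset.Icc (-(N : ℤ)) N, b j), ?_, fun N M hNM => ?_⟩
  · have h1 := (h.hasSum.comp tendsto_Icc_neg).const_sub (∑' j, b j)
    rw [sub_self] at h1
    have h2 := (Real.continuous_sqrt.tendsto 0).comp h1
    rw [Real.sqrt_zero] at h2
    exact h2
  · refine Real.sqrt_le_sqrt ?_
    rw [le_sub_iff_add_le, Finset.sum_sdiff (Finset.Icc_subset_Icc (by omega) (by omega))]
    exact h.sum_le_tsum _ fun j _ => sq_nonneg _

theorem sum_Icc_eq_add {F : ℤ → 𝔼 → ℂ} {N M : ℕ} (h : N ≤ M) (x : 𝔼) :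
    ∑ j ∈ Finset.Icc (-(M : ℤ)) M, F j x = ∑ j ∈ Finset.Icc (-(N : ℤ)) N, F j x +
      ∑ j ∈ Finset.Icc (-(M : ℤ)) M \ Finset.Icc (-(N : ℤ)) N, F j x := by
  rw [add_comm, Finset.sum_sdiff (Finset.Icc_subset_Icc (by omega) (by omega))]

/-- Convergence of the integrals of the truncated products of three families. -/
theorem exists_tendsto_integral_truncation {C : ℝ} (hC : 0 ≤ C) {p : Fin 3 → ℝ≥0∞}
    {s t : Fin 3 → ℝ} {F : Fin 3 → ℤ → 𝔼 → ℂ}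
    (H : ∀ J : Fin 3 → Finset ℤ,
      Integrable (fun x => (∑ j ∈ J 0, F 0 j x) * (∑ j ∈ J 1, F 1 j x) * ∑ j ∈ J 2, F 2 j x)
        volume ∧
      ‖∫ x, (∑ j ∈ J 0, F 0 j x) * (∑ j ∈ J 1, F 1 j x) * ∑ j ∈ J 2, F 2 j x‖ ≤
        C * ∏ a, besovSum (s a) (t a) (p a) (J a) (F a))
    (hF : ∀ a, Summable fun j => ((2 : ℝ) ^ logWeight (s a) (t a) j *
      MeasureTheory.lpNorm (F a j) (p a) volume) ^ 2)
    {B : Fin 3 → ℝ} (hB : ∀ a J, besovSum (s a) (t a) (p a) J (F a) ≤ B a) :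
    ∃ I : ℂ, Tendsto (fun N : ℕ => ∫ x, (∑ j ∈ Finset.Icc (-(N : ℤ)) N, F 0 j x) *
      (∑ j ∈ Finset.Icc (-(N : ℤ)) N, F 1 j x) * ∑ j ∈ Finset.Icc (-(N : ℤ)) N, F 2 j x)
      atTop (𝓝 I) ∧ ‖I‖ ≤ C * ∏ a, B a := by
  choose τ hτ hτle using fun a => exists_besovSum_tail (hF a)
  have hB0 : ∀ a, 0 ≤ B a := fun a => (LittlewoodPaley.besovSum_nonneg _ _ _ ∅ _).trans (hB a ∅)
  set J : ℕ → Finset ℤ := fun N => Finset.Icc (-(N : ℤ)) N with hJ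
  set T : ℕ → ℂ := fun N => ∫ x, (∑ j ∈ J N, F 0 j x) * (∑ j ∈ J N, F 1 j x) * ∑ j ∈ J N, F 2 j x
    with hT
  -- The difference of two truncated products is a sum of three products, each containing one factor
  -- restricted to frequencies between N and M. The finite estimate with different index sets bounds
  -- it by a tail.
  have hcauchy : CauchySeq T := by
    refine cauchySeq_of_le_tendsto_0' (fun N => C * (τ 0 N * B 1 * B 2) + C * (B 0 * τ 1 N * B 2) +
      C * (B 0 * B 1 * τ 2 N)) (fun N M hNM => ?_) ?_
    · have b0 := H ![J M \ J N, J M, J M]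
      have b1 := H ![J N, J M \ J N, J M]
      have b2 := H ![J N, J N, J M \ J N]
      have i1 := (H fun _ => J M).1
      have i2 := (H fun _ => J N).1
      simp only [Fin.prod_univ_three, Matrix.cons_val_zero, Matrix.cons_val_one,
        Matrix.cons_val] at b0 b1 b2
      rw [dist_comm, dist_eq_norm, hT]
      simp only
      rw [← integral_sub i1 i2]
      have e : ∫ x, (∑ j ∈ J M, F 0 j x) * (∑ j ∈ J M, F 1 j x) * (∑ j ∈ J M, F 2 j x) -
          (∑ j ∈ J N, F 0 j x) * (∑ j ∈ J N, F 1 j x) * (∑ j ∈ J N, F 2 j x) =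
          (∫ x, (∑ j ∈ J M \ J N, F 0 j x) * (∑ j ∈ J M, F 1 j x) * (∑ j ∈ J M, F 2 j x)) +
          (∫ x, (∑ j ∈ J N, F 0 j x) * (∑ j ∈ J M \ J N, F 1 j x) * (∑ j ∈ J M, F 2 j x)) +
          ∫ x, (∑ j ∈ J N, F 0 j x) * (∑ j ∈ J N, F 1 j x) * (∑ j ∈ J M \ J N, F 2 j x) := by
        rw [← integral_add b0.1 b1.1]
        refine Eq.trans ?_ (integral_add (b0.1.add b1.1) b2.1)
        congr 1; ext x
        simp only [hJ]
        rw [sum_Icc_eq_add (F := F 0) hNM x, sum_Icc_eq_add (F := F 1) hNM x,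
          sum_Icc_eq_add (F := F 2) hNM x]
        ring
      rw [e]
      have n0 := fun a J => LittlewoodPaley.besovSum_nonneg (s a) (t a) (p a) J (F a)
      refine norm_add₃_le.trans (add_le_add (add_le_add (b0.2.trans ?_) (b1.2.trans ?_))
        (b2.2.trans ?_))
      · exact mul_le_mul_of_nonneg_left (mul_le_mul (mul_le_mul (hτle 0 N M hNM) (hB 1 _) (n0 _ _)
          ((n0 _ _).trans (hτle 0 N M hNM))) (hB 2 _) (n0 _ _)
          (mul_nonneg ((n0 _ _).trans (hτle 0 N M hNM)) (hB0 1))) hC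
      · exact mul_le_mul_of_nonneg_left (mul_le_mul (mul_le_mul (hB 0 _) (hτle 1 N M hNM) (n0 _ _)
          (hB0 0)) (hB 2 _) (n0 _ _)
          (mul_nonneg (hB0 0) ((n0 _ _).trans (hτle 1 N M hNM)))) hC
      · exact mul_le_mul_of_nonneg_left (mul_le_mul (mul_le_mul (hB 0 _) (hB 1 _) (n0 _ _)
          (hB0 0)) (hτle 2 N M hNM) (n0 _ _) (mul_nonneg (hB0 0) (hB0 1))) hC
    · have h0 := (((hτ 0).mul_const (B 1)).mul_const (B 2)).const_mul C
      have h1 := (((hτ 1).const_mul (B 0)).mul_const (B 2)).const_mul C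
      have h2 := ((hτ 2).const_mul (B 0 * B 1)).const_mul C
      simpa using (h0.add h1).add h2
  obtain ⟨I, hI⟩ := cauchySeq_tendsto_of_complete hcauchy
  refine ⟨I, hI, le_of_tendsto hI.norm (Eventually.of_forall fun N => ?_)⟩
  refine (H fun _ => J N).2.trans (mul_le_mul_of_nonneg_left ?_ hC)
  exact Finset.prod_le_prod (fun a _ => LittlewoodPaley.besovSum_nonneg _ _ _ _ _)
    fun a _ => hB a _

theorem exists_hasTripleIntegral [Nontrivial 𝔼] {χ φ : 𝔼 → ℝ} (hχ : IsLowFreqCutoff χ)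
    (hφ : IsDyadicPartition φ) {p : Fin 3 → ℝ≥0∞} {s t : Fin 3 → ℝ}
    (H : LittlewoodPaley.Admissible d p s t) :
    ∃ C : ℝ≥0, ∀ f : Fin 3 → 𝓢'(𝔼, ℂ), (∀ a, Mem χ φ ⟨s a, t a, p a⟩ (f a)) →
      ∃ I : ℂ, HasTripleIntegral φ f I ∧
        ‖I‖ₑ ≤ C * ∏ a, norm χ φ ⟨s a, t a, p a⟩ (f a) ∧
        ∀ (r : Fin 3 → ℝ≥0∞) (F : Fin 3 → 𝔼 → ℂ),
          (∀ a, 1 < r a ∧ r a < ⊤) → (r 0)⁻¹ + (r 1)⁻¹ + (r 2)⁻¹ = 1 →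
          (∀ a, MemLp (F a) (r a) volume ∧ Represents (f a) (F a)) →
          I = ∫ x, F 0 x * F 1 x * F 2 x := by
  have hp : ∀ a, 1 ≤ p a := fun a => le_trans (by norm_num) (H.two_le a)
  have H' : LittlewoodPaley.Admissible (Module.finrank ℝ 𝔼 : ℝ) p s t := by
    rw [finrank_euclideanSpace_fin]; exact H
  obtain ⟨C₀, hC₀, h₀⟩ := H'.exists_norm_integral_sum_le' (E := 𝔼)
  choose D hD using fun a => exists_blockNorm_le_norm hχ hφ ⟨s a, t a, p a⟩ (hp a)
  refine ⟨C₀.toNNReal * ∏ a, D a, fun f hf => ?_⟩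
  have hblock : ∀ a, blockNorm φ ⟨s a, t a, p a⟩ (f a) < ⊤ := fun a =>
    (hD a (f a)).trans_lt (ENNReal.mul_lt_top ENNReal.coe_lt_top (hf a).1)
  choose F hF hF' using fun a => exists_dyadicFamily hφ (hp a) (hblock a)
  have hsum := fun a => summable_besov (hblock a) (hF a) (hF' a).memLp
  obtain ⟨I, hI, hIle⟩ := exists_tendsto_integral_truncation hC₀ (h₀ F hF') hsum
    (B := fun a => (blockNorm φ ⟨s a, t a, p a⟩ (f a)).toReal) fun a J => by
      rw [← ENNReal.ofReal_le_iff_le_toReal (hblock a).ne]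
      exact ofReal_besovSum_le (hF a) (hF' a).memLp J
  have hrep : ∀ (N : ℕ) a, Represents (truncation φ N (f a))
      (∑ j ∈ Finset.Icc (-(N : ℤ)) N, F a j) := fun N a => Represents.sum _ fun j _ => hF a j
  refine ⟨I, ⟨fun N a => ∑ j ∈ Finset.Icc (-(N : ℤ)) N, F a j, hrep, fun N => ?_, ?_⟩, ?_, ?_⟩
  · simp only [Fin.prod_univ_three, Finset.sum_apply]
    exact (h₀ F hF' fun _ => Finset.Icc (-(N : ℤ)) N).1
  · simp only [Fin.prod_univ_three, Finset.sum_apply]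
    exact hI
  · rw [← ofReal_norm]
    refine (ENNReal.ofReal_le_ofReal hIle).trans ?_
    rw [ENNReal.ofReal_mul hC₀, ENNReal.ofReal_prod_of_nonneg fun a _ => ENNReal.toReal_nonneg,
      ENNReal.coe_mul, mul_assoc, ENNReal.ofNNReal_finsetProd, ← Finset.prod_mul_distrib]
    simp only [ENNReal.ofReal_toReal (hblock _).ne]
    exact mul_le_mul' le_rfl (Finset.prod_le_prod' fun a _ => hD a (f a))
  -- The truncations computed from the blocks agree almost everywhere with those obtained by
  -- convolving the given functions, and the latter converge in the Hölder triple of Lebesgue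
  -- spaces.
  · intro r G hr hr1 hG
    refine tendsto_nhds_unique hI ?_
    set S : ℕ → Fin 3 → 𝔼 → ℂ := fun N a =>
      ∑ j ∈ Finset.Icc (-(N : ℤ)) N, conv (dil j hφ.kernel) (G a) with hS
    have hae : ∀ (N : ℕ) a, (∑ j ∈ Finset.Icc (-(N : ℤ)) N, F a j) =ᵐ[volume] S N a := fun N a =>
      (hrep N a).ae_eq (Represents.sum _ fun j _ => (hG a).2.block hφ (hr a).1.le (hG a).1 j)
    have hlim := tendsto_integral_mul_mul (fun a => (hr a).1.le) hr1 (fun a => (hG a).1)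
      (G := S) (fun N a => memLp_finsetSum' _ fun j _ => LittlewoodPaley.memLp_conv
        (dil j hφ.kernel).continuous (dil j hφ.kernel).integrable (hr a).1.le (hG a).1)
      fun a => tendsto_eLpNorm_truncation_sub hχ hφ (hr a).1 (hr a).2.ne (hG a).1
    refine hlim.congr fun N => integral_congr_ae ?_
    filter_upwards [hae N 0, hae N 1, hae N 2] with x h0 h1 h2
    rw [← h0, ← h1, ← h2]
    simp only [Finset.sum_apply]

/-! ### Products of finite sums, estimated by duality -/

theorem IsDyadicPartition.localized_conv_reflect {φ : 𝔼 → ℝ} (h : IsDyadicPartition φ) (j : ℤ)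
    {D : 𝔼 → ℂ} {p : ℝ≥0∞} (hp : 1 ≤ p) (hD : MemLp D p volume) :
    Localized j (conv (reflect (dil j h.kernel)) D) := by
  obtain ⟨u, hu⟩ := exists_represents hp hD
  have hK := (h.isKernel j).reflect
  have h1 := hu.multiplier hK hp hD
  have h2 := h1.multiplier (LittlewoodPaley.isKernel_annulusKernel.dil j) hp
    (LittlewoodPaley.memLp_conv (SchwartzMap.continuous _) (SchwartzMap.integrable _) hp hD)
  rw [multiplier_multiplier (LittlewoodPaley.isKernel_annulusKernel.dil j) hK] at h2
  refine h1.ae_eq ?_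
  -- The reflected kernel has symbol φ(-·). Although φ need not be even, its support still lies in
  -- the symmetric annulus where the wider cutoff equals 1.
  convert! h2 using 3
  ext ξ
  by_cases hξ : φ ((2 : ℝ) ^ (-j) • -ξ) = 0
  · rw [hξ, zero_mul]
  · have hs := h.support _ hξ
    rw [smul_neg, norm_neg] at hs
    rw [LittlewoodPaley.annulus_eq_one hs.1 hs.2, mul_one]

/-- The blocks of a product of two finite sums of localized functions, estimated by duality. -/
theorem exists_besovSum_conv_mul_le {φ : 𝔼 → ℝ} (hφ : IsDyadicPartition φ) {p₁ p₂ q q' : ℝ≥0∞}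
    {s₁ s₂ t₁ t₂ a b : ℝ} [hqq : q.HolderConjugate q'] (hq : 1 < q) (hq' : q ≠ ⊤)
    (H : LittlewoodPaley.Admissible d ![p₁, p₂, q'] ![s₁, s₂, -a] ![t₁, t₂, -b]) :
    ∃ C : ℝ, 0 ≤ C ∧ ∀ F G : ℤ → 𝔼 → ℂ, DyadicFamily p₁ F → DyadicFamily p₂ G →
      ∀ J L : Finset ℤ,
      MemLp (fun x => (∑ j ∈ J, F j) x * (∑ j ∈ J, G j) x) q volume ∧
      besovSum a b q L
        (fun l => conv (dil l hφ.kernel) fun x => (∑ j ∈ J, F j) x * (∑ j ∈ J, G j) x) ≤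
        C * (besovSum s₁ t₁ p₁ J F * besovSum s₂ t₂ p₂ J G) := by
  have two₁ : 2 ≤ p₁ := H.two_le 0
  have two₂ : 2 ≤ p₂ := H.two_le 1
  have two₃ : 2 ≤ q' := H.two_le 2
  have hp₁ : 1 ≤ p₁ := le_trans (by norm_num) two₁
  have hp₂ : 1 ≤ p₂ := le_trans (by norm_num) two₂
  have hq1' : 1 ≤ q' := le_trans (by norm_num) two₃
  have H' : LittlewoodPaley.Admissible (Module.finrank ℝ 𝔼 : ℝ) ![p₁, p₂, q'] ![s₁, s₂, -a]
      ![t₁, t₂, -b] := by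
    rw [finrank_euclideanSpace_fin]; exact H
  obtain ⟨C, hC, hT⟩ := H'.exists_norm_integral_sum_le' (E := 𝔼)
  set M : ℝ := ∫ x, ‖hφ.kernel x‖ with hM
  have hM0 : 0 ≤ M := integral_nonneg fun x => norm_nonneg _
  refine ⟨C * M, by positivity, fun F G hF hG J L => ?_⟩
  have hle := LittlewoodPaley.inv_add_inv_le_one two₂ two₃
  -- With this exponent, 1/r + 1/p₂ = 1/q; Bernstein puts the first factor in L^r, so the product of
  -- finite sums lies in L^q.
  set r : ℝ≥0∞ := (1 - (p₂⁻¹ + q'⁻¹))⁻¹ with hr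
  have hr1 : r⁻¹ + p₂⁻¹ + q'⁻¹ = 1 := by
    rw [hr, inv_inv, add_assoc, tsub_add_cancel_of_le hle]
  have hqi : q⁻¹ + q'⁻¹ = 1 := by simpa using hqq.inv_add_inv_eq_inv
  have hpr : p₁ ≤ r := by
    have hone := H.one_le
    simp only [Matrix.cons_val_zero, Matrix.cons_val_one, Matrix.cons_val] at hone
    rw [← ENNReal.inv_le_inv, ← ENNReal.toReal_le_toReal (by simp [hr])
      (LittlewoodPaley.inv_ne_top_of_two_le two₁), hr, inv_inv,
      ENNReal.toReal_sub_of_le hle ENNReal.one_ne_top,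
      ENNReal.toReal_add (LittlewoodPaley.inv_ne_top_of_two_le two₂)
        (LittlewoodPaley.inv_ne_top_of_two_le two₃), ENNReal.toReal_one]
    linarith
  obtain ⟨_, -, hBern⟩ := LittlewoodPaley.exists_lpNorm_le_of_localized (E := 𝔼) p₁ r hp₁ hpr
  have hFr : MemLp (∑ j ∈ J, F j) r volume := memLp_finsetSum' _ fun j _ =>
    (hBern j _ (hF.memLp j) (hF.localized j)).1
  have hGp : MemLp (∑ j ∈ J, G j) p₂ volume := memLp_finsetSum' _ fun j _ => hG.memLp j
  have hrq : r⁻¹ + p₂⁻¹ = q⁻¹ := by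
    rw [← hqi] at hr1
    exact (ENNReal.add_left_inj (LittlewoodPaley.inv_ne_top_of_two_le two₃)).1 hr1
  have : ENNReal.HolderTriple r p₂ q := ⟨hrq⟩
  set U : 𝔼 → ℂ := fun x => (∑ j ∈ J, F j) x * (∑ j ∈ J, G j) x with hU
  have hUq : MemLp U q volume := hGp.mul' hFr
  refine ⟨hUq, ?_⟩
  set V : ℤ → 𝔼 → ℂ := fun l => conv (dil l hφ.kernel) U with hV
  have hVq : ∀ l, MemLp (V l) q volume := fun l =>
    LittlewoodPaley.memLp_conv (SchwartzMap.continuous _) (SchwartzMap.integrable _) hq.le hUq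
  choose D hD hD1 hDV using fun l => LittlewoodPaley.exists_dual (q' := q') hq hq' (hVq l)
  set ν : ℤ → ℝ := fun l => MeasureTheory.lpNorm (V l) q volume with hν
  have hν0 : ∀ l, 0 ≤ ν l := fun l => lpNorm_nonneg
  -- Writing w for the weight at l, c = w²ν. Pairing the block with c times its norming functional
  -- gives (wν)², while the dual weight w⁻¹ turns the norm c into wν: this is extremality in
  -- weighted ℓ² duality.
  set c : ℤ → ℝ := fun l => ((2 : ℝ) ^ logWeight a b l) ^ 2 * ν l with hc
  have hc0 : ∀ l, 0 ≤ c l := fun l => mul_nonneg (by positivity) (hν0 l)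
  set D' : ℤ → 𝔼 → ℂ := fun l => (c l : ℂ) • D l with hD'
  have hD'q : ∀ l, MemLp (D' l) q' volume := fun l => (hD l).const_smul _
  have hD'n : ∀ l, MeasureTheory.lpNorm (D' l) q' volume ≤ c l := fun l => by
    rw [hD', MeasureTheory.lpNorm_const_smul, coe_nnnorm, Complex.norm_real,
      Real.norm_of_nonneg (hc0 l)]
    exact mul_le_of_le_one_right (hc0 l) (hD1 l)
  -- Transposing the block operator replaces the pairing of the block with its functional by a
  -- pairing of the product itself with a localized function, as the trilinear estimate requires.
  set h : ℤ → 𝔼 → ℂ := fun l => conv (reflect (dil l hφ.kernel)) (D' l) with hh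
  have hhq : ∀ l, MemLp (h l) q' volume := fun l =>
    LittlewoodPaley.memLp_conv (SchwartzMap.continuous _) (SchwartzMap.integrable _) hq1' (hD'q l)
  have hhd : DyadicFamily q' h := ⟨hhq, fun l => hφ.localized_conv_reflect l hq1' (hD'q l)⟩
  have hhn : ∀ l, MeasureTheory.lpNorm (h l) q' volume ≤ M * c l := fun l => by
    refine le_trans ?_ (mul_le_mul_of_nonneg_left (hD'n l) hM0)
    rw [← ENNReal.ofReal_le_ofReal_iff (mul_nonneg hM0 lpNorm_nonneg), ENNReal.ofReal_mul hM0,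
      ofReal_lpNorm (hhq l), ofReal_lpNorm (hD'q l), hM, ← LittlewoodPaley.eLpNorm_one_eq_ofReal,
      ← LittlewoodPaley.eLpNorm_one_dil l, ← LittlewoodPaley.eLpNorm_reflect]
    exact LittlewoodPaley.eLpNorm_conv_le (SchwartzMap.continuous _) (hD'q l).1 hq1'
  have hpair : ∀ l, ∫ x, U x * h l x = ((c l * ν l : ℝ) : ℂ) := fun l => by
    rw [hh]
    simp only
    rw [← LittlewoodPaley.integral_conv_mul (dil l hφ.kernel) hUq (hD'q l)]
    simp only [hD', Pi.smul_apply, smul_eq_mul]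
    have : ∀ x, conv (dil l hφ.kernel) U x * ((c l : ℂ) * D l x) =
        (c l : ℂ) * (V l x * D l x) := fun x => by simp only [hV]; ring
    simp_rw [this]
    rw [integral_const_mul, hDV l]
    push_cast; rfl
  have hpint : ∀ l, Integrable (fun x => U x * h l x) volume := fun l =>
    memLp_one_iff_integrable.1 ((hhq l).mul' hUq)
  set Y := besovSum a b q L V with hY
  have hY0 : 0 ≤ Y := LittlewoodPaley.besovSum_nonneg _ _ _ _ _
  have hYsq : Y ^ 2 = ∑ l ∈ L, c l * ν l := by
    rw [hY, besovSum, Real.sq_sqrt (Finset.sum_nonneg fun l _ => sq_nonneg _)]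
    exact Finset.sum_congr rfl fun l _ => by simp only [hc, hν]; ring
  have hbes : besovSum (-a) (-b) q' L h ≤ M * Y := by
    rw [hY, besovSum, besovSum, ← Real.sqrt_sq hM0, ← Real.sqrt_mul (sq_nonneg M), Finset.mul_sum]
    refine Real.sqrt_le_sqrt (Finset.sum_le_sum fun l _ => ?_)
    rw [← mul_pow, LittlewoodPaley.logWeight_neg]
    have n0 : 0 ≤ MeasureTheory.lpNorm (h l) q' volume := lpNorm_nonneg
    refine pow_le_pow_left₀ (by positivity) ?_ 2
    calc (2 : ℝ) ^ (-logWeight a b l) * MeasureTheory.lpNorm (h l) q' volume ≤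
        (2 : ℝ) ^ (-logWeight a b l) * (M * c l) := by gcongr; exact hhn l
      _ = M * ((2 : ℝ) ^ logWeight a b l * ν l) := by
        have hw : (0 : ℝ) < 2 ^ logWeight a b l := by positivity
        rw [hc, Real.rpow_neg (by norm_num)]
        field_simp
  have hfam : ∀ i, DyadicFamily (![p₁, p₂, q'] i) (![F, G, h] i) := by
    intro i; fin_cases i
    exacts [hF, hG, hhd]
  have hbound := (hT ![F, G, h] hfam ![J, J, L]).2
  simp only [Fin.prod_univ_three, Matrix.cons_val_zero, Matrix.cons_val_one,
    Matrix.cons_val] at hbound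
  have hint : ∫ x, (∑ j ∈ J, F j x) * (∑ j ∈ J, G j x) * ∑ l ∈ L, h l x = ((Y ^ 2 : ℝ) : ℂ) := by
    rw [hYsq]
    push_cast
    have e1 : ∀ x, (∑ j ∈ J, F j x) * (∑ j ∈ J, G j x) * ∑ l ∈ L, h l x =
        ∑ l ∈ L, U x * h l x := fun x => by
      simp only [hU, Finset.sum_apply, Finset.mul_sum]
    simp_rw [e1]
    rw [integral_finsetSum _ fun l _ => hpint l]
    exact Finset.sum_congr rfl fun l _ => by rw [hpair l]; push_cast; rfl
  rw [hint, Complex.norm_real, Real.norm_of_nonneg (sq_nonneg Y)] at hbound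
  have nF := LittlewoodPaley.besovSum_nonneg s₁ t₁ p₁ J F
  have nG := LittlewoodPaley.besovSum_nonneg s₂ t₂ p₂ J G
  -- The trilinear estimate reads Y² ≤ C‖F‖‖G‖·MY with Y finite, so one factor Y can be cancelled.
  rcases hY0.eq_or_lt with h0 | hpos
  · rw [← h0]; positivity
  · refine le_of_mul_le_mul_right ?_ hpos
    calc Y * Y = Y ^ 2 := by ring
      _ ≤ C * (besovSum s₁ t₁ p₁ J F * besovSum s₂ t₂ p₂ J G * (M * Y)) := by
        refine hbound.trans ?_
        gcongr
      _ = _ := by ring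

/-! ### Sobolev embedding, Fatou's lemma and the full product estimate -/

theorem tendsto_integral_schwartz_mul {r : ℝ≥0∞} (hr : 1 ≤ r) {P : ℕ → 𝔼 → ℂ} {F : 𝔼 → ℂ}
    (hP : ∀ N, MemLp (P N) r volume) (hF : MemLp F r volume)
    (h : Tendsto (fun N => eLpNorm (P N - F) r volume) atTop (𝓝 0)) (ψ : 𝓢(𝔼, ℂ)) :
    Tendsto (fun N => ∫ x, ψ x * P N x) atTop (𝓝 (∫ x, ψ x * F x)) := by
  have := (ENNReal.HolderConjugate.conjExponent hr).symm
  have ht : ENNReal.HolderTriple r.conjExponent r 1 := this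
  refine tendsto_integral_of_L1' _ (integrable_schwartz_mul hr hF ψ).1
    (Eventually.of_forall fun N => integrable_schwartz_mul hr (hP N) ψ) ?_
  have h1 := ENNReal.Tendsto.const_mul h
    (Or.inr (ψ.memLp r.conjExponent (volume : Measure 𝔼)).2.ne)
  rw [mul_zero] at h1
  refine tendsto_of_tendsto_of_tendsto_of_le_of_le tendsto_const_nhds h1 (fun _ => zero_le)
    fun N => ?_
  refine le_trans (le_of_eq ?_) (LittlewoodPaley.eLpNorm_mul_le (p := r.conjExponent) (q := r)
    (r := 1) ψ.continuous.aestronglyMeasurable ((hP N).sub hF).1)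
  congr 1; ext x
  simp only [Pi.sub_apply]; ring

theorem tendsto_truncation_apply {φ : 𝔼 → ℝ} {u : 𝓢'(𝔼, ℂ)}
    (hu : HasSum (fun j : ℤ => block φ j u) u) (ψ : 𝓢(𝔼, ℂ)) :
    Tendsto (fun N => truncation φ N u ψ) atTop (𝓝 (u ψ)) :=
  PointwiseConvergenceCLM.tendsto_iff_forall_tendsto.1 (hu.comp tendsto_Icc_neg) ψ

/-- A distribution which is the sum of its blocks is an `L^r` function if the sums of its blocks
converge in `L^r`. -/
theorem Represents.of_tendsto {φ : 𝔼 → ℝ} {u : 𝓢'(𝔼, ℂ)}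
    (hu : HasSum (fun j : ℤ => HybridBesov.block φ j u) u) {r : ℝ≥0∞} (hr : 1 ≤ r) {P : ℕ → 𝔼 → ℂ}
    {F : 𝔼 → ℂ} (hP : ∀ N, MemLp (P N) r volume) (hPu : ∀ N, Represents (truncation φ N u) (P N))
    (hF : MemLp F r volume)
    (h : Tendsto (fun N => eLpNorm (P N - F) r volume) atTop (𝓝 0)) : Represents u F := by
  refine ⟨hF.locallyIntegrable hr, fun ψ => ⟨integrable_schwartz_mul hr hF ψ, ?_⟩⟩
  refine tendsto_nhds_unique (tendsto_truncation_apply hu ψ) ?_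
  refine (tendsto_integral_schwartz_mul hr hP hF h ψ).congr fun N => ?_
  rw [((hPu N).2 ψ).2]

/-- Sobolev embedding: the partial sums of the blocks converge in `L^r`. -/
theorem exists_tendsto_eLpNorm_sum_sub {s t : ℝ} {p r : ℝ≥0∞} (hp : 2 ≤ p) (hpr : p ≤ r)
    (hr : r ≠ ⊤) (hs : s ≤ d * (p⁻¹.toReal - r⁻¹.toReal)) (ht : d * (p⁻¹.toReal - r⁻¹.toReal) ≤ t)
    {F : ℤ → 𝔼 → ℂ} (hF : DyadicFamily p F)
    (hsum : Summable fun j => ((2 : ℝ) ^ logWeight s t j *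
      MeasureTheory.lpNorm (F j) p volume) ^ 2) :
    (∀ N : ℕ, MemLp (∑ j ∈ Finset.Icc (-(N : ℤ)) N, F j) r volume) ∧
    ∃ G : 𝔼 → ℂ, MemLp G r volume ∧
      Tendsto (fun N : ℕ => eLpNorm (∑ j ∈ Finset.Icc (-(N : ℤ)) N, F j - G) r volume)
        atTop (𝓝 0) := by
  have hp1 : 1 ≤ p := le_trans (by norm_num) hp
  have hr1 : Fact (1 ≤ r) := ⟨hp1.trans hpr⟩
  obtain ⟨_, -, hBern⟩ := LittlewoodPaley.exists_lpNorm_le_of_localized (E := 𝔼) p r hp1 hpr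
  obtain ⟨C, hC, hLP⟩ := LittlewoodPaley.exists_lpNorm_sum_le_sqrt_of_le (E := 𝔼) hp hpr hr
  obtain ⟨τ, hτ, hτle⟩ := exists_besovSum_tail hsum
  have hFr : ∀ j, MemLp (F j) r volume := fun j =>
    (hBern j _ (hF.memLp j) (hF.localized j)).1
  have hmem : ∀ J : Finset ℤ, MemLp (∑ j ∈ J, F j) r volume := fun J =>
    memLp_finsetSum' _ fun j _ => hFr j
  refine ⟨fun N => hmem _, ?_⟩
  have hle : ∀ J : Finset ℤ, MeasureTheory.lpNorm (∑ j ∈ J, F j) r volume ≤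
      C * besovSum s t p J F := fun J => by
    refine (hLP F hF.memLp hF.localized J).trans (mul_le_mul_of_nonneg_left ?_ hC)
    refine Real.sqrt_le_sqrt (Finset.sum_le_sum fun j _ => ?_)
    have h0 : 0 ≤ MeasureTheory.lpNorm (F j) p volume := lpNorm_nonneg
    rw [finrank_euclideanSpace_fin]
    gcongr
    · exact one_le_two
    -- The hypotheses s ≤ d(1/p - 1/r) ≤ t say that the hybrid weight dominates the Sobolev weight
    -- on both sides of frequency 1.
    · unfold logWeight
      split_ifs with hj
      · exact mul_le_mul_of_nonpos_left hs (by exact_mod_cast hj)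
      · exact mul_le_mul_of_nonneg_left ht (by exact_mod_cast (not_le.1 hj).le)
  set P : ℕ → 𝔼 → ℂ := fun N => ∑ j ∈ Finset.Icc (-(N : ℤ)) N, F j with hP
  have hcauchy : CauchySeq fun N : ℕ => (hmem (Finset.Icc (-(N : ℤ)) N)).toLp (P N) := by
    refine cauchySeq_of_le_tendsto_0' (fun N => C * τ N) (fun N M hNM => ?_) ?_
    · rw [dist_comm, dist_eq_norm, ← MemLp.toLp_sub, Lp.norm_toLp]
      have e : P M - P N = ∑ j ∈ Finset.Icc (-(M : ℤ)) M \ Finset.Icc (-(N : ℤ)) N, F j := by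
        simp only [hP]
        rw [sub_eq_iff_eq_add, Finset.sum_sdiff (Finset.Icc_subset_Icc (by omega) (by omega))]
      rw [e, toReal_eLpNorm (hmem _).1]
      exact (hle _).trans (mul_le_mul_of_nonneg_left (hτle N M hNM) hC)
    · simpa using hτ.const_mul C
  obtain ⟨G, hG⟩ := cauchySeq_tendsto_of_complete hcauchy
  refine ⟨G, Lp.memLp G, ?_⟩
  have h2 := (Lp.tendsto_Lp_iff_tendsto_eLpNorm'' P (fun N => hmem _) G (Lp.memLp G)).1 (by
    rw [Lp.toLp_coeFn]; exact hG)
  exact h2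

theorem tendsto_eLpNorm_mul_sub {r₁ r₂ m : ℝ≥0∞} [hm : r₁.HolderTriple r₂ m] (hm1 : 1 ≤ m)
    (hr₂ : 1 ≤ r₂) {P Q : ℕ → 𝔼 → ℂ}
    {F G : 𝔼 → ℂ} (hP : ∀ N, MemLp (P N) r₁ volume) (hQ : ∀ N, MemLp (Q N) r₂ volume)
    (hF : MemLp F r₁ volume) (hG : MemLp G r₂ volume)
    (hPF : Tendsto (fun N => eLpNorm (P N - F) r₁ volume) atTop (𝓝 0))
    (hQG : Tendsto (fun N => eLpNorm (Q N - G) r₂ volume) atTop (𝓝 0)) :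
    Tendsto (fun N => eLpNorm ((fun x => P N x * Q N x) - fun x => F x * G x) m volume)
      atTop (𝓝 0) := by
  have hlim : Tendsto (fun N => eLpNorm (P N - F) r₁ volume *
      (eLpNorm G r₂ volume + eLpNorm (Q N - G) r₂ volume) +
      eLpNorm F r₁ volume * eLpNorm (Q N - G) r₂ volume) atTop (𝓝 0) := by
    have h1 := ENNReal.Tendsto.mul hPF (Or.inr (by simpa using hG.2.ne))
      ((tendsto_const_nhds (x := eLpNorm G r₂ volume)).add hQG) (Or.inr ENNReal.zero_ne_top)
    have h2 := ENNReal.Tendsto.const_mul hQG (Or.inr hF.2.ne)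
    simpa using h1.add h2
  refine tendsto_of_tendsto_of_tendsto_of_le_of_le tendsto_const_nhds hlim (fun _ => zero_le)
    fun N => ?_
  have e : ((fun x => P N x * Q N x) - fun x => F x * G x) =
      (fun x => (P N - F) x * Q N x) + fun x => F x * (Q N - G) x := by
    ext x; simp only [Pi.sub_apply, Pi.add_apply]; ring
  have hQle : eLpNorm (Q N) r₂ volume ≤ eLpNorm G r₂ volume + eLpNorm (Q N - G) r₂ volume := by
    have := eLpNorm_add_le hG.1 ((hQ N).sub hG).1 hr₂
    simpa using this
  simp only
  rw [e]
  refine (eLpNorm_add_le (((hP N).sub hF).1.mul (hQ N).1) (hF.1.mul ((hQ N).sub hG).1) hm1).trans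
    (add_le_add ?_ ?_)
  · exact (LittlewoodPaley.eLpNorm_mul_le ((hP N).sub hF).1 (hQ N).1).trans
      (mul_le_mul' le_rfl hQle)
  · exact LittlewoodPaley.eLpNorm_mul_le hF.1 ((hQ N).sub hG).1

theorem tendsto_conv {m : ℝ≥0∞} (hm : 1 ≤ m) (K : 𝓢(𝔼, ℂ)) {P : ℕ → 𝔼 → ℂ} {U : 𝔼 → ℂ}
    (hP : ∀ N, MemLp (P N) m volume) (hU : MemLp U m volume)
    (h : Tendsto (fun N => eLpNorm (P N - U) m volume) atTop (𝓝 0)) (x : 𝔼) :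
    Tendsto (fun N => conv K (P N) x) atTop (𝓝 (conv K U x)) := by
  have := ENNReal.HolderConjugate.conjExponent hm
  rw [tendsto_iff_edist_tendsto_0]
  have h1 := ENNReal.Tendsto.const_mul h
    (Or.inr (K.memLp m.conjExponent (volume : Measure 𝔼)).2.ne)
  rw [mul_zero] at h1
  refine tendsto_of_tendsto_of_tendsto_of_le_of_le tendsto_const_nhds h1 (fun _ => zero_le)
    fun N => ?_
  simp only
  have e : conv K (P N) x - conv K U x = conv K (P N - U) x := by
    simp only [conv, Pi.sub_apply, mul_sub]
    exact (integral_sub (LittlewoodPaley.integrable_kernel_mul K hm (hP N) x)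
      (LittlewoodPaley.integrable_kernel_mul K hm hU x)).symm
  rw [edist_eq_enorm_sub, e]
  exact LittlewoodPaley.enorm_conv_le_eLpNorm_mul K ((hP N).sub hU).1 x

/-- Fatou's lemma for the counting measure on ℤ, after moving the lower limit through the monotone
continuous map x ↦ (w x)². -/
theorem tsum_sq_liminf_le {w : ℤ → ℝ≥0∞} (hw : ∀ l, w l ≠ ⊤) {a : ℤ → ℕ → ℝ≥0∞} {B : ℝ≥0∞}
    (h : ∀ (L : Finset ℤ) (N : ℕ), ∑ l ∈ L, (w l * a l N) ^ 2 ≤ B) :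
    ∑' l, (w l * liminf (a l) atTop) ^ 2 ≤ B := by
  have h1 : ∀ l, (w l * liminf (a l) atTop) ^ 2 = liminf (fun N => (w l * a l N) ^ 2) atTop :=
    fun l => by
      have hmono : Monotone fun x : ℝ≥0∞ => (w l * x) ^ 2 := fun x y hxy => by
        simp only; gcongr
      have hcont : Continuous fun x : ℝ≥0∞ => (w l * x) ^ 2 :=
        (ENNReal.continuous_pow 2).comp (ENNReal.continuous_const_mul (hw l))
      exact hmono.map_liminf_of_continuousAt (a l) hcont.continuousAt
  simp_rw [h1]
  rw [← lintegral_count]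
  refine (lintegral_liminf_le fun N => measurable_of_countable _).trans ?_
  simp_rw [lintegral_count]
  refine liminf_le_of_le (by isBoundedDefault) fun b hb => ?_
  obtain ⟨N, hN⟩ := hb.exists
  exact hN.trans (ENNReal.summable.tsum_le_of_sum_le fun L => h L N)

theorem reflect_dil (j : ℤ) (K : 𝓢(𝔼, ℂ)) : reflect (dil j K) = dil j (reflect K) := by
  ext x
  simp [LittlewoodPaley.dil_apply]

/-- An `L^m` function, `1 < m < ∞`, is the sum of its Littlewood-Paley blocks. -/
theorem hasSum_block [Nontrivial 𝔼] {χ φ : 𝔼 → ℝ} (hχ : IsLowFreqCutoff χ)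
    (hφ : IsDyadicPartition φ) {m : ℝ≥0∞} (hm : 1 < m) (hm' : m ≠ ⊤) {u : 𝓢'(𝔼, ℂ)} {U : 𝔼 → ℂ}
    (hU : MemLp U m volume) (hu : Represents u U) : HasSum (fun j : ℤ => block φ j u) u := by
  have hconj := ENNReal.HolderConjugate.conjExponent hm.le
  set m' := m.conjExponent with hm'def
  have hm'1 : 1 < m' := by
    have h := hconj.inv_add_inv_eq_inv
    have hne : m⁻¹ ≠ 0 := by simpa using hm'
    rw [inv_one] at h
    rw [← ENNReal.inv_lt_one, ← h, add_comm]
    refine ENNReal.lt_add_right ?_ hne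
    intro htop
    rw [htop] at h
    simp at h
  have hKint : ∫ x, hφ.kernel x = 0 := by
    have h1 := hφ.exists_isKernel.choose_spec.integral_eq
    refine h1.trans ?_
    rw [Complex.ofReal_eq_zero]
    by_contra h0
    have := (hφ.support 0 h0).1
    norm_num at this
  have hRint : ∫ x, reflect hφ.kernel x = 0 := by
    rw [← hKint, ← integral_neg_eq_self]
    simp
  have hblock : ∀ j, Represents (block φ j u) (conv (dil j hφ.kernel) U) := fun j =>
    hu.block hφ hm.le hU j
  have hconv : ∀ j, MemLp (conv (dil j hφ.kernel) U) m volume := fun j =>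
    LittlewoodPaley.memLp_conv (SchwartzMap.continuous _) (SchwartzMap.integrable _) hm.le hU
  refine PointwiseConvergenceCLM.tendsto_iff_forall_tendsto.2 fun ψ => ?_
  -- Tested against ψ, the block can be transposed onto ψ, whose blocks are summable in the
  -- conjugate space. This supplies the unconditional convergence; the symmetric truncations then
  -- only identify the sum.
  have hsummable : Summable fun j : ℤ => block φ j u ψ := by
    have hfin := LittlewoodPaley.tsum_eLpNorm_conv_dil_lt_top (reflect hφ.kernel) ψ hRint hm'1
    refine Summable.of_norm_bounded (g := fun j => (eLpNorm (conv (dil j (reflect hφ.kernel)) ψ)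
      m' volume * eLpNorm U m volume).toReal) ?_ fun j => ?_
    · refine ENNReal.summable_toReal ?_
      rw [ENNReal.tsum_mul_right]
      exact (ENNReal.mul_lt_top hfin hU.2).ne
    · have h1 : block φ j u ψ = ∫ x, conv (dil j (reflect hφ.kernel)) ψ x * U x := by
        rw [((hblock j).2 ψ).2]
        have := hconj.symm
        have h2 := LittlewoodPaley.integral_conv_mul (dil j (reflect hφ.kernel))
          (ψ.memLp m' (volume : Measure 𝔼)) hU
        rw [h2, ← reflect_dil, LittlewoodPaley.reflect_reflect]
      have hmem : MemLp (conv (dil j (reflect hφ.kernel)) ψ) m' volume :=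
        LittlewoodPaley.memLp_conv (SchwartzMap.continuous _) (SchwartzMap.integrable _) hm'1.le
          (ψ.memLp m' volume)
      rw [h1, ← toReal_enorm]
      refine ENNReal.toReal_mono (ENNReal.mul_lt_top hmem.2 hU.2).ne ?_
      have ht : ENNReal.HolderTriple m' m 1 := hconj.symm
      refine (enorm_integral_le_lintegral_enorm _).trans ?_
      rw [← eLpNorm_one_eq_lintegral_enorm]
      exact LittlewoodPaley.eLpNorm_mul_le hmem.1 hU.1
  have hlim := tendsto_integral_schwartz_mul hm.le (P := fun N =>
    ∑ j ∈ Finset.Icc (-(N : ℤ)) N, conv (dil j hφ.kernel) U)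
    (fun N => memLp_finsetSum' _ fun j _ => hconv j) hU
    (tendsto_eLpNorm_truncation_sub hχ hφ hm hm' hU) ψ
  have heq : ∑' j, block φ j u ψ = u ψ := by
    refine tendsto_nhds_unique (hsummable.hasSum.comp tendsto_Icc_neg) ?_
    rw [(hu.2 ψ).2]
    refine hlim.congr fun N => ?_
    have h1 := ((Represents.sum (Finset.Icc (-(N : ℤ)) N) fun j _ => hblock j).2 ψ).2
    rw [← h1]
    simp only [Function.comp]
    exact map_sum (PointwiseConvergenceCLM.evalCLM (RingHom.id ℂ) ℂ ψ) _ _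
  have := hsummable.hasSum
  rw [heq] at this
  refine Tendsto.congr (fun J => ?_) this
  exact (map_sum (PointwiseConvergenceCLM.evalCLM (RingHom.id ℂ) ℂ ψ) (fun j => block φ j u) J).symm

/-- The product estimate in terms of the trilinear one. The two factors are functions in `L^{r₁}`
and `L^{r₂}` by Sobolev embedding. -/
theorem productEstimate_of_admissible [Nontrivial 𝔼] {χ φ : 𝔼 → ℝ} (hχ : IsLowFreqCutoff χ)
    (hφ : IsDyadicPartition φ) {i₁ i₂ i₃ : Index} {q' r₁ r₂ m : ℝ≥0∞}
    [i₃.exponent.HolderConjugate q'] (hq : 1 < i₃.exponent) (hq' : i₃.exponent ≠ ⊤)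
    (H : LittlewoodPaley.Admissible d ![i₁.exponent, i₂.exponent, q'] ![i₁.low, i₂.low, -i₃.low]
      ![i₁.high, i₂.high, -i₃.high])
    (hr₁ : i₁.exponent ≤ r₁) (hr₂ : i₂.exponent ≤ r₂) (hr₁' : r₁ ≠ ⊤) (hr₂' : r₂ ≠ ⊤)
    (hlow₁ : i₁.low ≤ d * (i₁.exponent⁻¹.toReal - r₁⁻¹.toReal))
    (hhigh₁ : d * (i₁.exponent⁻¹.toReal - r₁⁻¹.toReal) ≤ i₁.high)
    (hlow₂ : i₂.low ≤ d * (i₂.exponent⁻¹.toReal - r₂⁻¹.toReal))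
    (hhigh₂ : d * (i₂.exponent⁻¹.toReal - r₂⁻¹.toReal) ≤ i₂.high)
    [hm : r₁.HolderTriple r₂ m] (hm1 : 1 < m) :
    ProductEstimate χ φ i₁ i₂ i₃ := by
  have two₁ : 2 ≤ i₁.exponent := H.two_le 0
  have two₂ : 2 ≤ i₂.exponent := H.two_le 1
  have one₁ : 1 ≤ i₁.exponent := le_trans (by norm_num) two₁
  have one₂ : 1 ≤ i₂.exponent := le_trans (by norm_num) two₂
  have hm' : m ≠ ⊤ := by
    rintro rfl
    have h := hm.inv_add_inv_eq_inv
    simp [hr₁', hr₂'] at h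
  obtain ⟨C, hC, hT⟩ := exists_besovSum_conv_mul_le hφ hq hq' H
  obtain ⟨C₁, hC₁⟩ := exists_blockNorm_le_norm hχ hφ i₁ one₁
  obtain ⟨C₂, hC₂⟩ := exists_blockNorm_le_norm hχ hφ i₂ one₂
  obtain ⟨C₃, hC₃⟩ := exists_norm_le_blockNorm hχ hφ i₃ hq.le
  refine ⟨C₃ * C.toNNReal * C₁ * C₂, fun f g hf hg => ?_⟩
  have hbf : blockNorm φ i₁ f < ⊤ :=
    (hC₁ f).trans_lt (ENNReal.mul_lt_top ENNReal.coe_lt_top hf.1)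
  have hbg : blockNorm φ i₂ g < ⊤ :=
    (hC₂ g).trans_lt (ENNReal.mul_lt_top ENNReal.coe_lt_top hg.1)
  obtain ⟨P, hP, hP'⟩ := exists_dyadicFamily hφ one₁ hbf
  obtain ⟨Q, hQ, hQ'⟩ := exists_dyadicFamily hφ one₂ hbg
  -- The finite Lebesgue exponents r₁ and r₂ make both factors functions and give strong convergence
  -- of the truncated products in L^m. The target exponent need not equal m; its bound is obtained
  -- separately.
  obtain ⟨hPr, F, hF, hPF⟩ := exists_tendsto_eLpNorm_sum_sub two₁ hr₁ hr₁' hlow₁ hhigh₁ hP'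
    (summable_besov hbf hP hP'.memLp)
  obtain ⟨hQr, G, hG, hQG⟩ := exists_tendsto_eLpNorm_sum_sub two₂ hr₂ hr₂' hlow₂ hhigh₂ hQ'
    (summable_besov hbg hQ hQ'.memLp)
  have hfF : Represents f F := Represents.of_tendsto hf.2 (one₁.trans hr₁) hPr
    (fun N => Represents.sum _ fun j _ => hP j) hF hPF
  have hgG : Represents g G := Represents.of_tendsto hg.2 (one₂.trans hr₂) hQr
    (fun N => Represents.sum _ fun j _ => hQ j) hG hQG
  set U : 𝔼 → ℂ := fun x => F x * G x with hU
  have hUm : MemLp U m volume := hG.mul' hF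
  obtain ⟨u, hu⟩ := exists_represents hm1.le hUm
  set V : ℕ → 𝔼 → ℂ := fun N x => (∑ j ∈ Finset.Icc (-(N : ℤ)) N, P j) x *
    (∑ j ∈ Finset.Icc (-(N : ℤ)) N, Q j) x with hV
  have hVm : ∀ N, MemLp (V N) m volume := fun N => (hQr N).mul' (hPr N)
  have hVU := tendsto_eLpNorm_mul_sub hm1.le (one₂.trans hr₂) hPr hQr hF hG hPF hQG
  have hconv := fun (l : ℤ) (x : 𝔼) => tendsto_conv hm1.le (dil l hφ.kernel) hVm hUm hVU x
  have hub : ∀ l, Represents (block φ l u) (conv (dil l hφ.kernel) U) := fun l =>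
    hu.block hφ hm1.le hUm l
  have hVq : ∀ N, MemLp (V N) i₃.exponent volume := fun N => (hT P Q hP' hQ' _ ∅).1
  have hKq : ∀ l N, MemLp (conv (dil l hφ.kernel) (V N)) i₃.exponent volume := fun l N =>
    LittlewoodPaley.memLp_conv (SchwartzMap.continuous _) (SchwartzMap.integrable _) hq.le (hVq N)
  set B : ℝ≥0∞ := ENNReal.ofReal C * (blockNorm φ i₁ f * blockNorm φ i₂ g) with hB
  have hfin : ∀ (L : Finset ℤ) (N : ℕ),
      ∑ l ∈ L, (ENNReal.ofReal ((2 : ℝ) ^ logWeight i₃.low i₃.high l) *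
        eLpNorm (conv (dil l hφ.kernel) (V N)) i₃.exponent volume) ^ 2 ≤ B ^ 2 := fun L N => by
    have h1 := (hT P Q hP' hQ' (Finset.Icc (-(N : ℤ)) N) L).2
    have h2 : ENNReal.ofReal (besovSum i₃.low i₃.high i₃.exponent L
        fun l => conv (dil l hφ.kernel) (V N)) ≤ B := by
      refine (ENNReal.ofReal_le_ofReal h1).trans ?_
      rw [ENNReal.ofReal_mul hC, ENNReal.ofReal_mul (LittlewoodPaley.besovSum_nonneg _ _ _ _ _)]
      exact mul_le_mul' le_rfl (mul_le_mul' (ofReal_besovSum_le hP hP'.memLp _)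
        (ofReal_besovSum_le hQ hQ'.memLp _))
    refine le_trans (le_of_eq ?_) (pow_le_pow_left' h2 2)
    rw [← ENNReal.ofReal_pow (LittlewoodPaley.besovSum_nonneg _ _ _ _ _), besovSum,
      Real.sq_sqrt (Finset.sum_nonneg fun l _ => sq_nonneg _),
      ENNReal.ofReal_sum_of_nonneg fun l _ => sq_nonneg _]
    exact Finset.sum_congr rfl fun l _ => (ofReal_weight_mul_lpNorm (hKq l N) _).symm
  -- For each l the blocks of the truncated products converge pointwise. Fatou is used twice: in x
  -- for each norm, then in l for the square sum, keeping the bound uniform in N.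
  have hbu : blockNorm φ i₃ u ≤ B := by
    rw [← rpow_half_sq B, blockNorm]
    refine ENNReal.rpow_le_rpow ?_ (by norm_num)
    refine le_trans (ENNReal.tsum_le_tsum fun l => ?_)
      (tsum_sq_liminf_le (fun l => ENNReal.ofReal_ne_top) hfin)
    rw [lpNorm_eq (hub l)]
    gcongr
    exact Lp.eLpNorm_lim_le_liminf_eLpNorm (fun N => (hKq l N).1) _ (ae_of_all _ (hconv l))
  have hnorm : norm χ φ i₃ u ≤
      (C₃ * C.toNNReal * C₁ * C₂ : ℝ≥0) * norm χ φ i₁ f * norm χ φ i₂ g := by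
    refine (hC₃ u).trans ?_
    calc (C₃ : ℝ≥0∞) * blockNorm φ i₃ u ≤ C₃ * (ENNReal.ofReal C *
          ((C₁ * norm χ φ i₁ f) * (C₂ * norm χ φ i₂ g))) := by
          refine mul_le_mul' le_rfl (hbu.trans ?_)
          exact mul_le_mul' le_rfl (mul_le_mul' (hC₁ f) (hC₂ g))
      _ = _ := by
          push_cast
          rw [ENNReal.ofReal]
          ring
  refine ⟨u, F, G, hfF, hgG, hu, ⟨hnorm.trans_lt ?_, hasSum_block hχ hφ hm1 hm' hUm hu⟩, hnorm⟩
  exact ENNReal.mul_lt_top (ENNReal.mul_lt_top ENNReal.coe_lt_top hf.1) hg.1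

/-! ### Reduction to inequalities between real indices -/

theorem le_inv_ofReal {p : ℝ≥0∞} {b β : ℝ} (hp : p⁻¹ = ENNReal.ofReal b) (h : β ≤ b) :
    p ≤ (ENNReal.ofReal β)⁻¹ := by
  rw [← ENNReal.inv_le_inv, inv_inv, hp]
  exact ENNReal.ofReal_le_ofReal h

/-- The product estimate with the reciprocals of the exponents as parameters; `β₁` and `β₂` are the
reciprocals of the exponents of Lebesgue spaces containing the factors. -/
theorem productEstimate_of_real [Nontrivial 𝔼] {χ φ : 𝔼 → ℝ} (hχ : IsLowFreqCutoff χ)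
    (hφ : IsDyadicPartition φ) {p₁ p₂ p₃ : ℝ≥0∞} {b₁ b₂ b₃ l₁ l₂ l₃ h₁ h₂ h₃ β₁ β₂ : ℝ}
    (hp₁ : p₁⁻¹ = ENNReal.ofReal b₁) (hp₂ : p₂⁻¹ = ENNReal.ofReal b₂)
    (hp₃ : p₃⁻¹ = ENNReal.ofReal b₃) (hb₁ : b₁ ≤ 1 / 2) (hb₂ : b₂ ≤ 1 / 2) (hb₃ : 1 / 2 ≤ b₃)
    (hb₃' : b₃ < 1) (hb : b₃ ≤ b₁ + b₂)
    (ll₁ : l₁ ≤ d * (b₁ + b₂ - b₃)) (ll₂ : l₂ ≤ d * (b₁ + b₂ - b₃))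
    (ll₃ : -l₃ ≤ d * (b₁ + b₂ - b₃)) (ll : l₁ + l₂ - l₃ ≤ d * (b₁ + b₂ - b₃))
    (hh : d * (b₁ + b₂ - b₃) ≤ h₁ + h₂ - h₃) (hh₁ : h₁ ≤ h₁ + h₂ - h₃) (hh₂ : h₂ ≤ h₁ + h₂ - h₃)
    (hh₃ : -h₃ ≤ h₁ + h₂ - h₃) (lt₁ : l₁ < d * b₁) (lt₂ : l₂ < d * b₂) (lt₃ : -l₃ < d * (1 - b₃))
    (ne₁₂ : b₁ = 1 / 2 → b₂ = 1 / 2 → h₁ + h₂ ≠ 0) (ne₁₃ : b₁ = 1 / 2 → b₃ = 1 / 2 → h₁ ≠ h₃)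
    (ne₂₃ : b₂ = 1 / 2 → b₃ = 1 / 2 → h₂ ≠ h₃)
    (hβ₁ : 0 < β₁) (hβ₁' : β₁ ≤ b₁) (hβ₂ : 0 < β₂) (hβ₂' : β₂ ≤ b₂) (hβ : β₁ + β₂ < 1)
    (lκ₁ : l₁ ≤ d * (b₁ - β₁)) (hκ₁ : d * (b₁ - β₁) ≤ h₁)
    (lκ₂ : l₂ ≤ d * (b₂ - β₂)) (hκ₂ : d * (b₂ - β₂) ≤ h₂) :
    ProductEstimate χ φ ⟨l₁, h₁, p₁⟩ ⟨l₂, h₂, p₂⟩ ⟨l₃, h₃, p₃⟩ := by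
  have b₁0 : 0 ≤ b₁ := by linarith
  have b₂0 : 0 ≤ b₂ := by linarith
  have e₁ : p₁⁻¹.toReal = b₁ := by rw [hp₁, ENNReal.toReal_ofReal b₁0]
  have e₂ : p₂⁻¹.toReal = b₂ := by rw [hp₂, ENNReal.toReal_ofReal b₂0]
  -- The third trilinear slot carries the dual exponent and the negated regularities of the target.
  -- With it, d times the sum of the reciprocals minus 1 becomes d(b₁ + b₂ - b₃).
  set q' : ℝ≥0∞ := (ENNReal.ofReal (1 - b₃))⁻¹ with hq'
  have hqi : q'⁻¹ = ENNReal.ofReal (1 - b₃) := by rw [hq', inv_inv]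
  have e₃ : q'⁻¹.toReal = 1 - b₃ := by rw [hqi, ENNReal.toReal_ofReal (by linarith)]
  have two : ∀ {p : ℝ≥0∞} {b : ℝ}, p⁻¹ = ENNReal.ofReal b → b ≤ 1 / 2 → 2 ≤ p := fun {p b} hp hb => by
    rw [← ENNReal.inv_le_inv, hp]
    refine (ENNReal.ofReal_le_ofReal hb).trans (le_of_eq ?_)
    rw [one_div, ENNReal.ofReal_inv_of_pos (by norm_num)]; norm_num
  have half : ∀ {p : ℝ≥0∞} {b : ℝ}, p⁻¹.toReal = b → p = 2 → b = 1 / 2 := fun {p b} hp h => by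
    rw [← hp, h]; simp
  have hconj : p₃.HolderConjugate q' := ⟨by
    rw [hp₃, hqi, ← ENNReal.ofReal_add (by linarith) (by linarith)]; simp⟩
  set r₁ : ℝ≥0∞ := (ENNReal.ofReal β₁)⁻¹ with hr₁
  set r₂ : ℝ≥0∞ := (ENNReal.ofReal β₂)⁻¹ with hr₂
  have f₁ : r₁⁻¹.toReal = β₁ := by rw [hr₁, inv_inv, ENNReal.toReal_ofReal hβ₁.le]
  have f₂ : r₂⁻¹.toReal = β₂ := by rw [hr₂, inv_inv, ENNReal.toReal_ofReal hβ₂.le]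
  have htriple : ENNReal.HolderTriple r₁ r₂ (ENNReal.ofReal (β₁ + β₂))⁻¹ := ⟨by
    rw [hr₁, hr₂, inv_inv, inv_inv, inv_inv, ENNReal.ofReal_add hβ₁.le hβ₂.le]⟩
  have H : LittlewoodPaley.Admissible d ![p₁, p₂, q'] ![l₁, l₂, -l₃] ![h₁, h₂, -h₃] := by
    have hn : ((1 : ℝ) / 2 = 1 - b₃) → b₃ = 1 / 2 := fun h => by linarith
    refine ⟨?_, ?_, ?_, ?_, ?_, ?_, ?_, ?_⟩
    · intro a; fin_cases a
      exacts [two hp₁ hb₁, two hp₂ hb₂, two hqi (by linarith)]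
    · simp only [Matrix.cons_val_zero, Matrix.cons_val_one, Matrix.cons_val, e₁, e₂, e₃]
      linarith
    · intro a; fin_cases a <;>
        simp only [Matrix.cons_val_zero, Matrix.cons_val_one, Matrix.cons_val, e₁, e₂, e₃,
          Fin.mk_one, Fin.zero_eta, Fin.reduceFinMk] <;> linarith
    · simp only [Matrix.cons_val_zero, Matrix.cons_val_one, Matrix.cons_val, e₁, e₂, e₃]
      linarith
    · simp only [Matrix.cons_val_zero, Matrix.cons_val_one, Matrix.cons_val, e₁, e₂, e₃]
      linarith
    · intro a; fin_cases a <;>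
        simp only [Matrix.cons_val_zero, Matrix.cons_val_one, Matrix.cons_val,
          Fin.mk_one, Fin.zero_eta, Fin.reduceFinMk] <;> linarith
    · intro a; fin_cases a <;>
        simp only [Matrix.cons_val_zero, Matrix.cons_val_one, Matrix.cons_val, e₁, e₂, e₃,
          Fin.mk_one, Fin.zero_eta, Fin.reduceFinMk] <;> assumption
    · intro a a' a'' k1 k2 k3 k4 k5 k6
      exfalso
      fin_cases a' <;> fin_cases a'' <;>
        simp only [Matrix.cons_val_zero, Matrix.cons_val_one, Matrix.cons_val, ne_eq,
          not_true_eq_false, Fin.mk_one, Fin.zero_eta, Fin.reduceFinMk] at k3 k4 k5 k6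
      · exact ne₁₂ (half e₁ k4) (half e₂ k5) k6
      · exact ne₁₃ (half e₁ k4) (hn (half e₃ k5).symm) (by linarith)
      · exact ne₁₂ (half e₁ k5) (half e₂ k4) (by linarith)
      · exact ne₂₃ (half e₂ k4) (hn (half e₃ k5).symm) (by linarith)
      · exact ne₁₃ (half e₁ k5) (hn (half e₃ k4).symm) (by linarith)
      · exact ne₂₃ (half e₂ k5) (hn (half e₃ k4).symm) (by linarith)
  refine productEstimate_of_admissible (q' := q') (r₁ := r₁) (r₂ := r₂)
    (m := (ENNReal.ofReal (β₁ + β₂))⁻¹) hχ hφ ?_ ?_ H (le_inv_ofReal hp₁ hβ₁')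
    (le_inv_ofReal hp₂ hβ₂') ?_ ?_ ?_ ?_ ?_ ?_ ?_
  · rw [← ENNReal.inv_lt_one, hp₃]
    simpa using hb₃'
  · intro h
    simp only at h
    rw [h, ENNReal.inv_top, eq_comm, ENNReal.ofReal_eq_zero] at hp₃
    linarith
  · simp [hr₁, hβ₁]
  · simp [hr₂, hβ₂]
  · simpa only [e₁, f₁] using lκ₁
  · simpa only [e₁, f₁] using hκ₁
  · simpa only [e₂, f₂] using lκ₂
  · simpa only [e₂, f₂] using hκ₂
  · rw [ENNReal.one_lt_inv]
    simpa using hβ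

theorem two_inv_eq_ofReal : (2 : ℝ≥0∞)⁻¹ = ENNReal.ofReal (1 / 2) := by
  rw [one_div, ENNReal.ofReal_inv_of_pos (by norm_num)]; norm_num

end HybridBesov

/-! ### The theorem -/

theorem lemma4p1 (d : ℕ) (hd : 1 ≤ d)
    (χ φ : EuclideanSpace ℝ (Fin d) → ℝ)
    (hχ : HybridBesov.IsLowFreqCutoff χ) (hφ : HybridBesov.IsDyadicPartition φ) :
    -- the trilinear estimate
    (∀ (p : Fin 3 → ℝ≥0∞) (s t b : Fin 3 → ℝ),
      (∀ a, 2 ≤ p a) →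
      (∀ a, b a = ((p a)⁻¹).toReal) →
      (∀ a, max (max 0 (s a)) (s 0 + s 1 + s 2) ≤ d * (b 0 + b 1 + b 2 - 1) ∧
        d * (b 0 + b 1 + b 2 - 1) ≤ t 0 + t 1 + t 2 ∧
        t a ≤ t 0 + t 1 + t 2 ∧
        s a < d * b a) →
      -- the exceptional endpoint, where the estimate would contain the embedding into `L^∞`
      (¬ ∃ a a' a'' : Fin 3, a ≠ a' ∧ a ≠ a'' ∧ a' ≠ a'' ∧
        p a' = 2 ∧ p a'' = 2 ∧ t a' + t a'' = 0 ∧ t a = d * b a) →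
      ∃ C : ℝ≥0, ∀ f : Fin 3 → 𝓢'(EuclideanSpace ℝ (Fin d), ℂ),
        (∀ a, HybridBesov.Mem χ φ ⟨s a, t a, p a⟩ (f a)) →
        ∃ I : ℂ, HybridBesov.HasTripleIntegral φ f I ∧
          ‖I‖ₑ ≤ C * ∏ a, HybridBesov.norm χ φ ⟨s a, t a, p a⟩ (f a) ∧
          -- `I` is the Lebesgue integral of `f₀ f₁ f₂` on Hölder triples of functions
          ∀ (r : Fin 3 → ℝ≥0∞) (F : Fin 3 → EuclideanSpace ℝ (Fin d) → ℂ),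
            (∀ a, 1 < r a ∧ r a < ⊤) → (r 0)⁻¹ + (r 1)⁻¹ + (r 2)⁻¹ = 1 →
            (∀ a, MemLp (F a) (r a) volume ∧ HybridBesov.Represents (f a) (F a)) →
            I = ∫ x, F 0 x * F 1 x * F 2 x) ∧
    -- the bilinear estimates (1)-(5)
    (4 ≤ d → ∀ (s b σ : ℝ) (p p' q : ℝ≥0∞),
      s = d / 2 - 1 → b = 1 / 2 - 1 / d →
      p⁻¹ = ENNReal.ofReal b → p'⁻¹ = ENNReal.ofReal (1 - b) →
      q⁻¹ = ENNReal.ofReal (1 / 2 - 1 / (2 * d)) →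
      |σ| - b ≤ d / 2 - 2 →
      (∀ j k : ℝ, 0 ≤ j → 0 ≤ k → j + k ≤ 1 →
        HybridBesov.ProductEstimate χ φ ⟨σ - b, s - j, 2⟩ ⟨σ - b, s - k, p⟩
          ⟨σ + b, s - j - k, p'⟩) ∧
      HybridBesov.ProductEstimate χ φ ⟨σ, s, 2⟩ ⟨σ - b, s - 1, p⟩ ⟨σ - b, s - 1, 2⟩ ∧
      HybridBesov.ProductEstimate χ φ ⟨σ - b / 2, s, q⟩ ⟨σ - b / 2, s, q⟩ ⟨σ, s, 2⟩ ∧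
      HybridBesov.ProductEstimate χ φ ⟨σ, s, 2⟩ ⟨σ, s, 2⟩ ⟨σ, s, p'⟩ ∧
      HybridBesov.ProductEstimate χ φ ⟨σ, s, 2⟩ ⟨σ - b / 2, s, q⟩ ⟨σ - 1, s - 1 / 2, 2⟩) := by
  have : Nonempty (Fin d) := ⟨⟨0, hd⟩⟩
  have : Nontrivial (EuclideanSpace ℝ (Fin d)) := inferInstance
  have hd0 : (1 : ℝ) ≤ d := by exact_mod_cast hd
  refine ⟨fun p s t b hp hb h hne => ?_, fun hd4 s b σ p p' q hs hb hp hp' hq hσ => ?_⟩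
  · simp only [max_le_iff, hb] at h
    refine HybridBesov.exists_hasTripleIntegral hχ hφ ⟨hp, ?_, fun a => (h a).1.1.2,
      (h 0).1.2, (h 0).2.1, fun a => (h a).2.2.1, fun a => (h a).2.2.2, ?_⟩
    -- Nonnegativity of d(b₀ + b₁ + b₂ - 1) with d > 0 gives b₀ + b₁ + b₂ ≥ 1.
    · have := nonneg_of_mul_nonneg_right (h 0).1.1.1 (by linarith : (0 : ℝ) < d)
      linarith
    · intro a a' a'' h1 h2 h3 h4 h5 h6 h7
      exact hne ⟨a, a', a'', h1, h2, h3, h4, h5, h6, by rw [hb]; exact h7⟩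
  · have hD : (4 : ℝ) ≤ d := by exact_mod_cast hd4
    -- Together with d·e = 1, this makes every index condition linear.
    set e : ℝ := 1 / d with he
    have hDe : (d : ℝ) * e = 1 := by rw [he]; field_simp
    have he0 : 0 < e := by positivity
    have he4 : e ≤ 1 / 4 := by rw [he]; exact one_div_le_one_div_of_le (by norm_num) hD
    have hq' : q⁻¹ = ENNReal.ofReal (1 / 2 - e / 2) := by
      rw [hq, he]; congr 2; field_simp
    have hσ1 := le_abs_self σ
    have hσ2 := neg_abs_le σ
    have h2 := HybridBesov.two_inv_eq_ofReal
    subst hs hb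
    refine ⟨fun j k hj hk hjk => ?_, ?_, ?_, ?_, ?_⟩
    -- Here d(b₁ + b₂ - b₃) = d/2 - 2, the bound in the hypothesis on σ. Both auxiliary Sobolev
    -- embeddings cost d/2 - 2 = s - 1, the least high regularity permitted by j, k ≤ 1.
    · refine HybridBesov.productEstimate_of_real (β₁ := 2 * e) (β₂ := e) hχ hφ h2 hp hp'
        ?_ ?_ ?_ ?_ ?_ ?_ ?_ ?_ ?_ ?_ ?_ ?_ ?_ ?_ ?_ ?_ ?_ ?_ ?_ ?_ ?_ ?_ ?_ ?_ ?_ ?_ ?_ ?_ <;>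
        first | linarith | (intro _ _; linarith)
    -- From here on each β is chosen critically: d times the difference of the reciprocals is
    -- exactly the high regularity of that factor, s or s - 1.
    · refine HybridBesov.productEstimate_of_real (β₁ := e) (β₂ := e) hχ hφ h2 hp h2
        ?_ ?_ ?_ ?_ ?_ ?_ ?_ ?_ ?_ ?_ ?_ ?_ ?_ ?_ ?_ ?_ ?_ ?_ ?_ ?_ ?_ ?_ ?_ ?_ ?_ ?_ ?_ ?_ <;>
        first | linarith | (intro _ _; linarith)
    · refine HybridBesov.productEstimate_of_real (β₁ := e / 2) (β₂ := e / 2) hχ hφ hq' hq' h2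
        ?_ ?_ ?_ ?_ ?_ ?_ ?_ ?_ ?_ ?_ ?_ ?_ ?_ ?_ ?_ ?_ ?_ ?_ ?_ ?_ ?_ ?_ ?_ ?_ ?_ ?_ ?_ ?_ <;>
        first | linarith | (intro _ _; linarith)
    · refine HybridBesov.productEstimate_of_real (β₁ := e) (β₂ := e) hχ hφ h2 h2 hp'
        ?_ ?_ ?_ ?_ ?_ ?_ ?_ ?_ ?_ ?_ ?_ ?_ ?_ ?_ ?_ ?_ ?_ ?_ ?_ ?_ ?_ ?_ ?_ ?_ ?_ ?_ ?_ ?_ <;>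
        first | linarith | (intro _ _; linarith)
    · refine HybridBesov.productEstimate_of_real (β₁ := e) (β₂ := e / 2) hχ hφ h2 hq' h2
        ?_ ?_ ?_ ?_ ?_ ?_ ?_ ?_ ?_ ?_ ?_ ?_ ?_ ?_ ?_ ?_ ?_ ?_ ?_ ?_ ?_ ?_ ?_ ?_ ?_ ?_ ?_ ?_ <;>
        first | linarith | (intro _ _; linarith)
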